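/- Fix $t\in\mathbb C$. **Diagrams.** A partition of size $(k,l)$ is a set partition of $k$ lower and $l$ upper vertices. If $p$ has size $(k,l)$ and $q$ has size $(l,m)$, place $q$ on top of $p$, take connected components, and delete the $l$ middle vertices; this gives the partition $qp$ of size $(k,m)$, and $\ell(q,p)$ denotes the number of components consisting of middle vertices only. Horizontal concatenation is denoted $p\otimes q$. **The category $\underline{\mathrm{Rep}}_0(H_t)$.** Its objects are $[k]$, $k\in\mathbb N$, and $\mathrm{Hom}([k],[l])$ is the $\mathbb C$-vector space with basis the partitions of size $(k,l)$ all of whose blocks have even cardinality. Composition is the bilinear extension of $q\circ p=t^{\ell(q,p)}\,qp$, and $[k]\otimes[l]=[k+l]$ with the tensor product of morphisms induced by horizontal concatenation. The symmetry is given by the partitions that interchange two groups of strands. **The category $\mathrm{Par}(\mathbb Z_2,t)$.** Write $\mathbb Z_2=\{1,-1\}$. Its objects are $[\tilde k]$, $k\in\mathbb N$, and $\mathrm{Hom}([\tilde k],[\tilde l])$ has as basis the equivalence classes of pairs (partition of size $(k,l)$, labelling of the vertices by $\mathbb Z_2$), where two labellings are equivalent if on each block they differ by multiplication with one element of $\mathbb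 Z_2$. To compose $P$ and $Q$, choose representatives whose labels agree at every middle vertex; then $Q\circ P=t^{\ell(Q,P)}$ times the class of the concatenated partition with the remaining labels. If no such representatives exist, $Q\circ P=0$. The symmetric monoidal structure is as above, the symmetry being given by the permutation diagrams with all labels $1$. **Envelopes.** For a $\mathbb C$-linear symmetric monoidal category $\mathcal C$ let $\mathcal C^{\mathrm{Kar}}$ be the idempotent completion of the additive envelope of $\mathcal C$, with the induced $\mathbb C$-linear symmetric monoidal structure. Put $\underline{\mathrm{Rep}}(H_t)=\underline{\mathrm{Rep}}_0(H_t)^{\mathrm{Kar}}$, and let $\iota:\underline{\mathrm{Rep}}_0(H_t)\to\underline{\mathrm{Rep}}(H_t)$ be the canonical embedding. **The functor.** Let $s\in\mathrm{End}([\tilde 1])$ be the strand with labels $-1$ (bottom) and $1$ (top), and let $e'=\tfrac12(\mathrm{id}_{[\tilde 1]}-s)$, an idempotent in $\mathrm{Par}(\mathbb Z_2,2t)$. Put $\Omega_0([k])=([\tilde k],(e')^{\otimes k})$. For an even partition $f$ of size $(k,l)$ with $b(f)$ blocks put $$\Omega_0(f)=2^{\frac{(k+l)-2b(f)}{2}}\,(e')^{\otimes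 l}\circ f\circ(e')^{\otimes k},$$ where on the right $f$ is regarded as a coloured partition with all labels $1$; extend $\Omega_0$ linearly to $\mathrm{Hom}([k],[l])$. **Theorem.** There is an additive functor $\Omega:\underline{\mathrm{Rep}}(H_t)\to\mathrm{Par}(\mathbb Z_2,2t)^{\mathrm{Kar}}$ with $\Omega\circ\iota=\Omega_0$. Every such functor $\Omega$ is $\mathbb C$-linear, satisfies $\Omega([1])=([\tilde 1],e')$, is full, faithful and essentially surjective, hence an equivalence of categories, and carries the structure of a (strong) symmetric monoidal functor. Thus $\Omega$ is an equivalence of $\mathbb C$-linear symmetric monoidal categories. -/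

import Mathlib

namespace PartitionDiagram

variable {X Y K L M : Type}

/-- `b` takes the same value on any two points of a block of `p`. -/
def ConstOnBlocks (p : Setoid X) (b : X → ℤˣ) : Prop :=
  ∀ x y, p x y → b x = b y

/-- Set partitions of the `k` lower vertices together with the `l` upper vertices. -/
abbrev Partition (k l : ℕ) : Type := Setoid (Fin k ⊕ Fin l)

/-- The lower diagram placed on three rows `K`, `L`, `M` (bottom, middle, top). -/
def lowerRows : K ⊕ L → K ⊕ (L ⊕ M) := Sum.map id Sum.inl

/-- The upper diagram placed on three rows `K`, `L`, `M` (bottom, middle, top). -/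
def upperRows : L ⊕ M → K ⊕ (L ⊕ M) := Sum.inr

/-- The bottom and the top row among the three rows. -/
def outerRows : K ⊕ M → K ⊕ (L ⊕ M) := Sum.map id Sum.inr

/-- The equivalence relation on all three rows generated by the two stacked partitions: its classes
are the connected components of the stacking of `q` on top of `p`. -/
def stack (p : Setoid (K ⊕ L)) (q : Setoid (L ⊕ M)) : Setoid (K ⊕ (L ⊕ M)) :=
  Setoid.map p lowerRows ⊔ Setoid.map q upperRows

/-- Vertical concatenation (`q` on top of `p`): remove the middle row from the stacking. -/
def concat (p : Setoid (K ⊕ L)) (q : Setoid (L ⊕ M)) : Setoid (K ⊕ M) :=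
  Setoid.comap outerRows (stack p q)

/-- A connected component of the stacking all of whose vertices lie in the middle row. -/
def IsLoop (p : Setoid (K ⊕ L)) (q : Setoid (L ⊕ M)) (c : Quotient (stack p q)) : Prop :=
  ∀ x : K ⊕ M, Quotient.mk (stack p q) (outerRows x) ≠ c

/-- The number of loops in the stacking of `q` on top of `p`. -/
noncomputable def loopNumber (p : Setoid (K ⊕ L)) (q : Setoid (L ⊕ M)) : ℕ :=
  Nat.card {c : Quotient (stack p q) // IsLoop p q c}

/-- Disjoint union of two partitions. -/
def disjointUnion (p : Setoid X) (q : Setoid Y) : Setoid (X ⊕ Y) where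
  r := Sum.LiftRel p q
  iseqv :=
    { refl := by rintro (x | y) <;> simp [Setoid.refl]
      symm := by
        rintro _ _ (h | h)
        · exact .inl (p.symm h)
        · exact .inr (q.symm h)
      trans := by
        rintro _ _ _ (h | h) (h' | h')
        · exact .inl (p.trans h h')
        · exact .inr (q.trans h h') }

/-- The vertices of a diagram of size `(k + k', l + l')`, sorted into the vertices of the left
diagram of size `(k, l)` and those of the right diagram of size `(k', l')`. -/
def splitVertex {k k' l l' : ℕ} :
    Fin (k + k') ⊕ Fin (l + l') → (Fin k ⊕ Fin l) ⊕ (Fin k' ⊕ Fin l') :=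
  Sum.elim (fun i => Sum.map Sum.inl Sum.inl (finSumFinEquiv.symm i))
    (fun j => Sum.map Sum.inr Sum.inr (finSumFinEquiv.symm j))

/-- Horizontal concatenation. -/
def juxtapose {k k' l l' : ℕ} (p : Partition k l) (q : Partition k' l') :
    Partition (k + k') (l + l') :=
  Setoid.comap splitVertex (disjointUnion p q)

/-- The partition with blocks `{i, (σ i)'}`. -/
def permPartition {k l : ℕ} (σ : Fin k ≃ Fin l) : Partition k l :=
  Setoid.ker (Sum.elim σ id)

/-- All blocks have an even number of elements. -/
def IsEven (p : Setoid X) : Prop :=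
  ∀ x, Even (Nat.card {y // p x y})

/-! ### Functions that are constant on blocks -/

theorem constOnBlocks_iff_le_ker {p : Setoid X} {b : X → ℤˣ} :
    ConstOnBlocks p b ↔ p ≤ Setoid.ker b :=
  ⟨fun h _ _ => h _ _, fun h _ _ hxy => h hxy⟩

theorem constOnBlocks_map {p : Setoid X} {f : X → Y} {b : Y → ℤˣ} :
    ConstOnBlocks (Setoid.map p f) b ↔ ConstOnBlocks p (b ∘ f) := by
  constructor
  · intro h x y hxy
    exact h _ _ (Relation.EqvGen.rel _ _ ⟨x, y, hxy, rfl, rfl⟩)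
  · intro h
    rw [constOnBlocks_iff_le_ker]
    refine Setoid.eqvGen_le ?_
    rintro _ _ ⟨x, y, hxy, rfl, rfl⟩
    exact h x y hxy

theorem constOnBlocks_sup {p q : Setoid X} {b : X → ℤˣ} :
    ConstOnBlocks (p ⊔ q) b ↔ ConstOnBlocks p b ∧ ConstOnBlocks q b := by
  simp only [constOnBlocks_iff_le_ker, sup_le_iff]

theorem constOnBlocks_stack {p : Setoid (K ⊕ L)} {q : Setoid (L ⊕ M)}
    {i : K → ℤˣ} {m : L → ℤˣ} {j : M → ℤˣ} :
    ConstOnBlocks (stack p q) (Sum.elim i (Sum.elim m j)) ↔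
      ConstOnBlocks p (Sum.elim i m) ∧ ConstOnBlocks q (Sum.elim m j) := by
  rw [stack, constOnBlocks_sup, constOnBlocks_map, constOnBlocks_map]
  have h1 : (Sum.elim i (Sum.elim m j)) ∘ (lowerRows : K ⊕ L → K ⊕ (L ⊕ M)) = Sum.elim i m := by
    ext (x | x) <;> rfl
  have h2 : (Sum.elim i (Sum.elim m j)) ∘ (upperRows : L ⊕ M → K ⊕ (L ⊕ M)) = Sum.elim m j := by
    ext (x | x) <;> rfl
  rw [h1, h2]

theorem constOnBlocks_one (p : Setoid X) : ConstOnBlocks p 1 := fun _ _ _ => rfl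

theorem ConstOnBlocks.mul {p : Setoid X} {b c : X → ℤˣ} (hb : ConstOnBlocks p b)
    (hc : ConstOnBlocks p c) : ConstOnBlocks p (b * c) := fun x y h => by
  simp [hb x y h, hc x y h]

theorem mul_self_one (b : X → ℤˣ) : b * b = 1 := by
  ext x; simp

theorem constOnBlocks_mul_iff {p : Setoid X} {b c : X → ℤˣ} (hc : ConstOnBlocks p c) :
    ConstOnBlocks p (b * c) ↔ ConstOnBlocks p b :=
  ⟨fun h => by simpa [mul_assoc, mul_self_one] using h.mul hc, fun h => h.mul hc⟩

open Classical in
theorem constOnBlocks_indicator (p : Setoid X) (x : X) :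
    ConstOnBlocks p (fun w => if p x w then -1 else 1) := fun y z h => by
  have : p x y ↔ p x z := ⟨fun h' => p.trans h' h, fun h' => p.trans h' (p.symm h)⟩
  simp [this]

theorem le_of_constOnBlocks {p q : Setoid X}
    (h : ∀ b, ConstOnBlocks q b → ConstOnBlocks p b) : p ≤ q := by
  classical
  intro x y hxy
  have := h _ (constOnBlocks_indicator q x) x y hxy
  by_contra hn
  simp [hn] at this

theorem eq_of_constOnBlocks {p q : Setoid X}
    (h : ∀ b, ConstOnBlocks p b ↔ ConstOnBlocks q b) : p = q :=
  le_antisymm (le_of_constOnBlocks fun b => (h b).2) (le_of_constOnBlocks fun b => (h b).1)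

open Classical in
/-- Labellings of the middle row extending a given labelling of the outer rows are counted by the
loops. -/
theorem card_middle [Finite L] (p : Setoid (K ⊕ L)) (q : Setoid (L ⊕ M))
    (i : K → ℤˣ) (j : M → ℤˣ) :
    Nat.card {m : L → ℤˣ // ConstOnBlocks p (Sum.elim i m) ∧ ConstOnBlocks q (Sum.elim m j)} =
      if ConstOnBlocks (concat p q) (Sum.elim i j) then 2 ^ loopNumber p q else 0 := by
  split_ifs with h
  · have hout : ∀ x y : K ⊕ M, stack p q (outerRows x) (outerRows y) →
        Sum.elim i j x = Sum.elim i j y := h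
    let B : Quotient (stack p q) → ℤˣ := fun c =>
      if hc : ∃ x : K ⊕ M, Quotient.mk (stack p q) (outerRows x) = c
        then Sum.elim i j hc.choose else 1
    have hB : ∀ x : K ⊕ M, B (Quotient.mk _ (outerRows x)) = Sum.elim i j x := by
      intro x
      have hc : ∃ y : K ⊕ M, Quotient.mk (stack p q) (outerRows y) =
        Quotient.mk (stack p q) (outerRows x) := ⟨x, rfl⟩
      simp only [B, dif_pos hc]
      exact hout _ _ (Quotient.exact hc.choose_spec)
    let toM : ({c : Quotient (stack p q) // IsLoop p q c} → ℤˣ) → Quotient (stack p q) → ℤˣ :=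
      fun φ c => if hc : IsLoop p q c then φ ⟨c, hc⟩ else B c
    have htoM : ∀ φ, (toM φ) ∘ Quotient.mk (stack p q) =
        Sum.elim i (Sum.elim (fun l => toM φ (Quotient.mk _ (.inr (.inl l)))) j) := by
      intro φ
      have hx : ∀ x : K ⊕ M, toM φ (Quotient.mk _ (outerRows x)) = Sum.elim i j x := by
        intro x
        have hn : ¬ IsLoop p q (Quotient.mk _ (outerRows x)) := fun hl => hl x rfl
        simp only [toM, dif_neg hn, hB]
      ext (x | x | x)
      · simpa [outerRows] using congrArg Units.val (hx (.inl x))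
      · rfl
      · simpa [outerRows] using congrArg Units.val (hx (.inr x))
    have key : ({c : Quotient (stack p q) // IsLoop p q c} → ℤˣ) ≃
        {m : L → ℤˣ // ConstOnBlocks p (Sum.elim i m) ∧ ConstOnBlocks q (Sum.elim m j)} :=
      { toFun := fun φ => ⟨fun l => toM φ (Quotient.mk _ (.inr (.inl l))), by
          rw [← constOnBlocks_stack, ← htoM]
          intro x y hxy
          exact congrArg (toM φ) (Quotient.sound hxy)⟩
        invFun := fun m c => Quotient.lift _ (constOnBlocks_stack.2 m.2) c.1
        left_inv := by
          intro φ
          ext ⟨c, hc⟩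
          congr 1
          have : ∀ d, Quotient.lift _ (constOnBlocks_stack.2 (show
              ConstOnBlocks p (Sum.elim i fun l => toM φ (Quotient.mk _ (.inr (.inl l)))) ∧
              ConstOnBlocks q (Sum.elim (fun l => toM φ (Quotient.mk _ (.inr (.inl l)))) j) by
                rw [← constOnBlocks_stack, ← htoM]
                intro x y hxy
                exact congrArg (toM φ) (Quotient.sound hxy))) d = toM φ d := by
            intro d
            induction d using Quotient.inductionOn with
            | h x => exact (congrFun (htoM φ) x).symm
          refine (this c).trans ?_
          simp only [toM, dif_pos hc]
        right_inv := by
          rintro ⟨m, hm⟩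
          ext l
          simp only
          congr 1
          by_cases hc : IsLoop p q (Quotient.mk _ (.inr (.inl l)))
          · simp only [toM, dif_pos hc]
            rfl
          · simp only [toM, dif_neg hc]
            simp only [IsLoop, not_forall, not_not] at hc
            obtain ⟨x, hx⟩ := hc
            rw [← hx, hB]
            have := constOnBlocks_stack.2 hm _ _ (Quotient.exact hx)
            rcases x with x | x <;> simpa [outerRows] using this }
    have hfin : Finite {c : Quotient (stack p q) // IsLoop p q c} := by
      have : Function.Surjective (fun l : {l : L // IsLoop p q (Quotient.mk _ (.inr (.inl l)))} =>
          (⟨Quotient.mk _ (.inr (.inl l.1)), l.2⟩ :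
            {c : Quotient (stack p q) // IsLoop p q c})) := by
        rintro ⟨c, hc⟩
        induction c using Quotient.inductionOn with
        | h x =>
          rcases x with x | x | x
          · exact absurd rfl (hc (.inl x))
          · exact ⟨⟨x, hc⟩, rfl⟩
          · exact absurd rfl (hc (.inr x))
      exact Finite.of_surjective _ this
    rw [← Nat.card_congr key, Nat.card_fun, loopNumber]
    simp
  · have : IsEmpty {m : L → ℤˣ //
        ConstOnBlocks p (Sum.elim i m) ∧ ConstOnBlocks q (Sum.elim m j)} := by
      refine ⟨fun m => h ?_⟩
      have := constOnBlocks_stack.2 m.2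
      intro x y hxy
      have := this _ _ hxy
      rcases x with x | x <;> rcases y with y | y <;> simpa [outerRows] using this
    simp

theorem constOnBlocks_juxtapose {k k' l l' : ℕ} {p : Partition k l} {q : Partition k' l'}
    {i : Fin (k + k') → ℤˣ} {j : Fin (l + l') → ℤˣ} :
    ConstOnBlocks (juxtapose p q) (Sum.elim i j) ↔
      ConstOnBlocks p (Sum.elim (i ∘ Fin.castAdd k') (j ∘ Fin.castAdd l')) ∧
      ConstOnBlocks q (Sum.elim (i ∘ Fin.natAdd k) (j ∘ Fin.natAdd l)) := by
  have hL : ∀ x y, juxtapose p q (Sum.map (Fin.castAdd k') (Fin.castAdd l') x)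
      (Sum.map (Fin.castAdd k') (Fin.castAdd l') y) ↔ p x y := by
    intro x y
    change Sum.LiftRel p q _ _ ↔ _
    rcases x with x | x <;> rcases y with y | y <;> simp [splitVertex]
  have hR : ∀ x y, juxtapose p q (Sum.map (Fin.natAdd k) (Fin.natAdd l) x)
      (Sum.map (Fin.natAdd k) (Fin.natAdd l) y) ↔ q x y := by
    intro x y
    change Sum.LiftRel p q _ _ ↔ _
    rcases x with x | x <;> rcases y with y | y <;> simp [splitVertex]
  have hLR : ∀ x y, ¬ juxtapose p q (Sum.map (Fin.castAdd k') (Fin.castAdd l') x)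
      (Sum.map (Fin.natAdd k) (Fin.natAdd l) y) := by
    intro x y
    change ¬ Sum.LiftRel p q _ _
    rcases x with x | x <;> rcases y with y | y <;> simp [splitVertex]
  have hsurj : ∀ x : Fin (k + k') ⊕ Fin (l + l'),
      (∃ y, Sum.map (Fin.castAdd k') (Fin.castAdd l') y = x) ∨
      (∃ y, Sum.map (Fin.natAdd k) (Fin.natAdd l) y = x) := by
    rintro (x | x)
    · refine Fin.addCases (fun x => Or.inl ⟨.inl x, rfl⟩) (fun x => Or.inr ⟨.inl x, rfl⟩) x
    · refine Fin.addCases (fun x => Or.inl ⟨.inr x, rfl⟩) (fun x => Or.inr ⟨.inr x, rfl⟩) x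
  have eL : Sum.elim (i ∘ Fin.castAdd k') (j ∘ Fin.castAdd l') =
      Sum.elim i j ∘ Sum.map (Fin.castAdd k') (Fin.castAdd l') := by
    ext (x | x) <;> rfl
  have eR : Sum.elim (i ∘ Fin.natAdd k) (j ∘ Fin.natAdd l) =
      Sum.elim i j ∘ Sum.map (Fin.natAdd k) (Fin.natAdd l) := by
    ext (x | x) <;> rfl
  rw [eL, eR]
  constructor
  · exact fun h => ⟨fun x y hxy => h _ _ ((hL x y).2 hxy), fun x y hxy => h _ _ ((hR x y).2 hxy)⟩
  · rintro ⟨h, h'⟩ x y hxy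
    rcases hsurj x with ⟨x, rfl⟩ | ⟨x, rfl⟩ <;> rcases hsurj y with ⟨y, rfl⟩ | ⟨y, rfl⟩
    · exact h _ _ ((hL x y).1 hxy)
    · exact absurd hxy (hLR _ _)
    · exact absurd ((juxtapose p q).symm hxy) (hLR _ _)
    · exact h' _ _ ((hR x y).1 hxy)

theorem constOnBlocks_permPartition {k l : ℕ} {σ : Fin k ≃ Fin l} {i : Fin k → ℤˣ}
    {j : Fin l → ℤˣ} : ConstOnBlocks (permPartition σ) (Sum.elim i j) ↔ i = j ∘ σ := by
  constructor
  · intro h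
    ext x
    exact congrArg Units.val (h (.inl x) (.inr (σ x)) rfl)
  · rintro rfl
    have : Sum.elim (j ∘ σ) j = j ∘ Sum.elim σ id := by ext (x | x) <;> rfl
    rw [this]
    intro x y hxy
    exact congrArg j hxy

open Classical in
theorem isEven_iff [Fintype X] {p : Setoid X} :
    IsEven p ↔ ∀ b : X → ℤˣ, ConstOnBlocks p b → ∏ x, b x = 1 := by
  constructor
  · intro h b hb
    refine Finset.prod_cancels_of_partition_cancels p fun x _ => ?_
    rw [Finset.prod_congr rfl (g := fun _ => b x)
      (fun y hy => hb y x (Finset.mem_filter.1 hy).2), Finset.prod_const]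
    have hx := h x
    rw [Nat.card_eq_fintype_card, Fintype.card_subtype] at hx
    have e : (Finset.univ.filter fun y => p x y) = Finset.univ.filter fun y => p y x := by
      ext y; simp [p.comm']
    rw [e] at hx
    obtain ⟨r, hr⟩ := hx
    rw [hr, pow_add, Int.units_mul_self]
  · intro h x
    have := h _ (constOnBlocks_indicator p x)
    rw [Finset.prod_ite, Finset.prod_const, Finset.prod_const_one, mul_one] at this
    rw [Nat.card_eq_fintype_card, Fintype.card_subtype]
    by_contra hn
    rw [Nat.not_even_iff_odd] at hn
    rw [hn.neg_one_pow] at this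
    exact absurd this (by decide)

theorem IsEven.concat {k l m : ℕ} {p : Partition k l} {q : Partition l m} (hp : IsEven p)
    (hq : IsEven q) : IsEven (concat p q) := by
  rw [isEven_iff] at *
  intro b hb
  have hb' : Sum.elim (b ∘ Sum.inl) (b ∘ Sum.inr) = b := by ext (x | x) <;> rfl
  have hc := card_middle p q (b ∘ Sum.inl) (b ∘ Sum.inr)
  rw [hb', if_pos hb] at hc
  have : 0 < Nat.card {m : Fin l → ℤˣ // ConstOnBlocks p (Sum.elim (b ∘ Sum.inl) m) ∧
      ConstOnBlocks q (Sum.elim m (b ∘ Sum.inr))} := by rw [hc]; positivity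
  obtain ⟨⟨m, h1, h2⟩⟩ := (Nat.card_pos_iff.1 this).1
  have h1 := hp _ h1
  have h2 := hq _ h2
  rw [Fintype.prod_sum_type] at *
  simp only [Sum.elim_inl, Sum.elim_inr, Function.comp_apply] at h1 h2
  have := congrArg₂ (· * ·) h1 h2
  simpa [mul_assoc, ← mul_assoc (∏ x, m x), Int.units_mul_self] using this

theorem IsEven.juxtapose {k k' l l' : ℕ} {p : Partition k l} {q : Partition k' l'} (hp : IsEven p)
    (hq : IsEven q) : IsEven (juxtapose p q) := by
  rw [isEven_iff] at *
  intro b hb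
  have hb' : Sum.elim (b ∘ Sum.inl) (b ∘ Sum.inr) = b := by ext (x | x) <;> rfl
  rw [← hb', constOnBlocks_juxtapose] at hb
  have h1 := hp _ hb.1
  have h2 := hq _ hb.2
  rw [Fintype.prod_sum_type] at *
  simp only [Sum.elim_inl, Sum.elim_inr, Function.comp_apply] at h1 h2
  rw [Fin.prod_univ_add, Fin.prod_univ_add, mul_mul_mul_comm, h1, h2, one_mul]

theorem isEven_permPartition {k l : ℕ} (σ : Fin k ≃ Fin l) : IsEven (permPartition σ) := by
  rw [isEven_iff]
  intro b hb
  have hb' : Sum.elim (b ∘ Sum.inl) (b ∘ Sum.inr) = b := by ext (x | x) <;> rfl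
  rw [← hb', constOnBlocks_permPartition] at hb
  rw [Fintype.prod_sum_type]
  have h : ∀ x, b (Sum.inl x) = b (Sum.inr (σ x)) := fun x => congrFun hb x
  simp only [h]
  rw [Equiv.prod_comp σ (fun y => b (Sum.inr y)), Int.units_mul_self]

/-- Even partitions of size `(k, l)`. -/
abbrev EvenPartition (k l : ℕ) : Type := {p : Partition k l // IsEven p}

/-! ### Coloured partitions -/

/-- A partition of `X` together with a label in `ℤˣ = {1, -1}` at every element of `X`. -/
abbrev Labelled (X : Type) : Type := Setoid X × (X → ℤˣ)

/-- Two labelled partitions are equivalent if the underlying partitions agree and the labels differ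
on every block by multiplication with one element of `{1, -1}`. -/
instance labelledSetoid (X : Type) : Setoid (Labelled X) where
  r a b := a.1 = b.1 ∧ ∃ c : X → ℤˣ, ConstOnBlocks a.1 c ∧ b.2 = c * a.2
  iseqv :=
    { refl := fun a => ⟨rfl, 1, constOnBlocks_one _, (one_mul _).symm⟩
      symm := by
        rintro ⟨p, z⟩ ⟨q, w⟩ ⟨h, c, hc, hw⟩
        dsimp only at h hc hw
        subst h hw
        exact ⟨rfl, c, hc, by rw [← mul_assoc, mul_self_one, one_mul]⟩
      trans := by
        rintro ⟨p, z⟩ ⟨q, w⟩ ⟨r, v⟩ ⟨h, c, hc, hw⟩ ⟨h', d, hd, hv⟩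
        dsimp only at h hc hw h' hd hv
        subst h hw h' hv
        exact ⟨rfl, d * c, hd.mul hc, (mul_assoc _ _ _).symm⟩ }

/-- Equivalence classes of `ℤ/2`-coloured partitions of size `(k, l)`. -/
abbrev ColouredPartition (k l : ℕ) : Type := Quotient (labelledSetoid (Fin k ⊕ Fin l))

/-- Compatibility for stacking `b` on top of `a`: the products of the two labels at the middle
vertices agree on each block of the upper partition. -/
def Compatible (a : Labelled (K ⊕ L)) (b : Labelled (L ⊕ M)) : Prop :=
  ∀ i j : L, b.1 (.inl i) (.inl j) → a.2 (.inr i) * b.2 (.inl i) = a.2 (.inr j) * b.2 (.inl j)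

open Classical in
/-- Vertical concatenation (`b` on top of `a`) of labelled partitions: a lower vertex keeps its
label, and the label of an upper vertex is multiplied by the product of the two labels at a middle
vertex which is connected to it in the upper partition, if there is one. -/
noncomputable def labelledConcat (a : Labelled (K ⊕ L)) (b : Labelled (L ⊕ M)) :
    Labelled (K ⊕ M) :=
  (concat a.1 b.1, Sum.elim (fun i => a.2 (.inl i)) fun j => b.2 (.inr j) *
    if h : ∃ l : L, b.1 (.inl l) (.inr j) then a.2 (.inr h.choose) * b.2 (.inl h.choose) else 1)

open Classical in
/-- Vertical concatenation of classes: `none` if there are no compatible representatives. -/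
noncomputable def colouredConcat {k l m : ℕ} (P : ColouredPartition k l)
    (Q : ColouredPartition l m) : Option (ColouredPartition k m) :=
  if h : ∃ ab : Labelled (Fin k ⊕ Fin l) × Labelled (Fin l ⊕ Fin m),
      Quotient.mk _ ab.1 = P ∧ Quotient.mk _ ab.2 = Q ∧ Compatible ab.1 ab.2
  then some (Quotient.mk _ (labelledConcat h.choose.1 h.choose.2)) else none

/-- The underlying partition of a coloured partition. -/
def underlying {k l : ℕ} (P : ColouredPartition k l) : Partition k l :=
  Quotient.lift (fun a : Labelled _ => a.1) (fun a b (h : labelledSetoid _ a b) => h.1) P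

/-- Horizontal concatenation of labelled partitions. -/
def labelledJuxtapose {k k' l l' : ℕ} (a : Labelled (Fin k ⊕ Fin l))
    (b : Labelled (Fin k' ⊕ Fin l')) : Labelled (Fin (k + k') ⊕ Fin (l + l')) :=
  (juxtapose a.1 b.1, Sum.elim a.2 b.2 ∘ splitVertex)

/-- The labellings `b` such that the product of `b` with the labels is constant on blocks. -/
def Labels (a : Labelled X) (b : X → ℤˣ) : Prop := ConstOnBlocks a.1 (b * a.2)

theorem labels_iff_of_equiv {a a' : Labelled X} (h : labelledSetoid X a a') (b : X → ℤˣ) :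
    Labels a b ↔ Labels a' b := by
  obtain ⟨p, z⟩ := a
  obtain ⟨q, w⟩ := a'
  obtain ⟨h, c, hc, hw⟩ := h
  dsimp only at h hc hw
  subst h hw
  have : b * (c * z) = (b * z) * c := by rw [mul_assoc, mul_comm c]
  simp only [Labels]
  rw [this, constOnBlocks_mul_iff hc]

theorem labels_self (a : Labelled X) : Labels a a.2 := by
  rw [Labels, mul_self_one]; exact constOnBlocks_one _

theorem equiv_of_labels {a a' : Labelled X} (h : ∀ b, Labels a b ↔ Labels a' b) :
    labelledSetoid X a a' := by
  obtain ⟨p, z⟩ := a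
  obtain ⟨q, w⟩ := a'
  simp only [Labels] at h
  have h1 : ConstOnBlocks q (z * w) := (h z).1 (labels_self (p, z))
  have hpq : p = q := eq_of_constOnBlocks fun b => by
    have := h (b * z)
    rwa [mul_assoc, mul_self_one, mul_one, mul_assoc, constOnBlocks_mul_iff h1] at this
  subst hpq
  exact ⟨rfl, z * w, h1, by rw [mul_comm z, mul_assoc, mul_self_one, mul_one]⟩

/-- If the stacking is compatible, some labelling of the three rows is compatible with both
labelled partitions. -/
theorem exists_labels_of_compatible (a : Labelled (K ⊕ L)) (b : Labelled (L ⊕ M))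
    (h : Compatible a b) :
    Labels a (Sum.elim ((labelledConcat a b).2 ∘ .inl) (a.2 ∘ .inr)) ∧
    Labels b (Sum.elim (a.2 ∘ .inr) ((labelledConcat a b).2 ∘ .inr)) := by
  constructor
  · have : Sum.elim ((labelledConcat a b).2 ∘ .inl) (a.2 ∘ .inr) = a.2 := by
      ext (x | x) <;> rfl
    rw [this]
    exact labels_self a
  · have hmid : ∀ x : M, ∀ l : L, b.1 (.inl l) (.inr x) →
        (labelledConcat a b).2 (.inr x) * b.2 (.inr x) = a.2 (.inr l) * b.2 (.inl l) := by
      intro x l hl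
      have hex : ∃ l : L, b.1 (.inl l) (.inr x) := ⟨l, hl⟩
      simp only [labelledConcat, Sum.elim_inr, dif_pos hex]
      rw [mul_right_comm, Int.units_mul_self, one_mul]
      exact h _ _ (b.1.trans hex.choose_spec (b.1.symm hl))
    have hno : ∀ x : M, (¬ ∃ l : L, b.1 (.inl l) (.inr x)) →
        (labelledConcat a b).2 (.inr x) * b.2 (.inr x) = 1 := by
      intro x hx
      simp only [labelledConcat, Sum.elim_inr, dif_neg hx]
      rw [mul_one, Int.units_mul_self]
    rintro (x | x) (y | y) hxy
    · exact h x y hxy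
    · exact (hmid y x hxy).symm
    · exact hmid x y (b.1.symm hxy)
    · change (labelledConcat a b).2 (.inr x) * b.2 (.inr x) =
        (labelledConcat a b).2 (.inr y) * b.2 (.inr y)
      by_cases hx : ∃ l : L, b.1 (.inl l) (.inr x)
      · obtain ⟨l, hl⟩ := hx
        rw [hmid x l hl, hmid y l (b.1.trans hl hxy)]
      · rw [hno x hx, hno y]
        rintro ⟨l, hl⟩
        exact hx ⟨l, b.1.trans hl (b.1.symm hxy)⟩

theorem exists_compatible_of_labels (a : Labelled (K ⊕ L)) (b : Labelled (L ⊕ M))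
    {i : K → ℤˣ} {m : L → ℤˣ} {j : M → ℤˣ} (ha : Labels a (Sum.elim i m))
    (hb : Labels b (Sum.elim m j)) :
    labelledSetoid _ (a.1, Sum.elim i m) a ∧ labelledSetoid _ (b.1, Sum.elim m j) b ∧
      Compatible (a.1, Sum.elim i m) (b.1, Sum.elim m j) := by
  refine ⟨⟨rfl, _, ha, ?_⟩, ⟨rfl, _, hb, ?_⟩, ?_⟩
  · rw [mul_right_comm, mul_self_one, one_mul]
  · rw [mul_right_comm, mul_self_one, one_mul]
  · intro x y _
    simp [Int.units_mul_self]

open Classical in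
theorem card_middle_labels [Finite L] (a : Labelled (K ⊕ L)) (b : Labelled (L ⊕ M))
    (h : Compatible a b) (i : K → ℤˣ) (j : M → ℤˣ) :
    Nat.card {m : L → ℤˣ // Labels a (Sum.elim i m) ∧ Labels b (Sum.elim m j)} =
      if Labels (labelledConcat a b) (Sum.elim i j) then 2 ^ loopNumber a.1 b.1 else 0 := by
  obtain ⟨ha, hb⟩ := exists_labels_of_compatible a b h
  set u := (labelledConcat a b).2 ∘ Sum.inl with hu
  set v := (a.2 ∘ Sum.inr : L → ℤˣ) with hv
  set w := (labelledConcat a b).2 ∘ Sum.inr with hw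
  have e1 : Labels (labelledConcat a b) (Sum.elim i j) ↔
      ConstOnBlocks (concat a.1 b.1) (Sum.elim (i * u) (j * w)) := by
    have : Sum.elim (i * u) (j * w) = Sum.elim i j * (labelledConcat a b).2 := by
      ext (x | x) <;> rfl
    rw [this]; rfl
  have e2 : ∀ m, Labels a (Sum.elim i m) ↔ ConstOnBlocks a.1 (Sum.elim (i * u) (m * v)) := by
    intro m
    have : Sum.elim (i * u) (m * v) = (Sum.elim i m * a.2) * (Sum.elim u v * a.2) := by
      rw [mul_mul_mul_comm, mul_self_one, mul_one]
      ext (x | x) <;> rfl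
    rw [this, constOnBlocks_mul_iff ha]; rfl
  have e3 : ∀ m, Labels b (Sum.elim m j) ↔ ConstOnBlocks b.1 (Sum.elim (m * v) (j * w)) := by
    intro m
    have : Sum.elim (m * v) (j * w) = (Sum.elim m j * b.2) * (Sum.elim v w * b.2) := by
      rw [mul_mul_mul_comm, mul_self_one, mul_one]
      ext (x | x) <;> rfl
    rw [this, constOnBlocks_mul_iff hb]; rfl
  simp only [e1, e2, e3]
  rw [← card_middle]
  refine Nat.card_congr ((Equiv.mulRight v).subtypeEquiv fun m => ?_)
  rfl

theorem labels_juxtapose {k k' l l' : ℕ} {a : Labelled (Fin k ⊕ Fin l)}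
    {b : Labelled (Fin k' ⊕ Fin l')}
    {i : Fin (k + k') → ℤˣ} {j : Fin (l + l') → ℤˣ} :
    Labels (labelledJuxtapose a b) (Sum.elim i j) ↔
      Labels a (Sum.elim (i ∘ Fin.castAdd k') (j ∘ Fin.castAdd l')) ∧
      Labels b (Sum.elim (i ∘ Fin.natAdd k) (j ∘ Fin.natAdd l)) := by
  set z := (labelledJuxtapose a b).2 with hz
  have h0 : Labels (labelledJuxtapose a b) (Sum.elim i j) ↔
      ConstOnBlocks (juxtapose a.1 b.1) (Sum.elim (i * (z ∘ .inl)) (j * (z ∘ .inr))) := by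
    have : Sum.elim (i * (z ∘ .inl)) (j * (z ∘ .inr)) = Sum.elim i j * z := by
      ext (x | x) <;> rfl
    rw [this]; rfl
  rw [h0, constOnBlocks_juxtapose, Labels, Labels]
  refine and_congr (iff_of_eq (congrArg _ ?_)) (iff_of_eq (congrArg _ ?_))
  · ext (x | x) <;> simp [hz, labelledJuxtapose, splitVertex]
  · ext (x | x) <;> simp [hz, labelledJuxtapose, splitVertex]

/-- Horizontal concatenation of coloured partitions. -/
def colouredJuxtapose {k k' l l' : ℕ} (P : ColouredPartition k l) (Q : ColouredPartition k' l') :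
    ColouredPartition (k + k') (l + l') :=
  Quotient.map₂ labelledJuxtapose (fun a a' ha b b' hb => equiv_of_labels fun c => by
    have hc : Sum.elim (c ∘ Sum.inl) (c ∘ Sum.inr) = c := by ext (x | x) <;> rfl
    rw [← hc, labels_juxtapose, labels_juxtapose, labels_iff_of_equiv ha,
      labels_iff_of_equiv hb]) P Q

/-- A partition, with all labels equal to `1`. -/
def uncoloured {k l : ℕ} (p : Partition k l) : ColouredPartition k l := Quotient.mk _ (p, 1)

/-- The labellings compatible with a class of coloured partitions. -/
def ClassLabels {k l : ℕ} (P : ColouredPartition k l) (b : Fin k ⊕ Fin l → ℤˣ) : Prop :=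
  Quotient.lift Labels (fun _ _ h => funext fun b => propext (labels_iff_of_equiv h b)) P b

/-! ### Families of diagrams -/

/-- A family of diagrams of size `(k, l)` with vertical concatenation (which may be undefined and
may produce loops), horizontal concatenation and permutation diagrams. The field `sem` records
which labellings of the lower and upper vertices by `{1, -1}` are compatible with a diagram. -/
class DiagramFamily (D : ℕ → ℕ → Type) where
  /-- `q` on top of `p`; `none` if `p` and `q` are not compatible -/
  vconcat {k l m : ℕ} (p : D k l) (q : D l m) : Option (D k m)
  /-- the number of loops in the stacking of `q` on top of `p` -/
  loops {k l m : ℕ} (p : D k l) (q : D l m) : ℕ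
  /-- horizontal concatenation -/
  hconcat {k k' l l' : ℕ} (p : D k l) (q : D k' l') : D (k + k') (l + l')
  /-- the diagram connecting the lower vertex `i` with the upper vertex `σ i` -/
  perm {k l : ℕ} (σ : Fin k ≃ Fin l) : D k l
  /-- compatibility with labellings -/
  sem {k l : ℕ} (p : D k l) (i : Fin k → ℤˣ) (j : Fin l → ℤˣ) : Prop
  sem_injective {k l : ℕ} (p q : D k l) : (∀ i j, sem p i j ↔ sem q i j) → p = q
  exists_sem {k l : ℕ} (p : D k l) : ∃ i j, sem p i j
  card_sem {k l m : ℕ} (p : D k l) (q : D l m) (r : D k m) :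
    vconcat p q = some r → ∀ i j,
      (sem r i j → Nat.card {x // sem p i x ∧ sem q x j} = 2 ^ loops p q) ∧
      (¬ sem r i j → Nat.card {x // sem p i x ∧ sem q x j} = 0)
  sem_none {k l m : ℕ} (p : D k l) (q : D l m) :
    vconcat p q = none → ∀ i x j, ¬ (sem p i x ∧ sem q x j)
  sem_perm {k l : ℕ} (σ : Fin k ≃ Fin l) (i : Fin k → ℤˣ) (j : Fin l → ℤˣ) :
    sem (perm σ) i j ↔ i = j ∘ σ
  sem_hconcat {k k' l l' : ℕ} (p : D k l) (q : D k' l') (i : Fin (k + k') → ℤˣ)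
    (j : Fin (l + l') → ℤˣ) : sem (hconcat p q) i j ↔
      sem p (i ∘ Fin.castAdd k') (j ∘ Fin.castAdd l') ∧
      sem q (i ∘ Fin.natAdd k) (j ∘ Fin.natAdd l)

/-- Even partitions. -/
noncomputable instance : DiagramFamily EvenPartition where
  vconcat p q := some ⟨concat p.1 q.1, p.2.concat q.2⟩
  loops p q := loopNumber p.1 q.1
  hconcat p q := ⟨juxtapose p.1 q.1, p.2.juxtapose q.2⟩
  perm σ := ⟨permPartition σ, isEven_permPartition σ⟩
  sem p i j := ConstOnBlocks p.1 (Sum.elim i j)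
  sem_injective p q h := Subtype.ext <| eq_of_constOnBlocks fun b => by
    have hb : Sum.elim (b ∘ Sum.inl) (b ∘ Sum.inr) = b := by ext (x | x) <;> rfl
    rw [← hb, h]
  exists_sem {k l} p := ⟨1, 1, by
    have : (Sum.elim 1 1 : Fin k ⊕ Fin l → ℤˣ) = 1 := by ext (x | x) <;> rfl
    rw [this]; exact constOnBlocks_one _⟩
  card_sem p q r h i j := by
    cases h
    have := card_middle p.1 q.1 i j
    exact ⟨fun h => by rwa [if_pos h] at this, fun h => by rwa [if_neg h] at this⟩
  sem_none p q h := by cases h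
  sem_perm σ i j := constOnBlocks_permPartition
  sem_hconcat p q i j := constOnBlocks_juxtapose

/-- `ℤ/2`-coloured partitions. -/
noncomputable instance : DiagramFamily ColouredPartition where
  vconcat := colouredConcat
  loops P Q := loopNumber (underlying P) (underlying Q)
  hconcat := colouredJuxtapose
  perm σ := uncoloured (permPartition σ)
  sem P i j := ClassLabels P (Sum.elim i j)
  sem_injective P Q h := by
    induction P, Q using Quotient.inductionOn₂ with
    | h a a' =>
      refine Quotient.sound (equiv_of_labels fun b => ?_)
      have hb : Sum.elim (b ∘ Sum.inl) (b ∘ Sum.inr) = b := by ext (x | x) <;> rfl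
      rw [← hb]
      exact h _ _
  exists_sem P := by
    induction P using Quotient.inductionOn with
    | h a =>
      refine ⟨a.2 ∘ .inl, a.2 ∘ .inr, ?_⟩
      have hb : Sum.elim (a.2 ∘ Sum.inl) (a.2 ∘ Sum.inr) = a.2 := by ext (x | x) <;> rfl
      rw [hb]
      exact labels_self a
  card_sem P Q R hR i j := by
    unfold colouredConcat at hR
    split_ifs at hR with h
    obtain ⟨h1, h2, h3⟩ := h.choose_spec
    cases hR
    generalize h.choose = ab at h1 h2 h3 ⊢
    subst h1 h2
    have := card_middle_labels _ _ h3 i j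
    refine ⟨fun hl => ?_, fun hl => ?_⟩
    · rw [if_pos (by exact hl)] at this
      exact this
    · rw [if_neg (by exact hl)] at this
      exact this
  sem_none P Q h i x j := by
    rintro ⟨hP, hQ⟩
    unfold colouredConcat at h
    split_ifs at h with h'
    induction P, Q using Quotient.inductionOn₂ with
    | h a b =>
      obtain ⟨h1, h2, h3⟩ := exists_compatible_of_labels a b hP hQ
      exact h' ⟨(_, _), Quotient.sound h1, Quotient.sound h2, h3⟩
  sem_perm σ i j := by
    rw [← constOnBlocks_permPartition (σ := σ)]
    change ConstOnBlocks (permPartition σ) (Sum.elim i j * 1) ↔ _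
    rw [mul_one]
  sem_hconcat P Q i j := by
    induction P, Q using Quotient.inductionOn₂ with
    | h a b => exact labels_juxtapose

/-! ### Zero or a diagram together with a number of loops -/

section Weighted

variable (D : ℕ → ℕ → Type) [DiagramFamily D]

/-- Zero or a diagram with a number of loops. -/
abbrev WDiag (k l : ℕ) : Type := Option (ℕ × D k l)

variable {D}

open DiagramFamily

/-- stacking `q` on top of `p`, remembering the loops -/
def wstack {k l m : ℕ} (p : D k l) (q : D l m) : WDiag D k m :=
  (vconcat p q).map fun r => (loops p q, r)

/-- Composition of weighted diagrams. -/
def wcomp {k l m : ℕ} : WDiag D k l → WDiag D l m → WDiag D k m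
  | some (a, p), some (b, q) => (wstack p q).map fun r => (a + b + r.1, r.2)
  | _, _ => none

/-- Tensor product of weighted diagrams. -/
def wtensor {k k' l l' : ℕ} : WDiag D k l → WDiag D k' l' → WDiag D (k + k') (l + l')
  | some (a, p), some (b, q) => some (a + b, hconcat p q)
  | _, _ => none

open Classical in
/-- The matrix of a weighted diagram, indexed by labellings. -/
noncomputable def wmat {k l : ℕ} : WDiag D k l → (Fin k → ℤˣ) → (Fin l → ℤˣ) → ℕ
  | some (a, p), i, j => if sem p i j then 2 ^ a else 0
  | none, _, _ => 0

theorem wmat_injective {k l : ℕ} {x y : WDiag D k l} (h : ∀ i j, wmat x i j = wmat y i j) :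
    x = y := by
  classical
  rcases x with _ | ⟨a, p⟩ <;> rcases y with _ | ⟨b, q⟩
  · rfl
  · obtain ⟨i, j, hij⟩ := exists_sem q
    have := h i j
    simp only [wmat, if_pos hij] at this
    exact absurd this.symm (by positivity)
  · obtain ⟨i, j, hij⟩ := exists_sem p
    have := h i j
    simp only [wmat, if_pos hij] at this
    exact absurd this (by positivity)
  · have hpq : p = q := by
      refine sem_injective p q fun i j => ?_
      have := h i j
      simp only [wmat] at this
      have ha : 2 ^ a ≠ 0 := by positivity
      have hb : 2 ^ b ≠ 0 := by positivity
      by_cases h1 : sem p i j <;> by_cases h2 : sem q i j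
      · simp [h1, h2]
      · rw [if_pos h1, if_neg h2] at this; exact absurd this ha
      · rw [if_neg h1, if_pos h2] at this; exact absurd this.symm hb
      · simp [h1, h2]
    subst hpq
    obtain ⟨i, j, hij⟩ := exists_sem p
    have := h i j
    simp only [wmat, if_pos hij] at this
    rw [Nat.pow_right_injective le_rfl this]

theorem wmat_wcomp {k l m : ℕ} (x : WDiag D k l) (y : WDiag D l m) (i : Fin k → ℤˣ)
    (j : Fin m → ℤˣ) : wmat (wcomp x y) i j = ∑ u, wmat x i u * wmat y u j := by
  classical
  rcases x with _ | ⟨a, p⟩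
  · simp [wcomp, wmat]
  rcases y with _ | ⟨b, q⟩
  · simp [wcomp, wmat]
  have hs : ∑ u, wmat (some (a, p) : WDiag D k l) i u * wmat (some (b, q) : WDiag D l m) u j =
      2 ^ (a + b) * Nat.card {u // sem p i u ∧ sem q u j} := by
    rw [Nat.card_eq_fintype_card, Fintype.card_subtype, Finset.card_filter,
      Finset.mul_sum]
    refine Finset.sum_congr rfl fun u _ => ?_
    simp only [wmat]
    by_cases h1 : sem p i u <;> by_cases h2 : sem q u j <;> simp [h1, h2, pow_add]
  rw [hs]
  rcases hpq : vconcat p q with _ | r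
  · have : IsEmpty {u // sem p i u ∧ sem q u j} := ⟨fun u => sem_none p q hpq _ _ _ u.2⟩
    simp [wcomp, wstack, hpq, wmat]
  · have := card_sem p q r hpq i j
    by_cases hr : sem r i j
    · rw [this.1 hr]
      simp [wcomp, wstack, hpq, wmat, hr, pow_add]
    · rw [this.2 hr]
      simp [wcomp, wstack, hpq, wmat, hr]

theorem wmat_wtensor {k k' l l' : ℕ} (x : WDiag D k l) (y : WDiag D k' l')
    (i : Fin (k + k') → ℤˣ) (j : Fin (l + l') → ℤˣ) :
    wmat (wtensor x y) i j = wmat x (i ∘ Fin.castAdd k') (j ∘ Fin.castAdd l') *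
      wmat y (i ∘ Fin.natAdd k) (j ∘ Fin.natAdd l) := by
  classical
  rcases x with _ | ⟨a, p⟩
  · simp [wtensor, wmat]
  rcases y with _ | ⟨b, q⟩
  · simp [wtensor, wmat]
  simp only [wtensor, wmat, sem_hconcat]
  by_cases h1 : sem p (i ∘ Fin.castAdd k') (j ∘ Fin.castAdd l') <;>
    by_cases h2 : sem q (i ∘ Fin.natAdd k) (j ∘ Fin.natAdd l) <;> simp [h1, h2, pow_add]

/-- The weighted diagram of a permutation diagram. -/
def wperm {k l : ℕ} (σ : Fin k ≃ Fin l) : WDiag D k l := some (0, perm σ)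

theorem wmat_wperm {k l : ℕ} (σ : Fin k ≃ Fin l) (i : Fin k → ℤˣ) (j : Fin l → ℤˣ) :
    wmat (wperm σ : WDiag D k l) i j = if i = j ∘ σ then 1 else 0 := by
  classical
  simp [wmat, wperm, sem_perm]

theorem wmat_wperm_wcomp {k l m : ℕ} (σ : Fin k ≃ Fin l) (x : WDiag D l m)
    (i : Fin k → ℤˣ) (j : Fin m → ℤˣ) : wmat (wcomp (wperm σ) x) i j = wmat x (i ∘ σ.symm) j := by
  rw [wmat_wcomp, Finset.sum_eq_single (i ∘ σ.symm)]
  · rw [wmat_wperm, if_pos (by ext; simp), one_mul]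
  · intro u _ hu
    rw [wmat_wperm, if_neg, zero_mul]
    rintro rfl
    exact hu (by ext; simp)
  · simp

theorem wmat_wcomp_wperm {k l m : ℕ} (σ : Fin l ≃ Fin m) (x : WDiag D k l)
    (i : Fin k → ℤˣ) (j : Fin m → ℤˣ) : wmat (wcomp x (wperm σ)) i j = wmat x i (j ∘ σ) := by
  rw [wmat_wcomp, Finset.sum_eq_single (j ∘ σ)]
  · rw [wmat_wperm, if_pos rfl, mul_one]
  · intro u _ hu
    rw [wmat_wperm, if_neg hu, mul_zero]
  · simp

theorem wcomp_assoc {k l m n : ℕ} (x : WDiag D k l) (y : WDiag D l m) (z : WDiag D m n) :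
    wcomp (wcomp x y) z = wcomp x (wcomp y z) := by
  refine wmat_injective fun i j => ?_
  simp only [wmat_wcomp, Finset.sum_mul, Finset.mul_sum]
  rw [Finset.sum_comm]
  simp only [mul_assoc]

theorem wperm_refl_wcomp {k l : ℕ} (x : WDiag D k l) : wcomp (wperm (Equiv.refl _)) x = x :=
  wmat_injective fun i j => by rw [wmat_wperm_wcomp]; rfl

theorem wcomp_wperm_refl {k l : ℕ} (x : WDiag D k l) : wcomp x (wperm (Equiv.refl _)) = x :=
  wmat_injective fun i j => by rw [wmat_wcomp_wperm]; rfl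

theorem wtensor_wcomp {k l m k' l' m' : ℕ} (x : WDiag D k l) (y : WDiag D l m)
    (x' : WDiag D k' l') (y' : WDiag D l' m') :
    wcomp (wtensor x x') (wtensor y y') = wtensor (wcomp x y) (wcomp x' y') := by
  refine wmat_injective fun i j => ?_
  rw [wmat_wtensor, wmat_wcomp, wmat_wcomp, wmat_wcomp, Finset.sum_mul_sum, ← Finset.sum_product',
    ← (Fin.appendEquiv l l').sum_comp]
  refine Finset.sum_congr rfl fun u _ => ?_
  have h1 : (Fin.appendEquiv l l' u) ∘ Fin.castAdd l' = u.1 := by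
    ext; simp [Fin.appendEquiv]
  have h2 : (Fin.appendEquiv l l' u) ∘ Fin.natAdd l = u.2 := by
    ext; simp [Fin.appendEquiv]
  rw [wmat_wtensor, wmat_wtensor, h1, h2, mul_mul_mul_comm]

/-- The juxtaposition of two bijections. -/
def sumPerm {k k' l l' : ℕ} (σ : Fin k ≃ Fin l) (τ : Fin k' ≃ Fin l') :
    Fin (k + k') ≃ Fin (l + l') :=
  finSumFinEquiv.symm.trans ((Equiv.sumCongr σ τ).trans finSumFinEquiv)

@[simp] theorem sumPerm_castAdd {k k' l l' : ℕ} (σ : Fin k ≃ Fin l) (τ : Fin k' ≃ Fin l')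
    (x : Fin k) : sumPerm σ τ (Fin.castAdd k' x) = Fin.castAdd l' (σ x) := by
  simp [sumPerm]

@[simp] theorem sumPerm_natAdd {k k' l l' : ℕ} (σ : Fin k ≃ Fin l) (τ : Fin k' ≃ Fin l')
    (x : Fin k') : sumPerm σ τ (Fin.natAdd k x) = Fin.natAdd l (τ x) := by
  simp [sumPerm]

theorem wperm_wcomp_wperm {k l m : ℕ} (σ : Fin k ≃ Fin l) (τ : Fin l ≃ Fin m) :
    wcomp (wperm σ : WDiag D k l) (wperm τ) = wperm (σ.trans τ) :=
  wmat_injective fun i j => by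
    rw [wmat_wcomp_wperm, wmat_wperm, wmat_wperm]; rfl

theorem wtensor_wperm_wperm {k k' l l' : ℕ} (σ : Fin k ≃ Fin l) (τ : Fin k' ≃ Fin l') :
    wtensor (wperm σ : WDiag D k l) (wperm τ : WDiag D k' l') = wperm (sumPerm σ τ) :=
  wmat_injective fun i j => by
    rw [wmat_wtensor, wmat_wperm, wmat_wperm, wmat_wperm]
    have : i = j ∘ sumPerm σ τ ↔ (i ∘ Fin.castAdd k' = (j ∘ Fin.castAdd l') ∘ σ ∧
        i ∘ Fin.natAdd k = (j ∘ Fin.natAdd l) ∘ τ) := by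
      constructor
      · rintro rfl
        exact ⟨by ext; simp, by ext; simp⟩
      · rintro ⟨h1, h2⟩
        funext x
        refine Fin.addCases (fun x => ?_) (fun x => ?_) x
        · simpa using congrFun h1 x
        · simpa using congrFun h2 x
    simp only [this]
    split_ifs <;> simp_all

/-- The bijection underlying the associativity constraint. -/
def assocPerm (a b c : ℕ) : Fin (a + b + c) ≃ Fin (a + (b + c)) := finCongr (add_assoc a b c)

/-- The bijection underlying the left unit constraint. -/
def leftPerm (a : ℕ) : Fin (0 + a) ≃ Fin a := finCongr (zero_add a)

/-- The bijection underlying the right unit constraint. -/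
def rightPerm (a : ℕ) : Fin (a + 0) ≃ Fin a := finCongr (add_zero a)

/-- A bijection which does not change the values. -/
def IsCast {k l : ℕ} (σ : Fin k ≃ Fin l) : Prop := ∀ x, (σ x : ℕ) = x

theorem IsCast.ext {k l : ℕ} {σ τ : Fin k ≃ Fin l} (hσ : IsCast σ) (hτ : IsCast τ) : σ = τ :=
  Equiv.ext fun x => Fin.ext ((hσ x).trans (hτ x).symm)

theorem IsCast.trans {k l m : ℕ} {σ : Fin k ≃ Fin l} {τ : Fin l ≃ Fin m} (hσ : IsCast σ)
    (hτ : IsCast τ) : IsCast (σ.trans τ) := fun x => (hτ _).trans (hσ x)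

theorem isCast_refl (k : ℕ) : IsCast (Equiv.refl (Fin k)) := fun _ => rfl

theorem IsCast.sumPerm {k k' l l' : ℕ} {σ : Fin k ≃ Fin l} {τ : Fin k' ≃ Fin l'}
    (hσ : IsCast σ) (hτ : IsCast τ) : IsCast (sumPerm σ τ) := by
  have hkl : k = l := by simpa using Fintype.card_congr σ
  intro x
  refine Fin.addCases (fun x => ?_) (fun x => ?_) x
  · rw [sumPerm_castAdd]; exact hσ x
  · rw [sumPerm_natAdd, Fin.val_natAdd, Fin.val_natAdd, hτ x, hkl]

theorem isCast_assocPerm (a b c : ℕ) : IsCast (assocPerm a b c) := fun _ => rfl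

theorem isCast_leftPerm (a : ℕ) : IsCast (leftPerm a) := fun _ => rfl

theorem isCast_rightPerm (a : ℕ) : IsCast (rightPerm a) := fun _ => rfl

theorem assocPerm_left {a b c : ℕ} (x : Fin a) :
    assocPerm a b c (Fin.castAdd c (Fin.castAdd b x)) = Fin.castAdd (b + c) x := rfl

theorem assocPerm_mid {a b c : ℕ} (x : Fin b) :
    assocPerm a b c (Fin.castAdd c (Fin.natAdd a x)) = Fin.natAdd a (Fin.castAdd c x) := rfl

theorem assocPerm_right {a b c : ℕ} (x : Fin c) :
    assocPerm a b c (Fin.natAdd (a + b) x) = Fin.natAdd a (Fin.natAdd b x) :=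
  Fin.ext (by simp [assocPerm, add_assoc])

theorem hexagonPerm (a b c : ℕ) :
    (assocPerm a b c).trans (finAddFlip.trans (assocPerm b c a)) =
      (sumPerm finAddFlip (Equiv.refl (Fin c))).trans
        ((assocPerm b a c).trans (sumPerm (Equiv.refl (Fin b)) finAddFlip)) := by
  refine Equiv.ext fun x => ?_
  refine Fin.addCases (fun x => Fin.addCases (fun x => ?_) (fun x => ?_) x) (fun x => ?_) x
  · simp only [Equiv.trans_apply, assocPerm_left, assocPerm_mid, assocPerm_right,
      finAddFlip_apply_castAdd, finAddFlip_apply_natAdd, sumPerm_castAdd, sumPerm_natAdd,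
      Equiv.refl_apply]
  · simp only [Equiv.trans_apply, assocPerm_left, assocPerm_mid, assocPerm_right,
      finAddFlip_apply_castAdd, finAddFlip_apply_natAdd, sumPerm_castAdd, sumPerm_natAdd,
      Equiv.refl_apply]
  · simp only [Equiv.trans_apply, assocPerm_left, assocPerm_mid, assocPerm_right,
      finAddFlip_apply_castAdd, finAddFlip_apply_natAdd, sumPerm_castAdd, sumPerm_natAdd,
      Equiv.refl_apply]

theorem flip_flip (a b : ℕ) :
    (finAddFlip : Fin (a + b) ≃ _).trans finAddFlip = Equiv.refl _ := by
  refine Equiv.ext fun x => ?_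
  refine Fin.addCases (fun x => ?_) (fun x => ?_) x <;> simp

theorem flip_symm (a b : ℕ) : (finAddFlip : Fin (a + b) ≃ Fin (b + a)).symm = finAddFlip := by
  refine Equiv.ext fun x => ?_
  rw [Equiv.symm_apply_eq]
  refine Fin.addCases (fun x => ?_) (fun x => ?_) x <;> simp

theorem wassoc_natural {k l m k' l' m' : ℕ} (x : WDiag D k k') (y : WDiag D l l')
    (z : WDiag D m m') :
    wcomp (wtensor (wtensor x y) z) (wperm (assocPerm k' l' m')) =
      wcomp (wperm (assocPerm k l m)) (wtensor x (wtensor y z)) :=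
  wmat_injective fun i j => by
    have h1 : ∀ {a b c : ℕ} (u : Fin (a + b + c) → ℤˣ), (u ∘ Fin.castAdd c) ∘ Fin.castAdd b =
        (u ∘ (assocPerm a b c).symm) ∘ Fin.castAdd (b + c) := fun u => by
      funext v; exact congrArg u (Fin.ext (by simp [assocPerm]))
    have h2 : ∀ {a b c : ℕ} (u : Fin (a + b + c) → ℤˣ), (u ∘ Fin.castAdd c) ∘ Fin.natAdd a =
        ((u ∘ (assocPerm a b c).symm) ∘ Fin.natAdd a) ∘ Fin.castAdd c := fun u => by
      funext v; exact congrArg u (Fin.ext (by simp [assocPerm]))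
    have h3 : ∀ {a b c : ℕ} (u : Fin (a + b + c) → ℤˣ), u ∘ Fin.natAdd (a + b) =
        ((u ∘ (assocPerm a b c).symm) ∘ Fin.natAdd a) ∘ Fin.natAdd b := fun u => by
      funext v; exact congrArg u (Fin.ext (by simp [assocPerm, add_assoc]))
    have h4 : (j ∘ assocPerm k' l' m') ∘ (assocPerm k' l' m').symm = j := by
      funext v; simp
    simp only [wmat_wcomp_wperm, wmat_wperm_wcomp, wmat_wtensor]
    rw [h1, h1, h2, h2, h3, h3, h4, mul_assoc]

theorem wleft_natural {k l : ℕ} (x : WDiag D k l) :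
    wcomp (wtensor (wperm (Equiv.refl (Fin 0))) x) (wperm (leftPerm l)) =
      wcomp (wperm (leftPerm k)) x :=
  wmat_injective fun i j => by
    simp only [wmat_wcomp_wperm, wmat_wperm_wcomp, wmat_wtensor, wmat_wperm]
    rw [if_pos (Subsingleton.elim _ _), one_mul]
    congr 1
    · funext u; exact congrArg i (Fin.ext (by simp [leftPerm]))
    · funext u; exact congrArg j (Fin.ext (by simp [leftPerm]))

theorem wright_natural {k l : ℕ} (x : WDiag D k l) :
    wcomp (wtensor x (wperm (Equiv.refl (Fin 0)))) (wperm (rightPerm l)) =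
      wcomp (wperm (rightPerm k)) x :=
  wmat_injective fun i j => by
    simp only [wmat_wcomp_wperm, wmat_wperm_wcomp, wmat_wtensor, wmat_wperm]
    rw [if_pos (Subsingleton.elim _ _), mul_one]
    congr 1

theorem wswap_natural {k l k' l' : ℕ} (x : WDiag D k l) (y : WDiag D k' l') :
    wcomp (wtensor x y) (wperm finAddFlip) = wcomp (wperm finAddFlip) (wtensor y x) :=
  wmat_injective fun i j => by
    simp only [wmat_wcomp_wperm, wmat_wperm_wcomp, wmat_wtensor]
    rw [mul_comm]
    congr 2 <;> (funext u; simp [finAddFlip])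

end Weighted

/-! ### Symmetric monoidal structures from a swap -/

section Swap

open CategoryTheory MonoidalCategory

/-- A natural involutive swap which satisfies the hexagon identity is a symmetry. -/
@[reducible]
def symmetricOfSwap {C : Type*} [Category C] [MonoidalCategory C]
    (β : ∀ X Y : C, X ⊗ Y ⟶ Y ⊗ X)
    (natural : ∀ {X Y X' Y' : C} (f : X ⟶ Y) (g : X' ⟶ Y'),
      (f ⊗ₘ g) ≫ β Y Y' = β X X' ≫ (g ⊗ₘ f))
    (swap_swap : ∀ X Y : C, β X Y ≫ β Y X = 𝟙 (X ⊗ Y))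
    (hexagon : ∀ X Y Z : C, (α_ X Y Z).hom ≫ β X (Y ⊗ Z) ≫ (α_ Y Z X).hom =
      β X Y ▷ Z ≫ (α_ Y X Z).hom ≫ Y ◁ β X Z) : SymmetricCategory C where
  braiding X Y := ⟨β X Y, β Y X, swap_swap X Y, swap_swap Y X⟩
  braiding_naturality_right X Y Z f := by
    have := natural (𝟙 X) f
    rwa [id_tensorHom, tensorHom_id] at this
  braiding_naturality_left f Z := by
    have := natural f (𝟙 Z)
    rwa [id_tensorHom, tensorHom_id] at this
  hexagon_forward X Y Z := hexagon X Y Z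
  hexagon_reverse X Y Z := by
    have h := hexagon Z X Y
    let b : ∀ X Y : C, X ⊗ Y ≅ Y ⊗ X := fun X Y => ⟨β X Y, β Y X, swap_swap X Y, swap_swap Y X⟩
    have h' : α_ Z X Y ≪≫ b Z (X ⊗ Y) ≪≫ α_ X Y Z =
        whiskerRightIso (b Z X) Y ≪≫ α_ X Z Y ≪≫ whiskerLeftIso X (b Z Y) := Iso.ext h
    have h'' := congrArg Iso.inv h'
    simpa only [Iso.trans_inv, whiskerRightIso_inv, whiskerLeftIso_inv, Category.assoc] using h''
  symmetry X Y := swap_swap X Y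

end Swap

/-! ### The linear category attached to a family of diagrams -/

section LinearDiagrams

open CategoryTheory MonoidalCategory

variable {D : ℕ → ℕ → Type}

/-- Loops are replaced by the parameter `t`. -/
noncomputable def evalLoops (t : ℂ) {k l : ℕ} : WDiag D k l → (D k l →₀ ℂ)
  | some (a, p) => Finsupp.single p (t ^ a)
  | none => 0

theorem single_eq_eval (t : ℂ) {k l : ℕ} (p : D k l) :
    Finsupp.single p (1 : ℂ) = evalLoops t (some (0, p)) := by simp [evalLoops]

/-- To prove an identity that is linear in `f`, it suffices to treat diagrams. -/
theorem lin_induction (t : ℂ) {k l : ℕ} {P : (D k l →₀ ℂ) → Prop} (f : D k l →₀ ℂ)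
    (zero : P 0) (add : ∀ f g, P f → P g → P (f + g)) (smul : ∀ (c : ℂ) f, P f → P (c • f))
    (diag : ∀ x : WDiag D k l, P (evalLoops t x)) : P f := by
  induction f using Finsupp.induction_linear with
  | zero => exact zero
  | add f g hf hg => exact add f g hf hg
  | single p c =>
    have : Finsupp.single p c = c • Finsupp.single p (1 : ℂ) := by simp
    rw [this, single_eq_eval t]
    exact smul c _ (diag _)

variable [DiagramFamily D]

/-- The bilinear extension of `(p, q) ↦ t ^ (number of loops) • (q on top of p)`, where the
right-hand side is `0` if `p` and `q` are not compatible. -/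
noncomputable def linComp (t : ℂ) (k l m : ℕ) :
    (D k l →₀ ℂ) →ₗ[ℂ] (D l m →₀ ℂ) →ₗ[ℂ] (D k m →₀ ℂ) :=
  Finsupp.linearCombination ℂ fun p => Finsupp.linearCombination ℂ fun q =>
    evalLoops t (wstack p q)

/-- The bilinear extension of horizontal concatenation. -/
noncomputable def linTensor (k l k' l' : ℕ) :
    (D k l →₀ ℂ) →ₗ[ℂ] (D k' l' →₀ ℂ) →ₗ[ℂ] (D (k + k') (l + l') →₀ ℂ) :=
  Finsupp.linearCombination ℂ fun p => Finsupp.linearCombination ℂ fun q =>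
    Finsupp.single (DiagramFamily.hconcat p q) 1

theorem linComp_eval (t : ℂ) {k l m : ℕ} (x : WDiag D k l) (y : WDiag D l m) :
    linComp t k l m (evalLoops t x) (evalLoops t y) = evalLoops t (wcomp x y) := by
  rcases x with _ | ⟨a, p⟩
  · simp [evalLoops, wcomp]
  rcases y with _ | ⟨b, q⟩
  · simp [evalLoops, wcomp]
  simp only [linComp, evalLoops, Finsupp.linearCombination_single, LinearMap.smul_apply, wcomp]
  rcases wstack p q with _ | ⟨c, r⟩
  · simp
  · simp only [Option.map_some, Finsupp.smul_single, smul_eq_mul, pow_add, mul_assoc]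

theorem linTensor_eval (t : ℂ) {k l k' l' : ℕ} (x : WDiag D k l) (y : WDiag D k' l') :
    linTensor k l k' l' (evalLoops t x) (evalLoops t y) = evalLoops t (wtensor x y) := by
  rcases x with _ | ⟨a, p⟩
  · simp [evalLoops, wtensor]
  rcases y with _ | ⟨b, q⟩
  · simp [evalLoops, wtensor]
  simp [linTensor, evalLoops, wtensor, Finsupp.linearCombination_single, pow_add]

/-- The objects `[n]`, `n ∈ ℕ`, of the linear category of the family `D` of diagrams with
parameter `t`. -/
@[ext]
structure DiagramCat (D : ℕ → ℕ → Type) (t : ℂ) : Type where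
  /-- the number of points -/
  n : ℕ

variable {t : ℂ}

namespace DiagramCat

/-- Morphisms `[k] ⟶ [l]` are linear combinations of diagrams of size `(k, l)`. -/
noncomputable instance : Category (DiagramCat D t) where
  Hom X Y := D X.n Y.n →₀ ℂ
  id X := evalLoops t (wperm (Equiv.refl (Fin X.n)))
  comp {X Y Z} f g := linComp t X.n Y.n Z.n f g
  id_comp f := by
    induction f using lin_induction t
    case zero => simp
    case add f g hf hg => simp [hf, hg]
    case smul c f hf => simp [hf]
    rename_i x
    rw [linComp_eval, wperm_refl_wcomp]
  comp_id f := by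
    induction f using lin_induction t
    case zero => simp
    case add f g hf hg => simp [hf, hg]
    case smul c f hf => simp [hf]
    rename_i x
    rw [linComp_eval, wcomp_wperm_refl]
  assoc f g h := by
    induction f using lin_induction t
    case zero => simp
    case add f g hf hg => simp [hf, hg]
    case smul c f hf => simp [hf]
    rename_i x
    induction g using lin_induction t
    case zero => simp
    case add f g hf hg => simp [hf, hg]
    case smul c f hf => simp [hf]
    rename_i y
    induction h using lin_induction t
    case zero => simp
    case add f g hf hg => simp [hf, hg]
    case smul c f hf => simp [hf]
    rename_i z
    simp only [linComp_eval, wcomp_assoc]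

theorem comp_eq {X Y Z : DiagramCat D t} (f : X ⟶ Y) (g : Y ⟶ Z) :
    f ≫ g = linComp t X.n Y.n Z.n f g := rfl

noncomputable instance : Preadditive (DiagramCat D t) where
  homGroup X Y := inferInstanceAs (AddCommGroup (D X.n Y.n →₀ ℂ))
  add_comp := fun X Y Z (f f' : D X.n Y.n →₀ ℂ) (g : D Y.n Z.n →₀ ℂ) =>
    LinearMap.map_add₂ (linComp t X.n Y.n Z.n) f f' g
  comp_add := fun X Y Z (f : D X.n Y.n →₀ ℂ) (g g' : D Y.n Z.n →₀ ℂ) =>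
    map_add (linComp t X.n Y.n Z.n f) g g'

noncomputable instance : Linear ℂ (DiagramCat D t) where
  homModule X Y := inferInstanceAs (Module ℂ (D X.n Y.n →₀ ℂ))
  smul_comp := fun X Y Z r (f : D X.n Y.n →₀ ℂ) (g : D Y.n Z.n →₀ ℂ) =>
    LinearMap.map_smul₂ (linComp t X.n Y.n Z.n) r f g
  comp_smul := fun X Y Z (f : D X.n Y.n →₀ ℂ) r (g : D Y.n Z.n →₀ ℂ) =>
    map_smul (linComp t X.n Y.n Z.n f) r g

/-- The morphism given by a weighted diagram. -/
noncomputable def ofW {X Y : DiagramCat D t} (x : WDiag D X.n Y.n) : X ⟶ Y := evalLoops t x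

theorem ofW_comp {X Y Z : DiagramCat D t} (x : WDiag D X.n Y.n) (y : WDiag D Y.n Z.n) :
    (ofW x : X ⟶ Y) ≫ (ofW y : Y ⟶ Z) = ofW (wcomp x y) := by
  unfold ofW
  rw [comp_eq, linComp_eval]

/-- The isomorphism given by a bijection. -/
noncomputable def permIso {X Y : DiagramCat D t} (σ : Fin X.n ≃ Fin Y.n) : X ≅ Y where
  hom := ofW (wperm σ)
  inv := ofW (wperm σ.symm)
  hom_inv_id := by rw [ofW_comp, wperm_wcomp_wperm, Equiv.self_trans_symm]; rfl
  inv_hom_id := by rw [ofW_comp, wperm_wcomp_wperm, Equiv.symm_trans_self]; rfl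

theorem permIso_hom {X Y : DiagramCat D t} (σ : Fin X.n ≃ Fin Y.n) :
    (permIso σ : X ≅ Y).hom = ofW (wperm σ) := rfl

theorem permIso_inv {X Y : DiagramCat D t} (σ : Fin X.n ≃ Fin Y.n) :
    (permIso σ : X ≅ Y).inv = ofW (wperm σ.symm) := rfl

theorem id_eq (X : DiagramCat D t) : 𝟙 X = ofW (wperm (Equiv.refl _)) := rfl

/-- `[k] ⊗ [l] = [k + l]`, and the tensor product of diagrams is horizontal concatenation. -/
noncomputable instance : MonoidalCategoryStruct (DiagramCat D t) where
  tensorObj X Y := ⟨X.n + Y.n⟩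
  tensorHom {X₁ Y₁ X₂ Y₂} f g := linTensor X₁.n Y₁.n X₂.n Y₂.n f g
  whiskerLeft X {Y₁ Y₂} g := linTensor X.n X.n Y₁.n Y₂.n (𝟙 X) g
  whiskerRight {X₁ X₂} f Y := linTensor X₁.n X₂.n Y.n Y.n f (𝟙 Y)
  tensorUnit := ⟨0⟩
  associator X Y Z := permIso (assocPerm X.n Y.n Z.n)
  leftUnitor X := permIso (leftPerm X.n)
  rightUnitor X := permIso (rightPerm X.n)

theorem ofW_tensor {X₁ Y₁ X₂ Y₂ : DiagramCat D t} (x : WDiag D X₁.n Y₁.n)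
    (y : WDiag D X₂.n Y₂.n) :
    (ofW x : X₁ ⟶ Y₁) ⊗ₘ (ofW y : X₂ ⟶ Y₂) = ofW (wtensor x y) := linTensor_eval t x y

theorem add_tensorHom {X₁ Y₁ X₂ Y₂ : DiagramCat D t} (f f' : X₁ ⟶ Y₁) (g : X₂ ⟶ Y₂) :
    (f + f') ⊗ₘ g = f ⊗ₘ g + f' ⊗ₘ g :=
  congrArg (fun h => h g) (map_add (linTensor X₁.n Y₁.n X₂.n Y₂.n) f f')

theorem tensorHom_add {X₁ Y₁ X₂ Y₂ : DiagramCat D t} (f : X₁ ⟶ Y₁) (g g' : X₂ ⟶ Y₂) :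
    f ⊗ₘ (g + g') = f ⊗ₘ g + f ⊗ₘ g' :=
  (linTensor X₁.n Y₁.n X₂.n Y₂.n f).map_add g g'

theorem smul_tensorHom {X₁ Y₁ X₂ Y₂ : DiagramCat D t} (c : ℂ) (f : X₁ ⟶ Y₁) (g : X₂ ⟶ Y₂) :
    (c • f) ⊗ₘ g = c • (f ⊗ₘ g) :=
  congrArg (fun h => h g) (map_smul (linTensor X₁.n Y₁.n X₂.n Y₂.n) c f)

theorem tensorHom_smul {X₁ Y₁ X₂ Y₂ : DiagramCat D t} (c : ℂ) (f : X₁ ⟶ Y₁) (g : X₂ ⟶ Y₂) :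
    f ⊗ₘ (c • g) = c • (f ⊗ₘ g) :=
  (linTensor X₁.n Y₁.n X₂.n Y₂.n f).map_smul c g

theorem zero_tensorHom {X₁ Y₁ X₂ Y₂ : DiagramCat D t} (g : X₂ ⟶ Y₂) :
    (0 : X₁ ⟶ Y₁) ⊗ₘ g = 0 :=
  congrArg (fun h => h g) (map_zero (linTensor X₁.n Y₁.n X₂.n Y₂.n))

theorem tensorHom_zero {X₁ Y₁ X₂ Y₂ : DiagramCat D t} (f : X₁ ⟶ Y₁) :
    f ⊗ₘ (0 : X₂ ⟶ Y₂) = 0 :=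
  (linTensor X₁.n Y₁.n X₂.n Y₂.n f).map_zero

/-- To prove an identity that is linear in the morphism `f`, it suffices to treat diagrams. -/
theorem hom_induction {X Y : DiagramCat D t} {P : (X ⟶ Y) → Prop} (f : X ⟶ Y)
    (zero : P 0) (add : ∀ f g, P f → P g → P (f + g)) (smul : ∀ (c : ℂ) f, P f → P (c • f))
    (diag : ∀ x : WDiag D X.n Y.n, P (ofW x)) : P f :=
  lin_induction t f zero add smul diag

noncomputable instance : MonoidalCategory (DiagramCat D t) :=
  MonoidalCategory.ofTensorHom
    (id_tensorHom_id := fun X Y => by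
      simp only [id_eq, ofW_tensor, wtensor_wperm_wperm]
      congr 2
      ext x
      refine Fin.addCases (fun x => ?_) (fun x => ?_) x
      · rw [sumPerm_castAdd]; rfl
      · rw [sumPerm_natAdd]; rfl)
    (id_tensorHom := fun _ _ _ _ => rfl)
    (tensorHom_id := fun _ _ => rfl)
    (tensorHom_comp_tensorHom := fun f₁ f₂ g₁ g₂ => by
      induction f₁ using hom_induction
      case zero => simp [zero_tensorHom]
      case add f g hf hg => simp [add_tensorHom, hf, hg]
      case smul c f hf => simp [smul_tensorHom, hf]
      rename_i x₁
      induction f₂ using hom_induction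
      case zero => simp [tensorHom_zero]
      case add f g hf hg => simp [tensorHom_add, hf, hg]
      case smul c f hf => simp [tensorHom_smul, hf]
      rename_i x₂
      induction g₁ using hom_induction
      case zero => simp [zero_tensorHom]
      case add f g hf hg => simp [add_tensorHom, hf, hg]
      case smul c f hf => simp [smul_tensorHom, hf]
      rename_i y₁
      induction g₂ using hom_induction
      case zero => simp [tensorHom_zero]
      case add f g hf hg => simp [tensorHom_add, hf, hg]
      case smul c f hf => simp [tensorHom_smul, hf]
      rename_i y₂
      simp only [ofW_tensor, ofW_comp]
      exact congrArg ofW (wtensor_wcomp _ _ _ _))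
    (associator_naturality := fun f₁ f₂ f₃ => by
      induction f₁ using hom_induction
      case zero => simp [zero_tensorHom]
      case add f g hf hg => simp [add_tensorHom, hf, hg]
      case smul c f hf => simp [smul_tensorHom, hf]
      rename_i x₁
      induction f₂ using hom_induction
      case zero => simp [zero_tensorHom, tensorHom_zero]
      case add f g hf hg => simp [add_tensorHom, tensorHom_add, hf, hg]
      case smul c f hf => simp [smul_tensorHom, tensorHom_smul, hf]
      rename_i x₂
      induction f₃ using hom_induction
      case zero => simp [tensorHom_zero]
      case add f g hf hg => simp [tensorHom_add, hf, hg]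
      case smul c f hf => simp [tensorHom_smul, hf]
      rename_i x₃
      simp only [ofW_tensor, MonoidalCategoryStruct.associator, permIso_hom]
      exact ((ofW_comp _ _).trans (congrArg ofW (wassoc_natural _ _ _))).trans
        (ofW_comp _ _).symm)
    (leftUnitor_naturality := fun f => by
      induction f using hom_induction
      case zero => simp [tensorHom_zero]
      case add f g hf hg => simp [tensorHom_add, hf, hg]
      case smul c f hf => simp [tensorHom_smul, hf]
      rename_i x
      simp only [id_eq, ofW_tensor, MonoidalCategoryStruct.leftUnitor, permIso_hom]
      exact ((ofW_comp _ _).trans (congrArg ofW (wleft_natural _))).trans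
        (ofW_comp _ _).symm)
    (rightUnitor_naturality := fun f => by
      induction f using hom_induction
      case zero => simp [zero_tensorHom]
      case add f g hf hg => simp [add_tensorHom, hf, hg]
      case smul c f hf => simp [smul_tensorHom, hf]
      rename_i x
      simp only [id_eq, ofW_tensor, MonoidalCategoryStruct.rightUnitor, permIso_hom]
      exact ((ofW_comp _ _).trans (congrArg ofW (wright_natural _))).trans
        (ofW_comp _ _).symm)
    (pentagon := fun W X Y Z => by
      simp only [id_eq, MonoidalCategoryStruct.associator, permIso_hom]
      rw [ofW_tensor, ofW_tensor, wtensor_wperm_wperm, wtensor_wperm_wperm]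
      refine (congrArg (fun f => _ ≫ f) (ofW_comp _ _)).trans ((ofW_comp _ _).trans
        (Eq.trans ?_ (ofW_comp _ _).symm))
      simp only [wperm_wcomp_wperm]
      exact congrArg (fun σ => ofW (wperm σ)) (IsCast.ext
        (((isCast_assocPerm _ _ _).sumPerm (isCast_refl _)).trans ((isCast_assocPerm _ _ _).trans
          ((isCast_refl _).sumPerm (isCast_assocPerm _ _ _))))
        ((isCast_assocPerm _ _ _).trans (isCast_assocPerm _ _ _))))
    (triangle := fun X Y => by
      simp only [id_eq, MonoidalCategoryStruct.associator, MonoidalCategoryStruct.leftUnitor,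
        MonoidalCategoryStruct.rightUnitor, permIso_hom]
      rw [ofW_tensor, ofW_tensor, wtensor_wperm_wperm, wtensor_wperm_wperm]
      refine (ofW_comp _ _).trans ?_
      simp only [wperm_wcomp_wperm]
      exact congrArg (fun σ => ofW (wperm σ)) (IsCast.ext
        ((isCast_assocPerm _ _ _).trans ((isCast_refl _).sumPerm (isCast_leftPerm _)))
        ((isCast_rightPerm _).sumPerm (isCast_refl _))))

theorem whiskerLeft_eq {X Y Z : DiagramCat D t} (f : Y ⟶ Z) : X ◁ f = 𝟙 X ⊗ₘ f := rfl

theorem whiskerRight_eq {X Y Z : DiagramCat D t} (f : Y ⟶ Z) : f ▷ X = f ⊗ₘ 𝟙 X := rfl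

instance : MonoidalPreadditive (DiagramCat D t) where
  whiskerLeft_zero := tensorHom_zero _
  zero_whiskerRight := zero_tensorHom _
  whiskerLeft_add := tensorHom_add _
  add_whiskerRight f g := add_tensorHom f g _

instance : MonoidalLinear ℂ (DiagramCat D t) where
  whiskerLeft_smul _ _ _ c f := tensorHom_smul c _ f
  smul_whiskerRight c _ _ f _ := smul_tensorHom c f _

theorem swap_natural {X Y X' Y' : DiagramCat D t} (f : X ⟶ Y) (g : X' ⟶ Y') :
    (f ⊗ₘ g) ≫ (permIso finAddFlip : Y ⊗ Y' ≅ Y' ⊗ Y).hom =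
      (permIso finAddFlip : X ⊗ X' ≅ X' ⊗ X).hom ≫ (g ⊗ₘ f) := by
  induction f using hom_induction
  case zero => simp [tensorHom_zero, zero_tensorHom]
  case add f g hf hg => simp [tensorHom_add, add_tensorHom, hf, hg]
  case smul c f hf => simp [tensorHom_smul, smul_tensorHom, hf]
  rename_i x
  induction g using hom_induction
  case zero => simp [tensorHom_zero, zero_tensorHom]
  case add f g hf hg => simp [tensorHom_add, add_tensorHom, hf, hg]
  case smul c f hf => simp [tensorHom_smul, smul_tensorHom, hf]
  rename_i y
  simp only [ofW_tensor, permIso_hom]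
  exact ((ofW_comp _ _).trans (congrArg ofW (wswap_natural _ _))).trans (ofW_comp _ _).symm

theorem hexagon (X Y Z : DiagramCat D t) :
    (α_ X Y Z).hom ≫ (permIso finAddFlip : X ⊗ (Y ⊗ Z) ≅ (Y ⊗ Z) ⊗ X).hom ≫ (α_ Y Z X).hom =
      (permIso finAddFlip : X ⊗ Y ≅ Y ⊗ X).hom ▷ Z ≫ (α_ Y X Z).hom ≫
        Y ◁ (permIso finAddFlip : X ⊗ Z ≅ Z ⊗ X).hom := by
  simp only [whiskerLeft_eq, whiskerRight_eq, id_eq, MonoidalCategoryStruct.associator, permIso_hom]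
  rw [ofW_tensor, ofW_tensor, wtensor_wperm_wperm, wtensor_wperm_wperm]
  refine (congrArg (fun f => _ ≫ f) (ofW_comp _ _)).trans ((ofW_comp _ _).trans
    (Eq.trans ?_ ((congrArg (fun f => _ ≫ f) (ofW_comp _ _)).trans (ofW_comp _ _)).symm))
  simp only [wperm_wcomp_wperm]
  exact congrArg (fun σ => ofW (wperm σ)) (hexagonPerm _ _ _)

theorem swap_swap (X Y : DiagramCat D t) :
    (permIso finAddFlip : X ⊗ Y ≅ Y ⊗ X).hom ≫ (permIso finAddFlip : Y ⊗ X ≅ X ⊗ Y).hom =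
      𝟙 (X ⊗ Y) :=
  (ofW_comp _ _).trans (congrArg ofW
    ((wperm_wcomp_wperm _ _).trans (congrArg wperm (flip_flip _ _))))

/-- The symmetry is given by the permutation diagrams which interchange two groups of strands. -/
noncomputable instance : SymmetricCategory (DiagramCat D t) :=
  symmetricOfSwap (fun _ _ => (permIso finAddFlip).hom) swap_natural swap_swap hexagon

end DiagramCat
end LinearDiagrams

/-! ### The additive envelope as a linear symmetric monoidal category -/

section AdditiveEnvelope

open CategoryTheory MonoidalCategory

universe v u

variable {C : Type u} [Category.{v} C] [Preadditive C]

namespace AdditiveEnvelope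

open Classical in
/-- The matrix whose only non-zero entries are the `φ i` in position `(i, e i)`. -/
noncomputable def diag {M N : Mat_ C} (e : M.ι ≃ N.ι) (φ : ∀ i, M.X i ⟶ N.X (e i)) : M ⟶ N :=
  fun i j => if h : e i = j then φ i ≫ eqToHom (congrArg N.X h) else 0

theorem diag_apply_self {M N : Mat_ C} (e : M.ι ≃ N.ι) (φ : ∀ i, M.X i ⟶ N.X (e i)) (i : M.ι) :
    diag e φ i (e i) = φ i := by simp [diag]

theorem diag_apply_ne {M N : Mat_ C} (e : M.ι ≃ N.ι) (φ : ∀ i, M.X i ⟶ N.X (e i)) {i : M.ι}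
    {j : N.ι} (h : e i ≠ j) : diag e φ i j = 0 := by simp [diag, h]

theorem diag_comp_apply {M N K : Mat_ C} (e : M.ι ≃ N.ι) (φ : ∀ i, M.X i ⟶ N.X (e i))
    (f : N ⟶ K) (i : M.ι) (k : K.ι) : (diag e φ ≫ f) i k = φ i ≫ f (e i) k := by
  rw [Mat_.comp_apply, Finset.sum_eq_single (e i), diag_apply_self]
  · intro j _ hj
    rw [diag_apply_ne _ _ hj.symm, Limits.zero_comp]
  · simp

theorem comp_diag_apply {M N K : Mat_ C} (e : M.ι ≃ N.ι) (φ : ∀ i, M.X i ⟶ N.X (e i))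
    (f : K ⟶ M) (k : K.ι) (i : M.ι) : (f ≫ diag e φ) k (e i) = f k i ≫ φ i := by
  rw [Mat_.comp_apply, Finset.sum_eq_single i, diag_apply_self]
  · intro j _ hj
    rw [diag_apply_ne _ _ (fun h => hj (e.injective h)), Limits.comp_zero]
  · simp

theorem id_eq_diag (M : Mat_ C) : 𝟙 M = diag (Equiv.refl M.ι) (fun i => 𝟙 (M.X i)) := by
  ext i j
  by_cases h : i = j
  · subst h
    rw [Mat_.id_apply_self]
    exact (diag_apply_self (Equiv.refl M.ι) (fun i => 𝟙 (M.X i)) i).symm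
  · rw [Mat_.id_apply_of_ne _ _ _ h]
    exact (diag_apply_ne (Equiv.refl M.ι) (fun i => 𝟙 (M.X i)) h).symm

theorem diag_comp_diag {M N K : Mat_ C} (e : M.ι ≃ N.ι) (φ : ∀ i, M.X i ⟶ N.X (e i))
    (e' : N.ι ≃ K.ι) (φ' : ∀ i, N.X i ⟶ K.X (e' i)) :
    diag e φ ≫ diag e' φ' = diag (e.trans e') (fun i => φ i ≫ φ' (e i)) := by
  ext i k
  rw [diag_comp_apply]
  by_cases h : e' (e i) = k
  · subst h
    rw [diag_apply_self]
    exact (diag_apply_self (e.trans e') (fun i => φ i ≫ φ' (e i)) i).symm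
  · rw [diag_apply_ne _ _ h, Limits.comp_zero]
    exact (diag_apply_ne (e.trans e') (fun i => φ i ≫ φ' (e i)) h).symm

theorem diag_ext {M N : Mat_ C} {e e' : M.ι ≃ N.ι} {φ : ∀ i, M.X i ⟶ N.X (e i)}
    {φ' : ∀ i, M.X i ⟶ N.X (e' i)}
    (h : ∀ i, ∃ h : e i = e' i, φ i ≫ eqToHom (congrArg N.X h) = φ' i) :
    diag e φ = diag e' φ' := by
  obtain rfl : e = e' := Equiv.ext fun i => (h i).1
  congr 1
  funext i
  obtain ⟨_, h⟩ := h i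
  simpa using h

/-- The isomorphism given by a diagonal matrix of isomorphisms. -/
noncomputable def diagIso {M N : Mat_ C} (e : M.ι ≃ N.ι) (φ : ∀ i, M.X i ≅ N.X (e i)) :
    M ≅ N where
  hom := diag e (fun i => (φ i).hom)
  inv := diag e.symm (fun j => eqToHom (by rw [e.apply_symm_apply]) ≫ (φ (e.symm j)).inv)
  hom_inv_id := by
    rw [diag_comp_diag, id_eq_diag]
    refine diag_ext fun i => ⟨by simp, ?_⟩
    have key : ∀ (i' : M.ι) (h : i' = i), ((φ i).hom ≫ eqToHom (by rw [h]) ≫ (φ i').inv) ≫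
        eqToHom (by rw [h]) = 𝟙 (M.X i) := by
      rintro _ rfl
      simp
    exact key _ (e.symm_apply_apply i)
  inv_hom_id := by
    rw [diag_comp_diag, id_eq_diag]
    refine diag_ext fun i => ⟨by simp, ?_⟩
    have key : ∀ (j : M.ι) (h : e j = i), ((eqToHom (by rw [h]) ≫ (φ j).inv) ≫ (φ j).hom) ≫
        eqToHom (by rw [h]) = 𝟙 (N.X i) := by
      rintro j rfl
      simp
    exact key _ (e.apply_symm_apply i)

section Linear

variable [Linear ℂ C]

/-- The additive envelope of a linear category is linear, entry by entry. -/
noncomputable instance : Linear ℂ (Mat_ C) where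
  homModule M N := inferInstanceAs (Module ℂ (∀ i j, (M.X i ⟶ N.X j)))
  smul_comp M N K r f g := by
    ext i k
    refine (Finset.sum_congr rfl fun j _ => Linear.smul_comp _ _ _ r (f i j) (g j k)).trans ?_
    exact Finset.smul_sum.symm
  comp_smul M N K f r g := by
    ext i k
    refine (Finset.sum_congr rfl fun j _ => Linear.comp_smul _ _ _ (f i j) r (g j k)).trans ?_
    exact Finset.smul_sum.symm

theorem smul_apply {M N : Mat_ C} (r : ℂ) (f : M ⟶ N) (i : M.ι) (j : N.ι) :
    (r • f) i j = r • f i j := rfl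

end Linear

theorem comp_eq_diag {M N K : Mat_ C} {e : M.ι ≃ N.ι} {φ : ∀ i, M.X i ⟶ N.X (e i)}
    {e' : N.ι ≃ K.ι} {φ' : ∀ i, N.X i ⟶ K.X (e' i)} {f : M ⟶ N} {g : N ⟶ K}
    (hf : f = diag e φ) (hg : g = diag e' φ') :
    f ≫ g = diag (e.trans e') (fun i => φ i ≫ φ' (e i)) := by
  rw [hf, hg, diag_comp_diag]

variable [MonoidalCategory C]

/-- The tensor product distributes over the formal direct sums. -/
noncomputable instance : MonoidalCategoryStruct (Mat_ C) where
  tensorObj M N := ⟨M.ι × N.ι, fun i => M.X i.1 ⊗ N.X i.2⟩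
  tensorHom f g := fun i j => f i.1 j.1 ⊗ₘ g i.2 j.2
  whiskerLeft M _ _ g := fun i j => (𝟙 M : M ⟶ M) i.1 j.1 ⊗ₘ g i.2 j.2
  whiskerRight f N := fun i j => f i.1 j.1 ⊗ₘ (𝟙 N : N ⟶ N) i.2 j.2
  tensorUnit := (Mat_.embedding C).obj (𝟙_ C)
  associator M N K := diagIso (Equiv.prodAssoc M.ι N.ι K.ι) (fun _ => α_ _ _ _)
  leftUnitor M := diagIso (Equiv.punitProd M.ι) (fun _ => λ_ _)
  rightUnitor M := diagIso (Equiv.prodPUnit M.ι) (fun _ => ρ_ _)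

theorem tensorHom_apply {M M' N N' : Mat_ C} (f : M ⟶ M') (g : N ⟶ N') (i : M.ι) (i' : N.ι)
    (j : M'.ι) (j' : N'.ι) : (f ⊗ₘ g : M ⊗ N ⟶ M' ⊗ N') (i, i') (j, j') = f i j ⊗ₘ g i' j' := rfl

theorem associator_hom (M N K : Mat_ C) : (α_ M N K).hom =
    diag (M := (M ⊗ N) ⊗ K) (N := M ⊗ (N ⊗ K)) (Equiv.prodAssoc M.ι N.ι K.ι)
      (fun (i : (M.ι × N.ι) × K.ι) => (α_ (M.X i.1.1) (N.X i.1.2) (K.X i.2)).hom) := rfl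

theorem leftUnitor_hom (M : Mat_ C) : (λ_ M).hom =
    diag (M := 𝟙_ (Mat_ C) ⊗ M) (N := M) (Equiv.punitProd M.ι)
      (fun (i : PUnit × M.ι) => (λ_ (M.X i.2)).hom) := rfl

theorem rightUnitor_hom (M : Mat_ C) : (ρ_ M).hom =
    diag (M := M ⊗ 𝟙_ (Mat_ C)) (N := M) (Equiv.prodPUnit M.ι)
      (fun (i : M.ι × PUnit) => (ρ_ (M.X i.1)).hom) := rfl

variable [MonoidalPreadditive C]

theorem diag_tensorHom_diag {M M' N N' : Mat_ C} (e : M.ι ≃ M'.ι) (φ : ∀ i, M.X i ⟶ M'.X (e i))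
    (e' : N.ι ≃ N'.ι) (φ' : ∀ i, N.X i ⟶ N'.X (e' i)) :
    diag e φ ⊗ₘ diag e' φ' =
      (diag (e.prodCongr e') (fun i => φ i.1 ⊗ₘ φ' i.2) : M ⊗ N ⟶ M' ⊗ N') := by
  ext ⟨i, i'⟩ ⟨j, j'⟩
  rw [tensorHom_apply]
  by_cases h : e i = j
  · by_cases h' : e' i' = j'
    · subst h h'
      rw [diag_apply_self, diag_apply_self]
      exact (diag_apply_self (M := M ⊗ N) (N := M' ⊗ N') (e.prodCongr e')
        (fun i => φ i.1 ⊗ₘ φ' i.2) (i, i')).symm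
    · rw [diag_apply_ne _ _ h', MonoidalPreadditive.tensor_zero, diag_apply_ne]
      exact fun H => h' (congrArg Prod.snd H)
  · rw [diag_apply_ne _ _ h, MonoidalPreadditive.zero_tensor, diag_apply_ne]
    exact fun H => h (congrArg Prod.fst H)

theorem tensorHom_eq_diag {M M' N N' : Mat_ C} {e : M.ι ≃ M'.ι} {φ : ∀ i, M.X i ⟶ M'.X (e i)}
    {e' : N.ι ≃ N'.ι} {φ' : ∀ i, N.X i ⟶ N'.X (e' i)} {f : M ⟶ M'} {g : N ⟶ N'}
    (hf : f = diag e φ) (hg : g = diag e' φ') :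
    f ⊗ₘ g = (diag (e.prodCongr e') (fun i => φ i.1 ⊗ₘ φ' i.2) : M ⊗ N ⟶ M' ⊗ N') := by
  rw [hf, hg, diag_tensorHom_diag]

noncomputable instance : MonoidalCategory (Mat_ C) :=
  MonoidalCategory.ofTensorHom
    (id_tensorHom_id := fun M N => by
      refine (tensorHom_eq_diag (id_eq_diag M) (id_eq_diag N)).trans
        (Eq.trans ?_ (id_eq_diag (M ⊗ N)).symm)
      refine diag_ext fun i => ⟨rfl, (Category.comp_id _).trans ?_⟩
      exact id_tensorHom_id _ _)
    (id_tensorHom := fun _ _ _ _ => rfl)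
    (tensorHom_id := fun _ _ => rfl)
    (tensorHom_comp_tensorHom := fun {M₁ N₁ K₁ M₂ N₂ K₂} f₁ f₂ g₁ g₂ => by
      ext ⟨i, i'⟩ ⟨k, k'⟩
      rw [tensorHom_apply, Mat_.comp_apply, Mat_.comp_apply, Mat_.comp_apply, sum_tensor]
      simp only [tensor_sum]
      refine (Fintype.sum_prod_type _).trans ?_
      refine Finset.sum_congr rfl fun j _ => Finset.sum_congr rfl fun j' _ => ?_
      exact tensorHom_comp_tensorHom _ _ _ _)
    (associator_naturality := fun {M₁ M₂ M₃ N₁ N₂ N₃} f₁ f₂ f₃ => by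
      rw [AdditiveEnvelope.associator_hom, AdditiveEnvelope.associator_hom]
      ext ⟨⟨i, i'⟩, i''⟩ k
      obtain ⟨k, rfl⟩ := (Equiv.prodAssoc N₁.ι N₂.ι N₃.ι).surjective k
      refine (comp_diag_apply _ _ _ _ _).trans (Eq.trans ?_ (diag_comp_apply _ _ _ _ _).symm)
      exact MonoidalCategory.associator_naturality _ _ _)
    (leftUnitor_naturality := fun {M N} f => by
      rw [AdditiveEnvelope.leftUnitor_hom, AdditiveEnvelope.leftUnitor_hom]
      ext ⟨_, i⟩ k
      obtain ⟨k, rfl⟩ := (Equiv.punitProd N.ι).surjective k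
      refine (comp_diag_apply _ _ _ _ _).trans (Eq.trans ?_ (diag_comp_apply _ _ _ _ _).symm)
      have : (𝟙 (𝟙_ (Mat_ C)) : 𝟙_ (Mat_ C) ⟶ 𝟙_ (Mat_ C)) PUnit.unit PUnit.unit = 𝟙 (𝟙_ C) :=
        Mat_.id_apply_self (𝟙_ (Mat_ C)) PUnit.unit
      refine (congrArg (fun g => (g ⊗ₘ f i k.2) ≫ (λ_ _).hom) this).trans ?_
      refine (congrArg (fun g => g ≫ (λ_ _).hom) (id_tensorHom _ _)).trans ?_
      exact MonoidalCategory.leftUnitor_naturality _)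
    (rightUnitor_naturality := fun {M N} f => by
      rw [AdditiveEnvelope.rightUnitor_hom, AdditiveEnvelope.rightUnitor_hom]
      ext ⟨i, _⟩ k
      obtain ⟨k, rfl⟩ := (Equiv.prodPUnit N.ι).surjective k
      refine (comp_diag_apply _ _ _ _ _).trans (Eq.trans ?_ (diag_comp_apply _ _ _ _ _).symm)
      have : (𝟙 (𝟙_ (Mat_ C)) : 𝟙_ (Mat_ C) ⟶ 𝟙_ (Mat_ C)) PUnit.unit PUnit.unit = 𝟙 (𝟙_ C) :=
        Mat_.id_apply_self (𝟙_ (Mat_ C)) PUnit.unit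
      refine (congrArg (fun g => (f i k.1 ⊗ₘ g) ≫ (ρ_ _).hom) this).trans ?_
      refine (congrArg (fun g => g ≫ (ρ_ _).hom) (tensorHom_id _ _)).trans ?_
      exact MonoidalCategory.rightUnitor_naturality _)
    (pentagon := fun M N K L => by
      refine (comp_eq_diag (tensorHom_eq_diag (AdditiveEnvelope.associator_hom M N K)
        (id_eq_diag L)) (comp_eq_diag (AdditiveEnvelope.associator_hom M (N ⊗ K) L)
        (tensorHom_eq_diag (id_eq_diag M) (AdditiveEnvelope.associator_hom N K L)))).trans
        (Eq.trans ?_ (comp_eq_diag (AdditiveEnvelope.associator_hom (M ⊗ N) K L)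
          (AdditiveEnvelope.associator_hom M N (K ⊗ L))).symm)
      refine diag_ext ?_
      rintro ⟨⟨⟨i, j⟩, k⟩, l⟩
      refine ⟨rfl, (Category.comp_id _).trans ?_⟩
      have := MonoidalCategory.pentagon (M.X i) (N.X j) (K.X k) (L.X l)
      rw [← tensorHom_id, ← id_tensorHom] at this
      exact this)
    (triangle := fun M N => by
      refine (comp_eq_diag (AdditiveEnvelope.associator_hom M (𝟙_ _) N)
        (tensorHom_eq_diag (id_eq_diag M) (AdditiveEnvelope.leftUnitor_hom N))).trans
        (Eq.trans ?_ (tensorHom_eq_diag (AdditiveEnvelope.rightUnitor_hom M) (id_eq_diag N)).symm)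
      refine diag_ext ?_
      rintro ⟨⟨i, _⟩, j⟩
      refine ⟨rfl, (Category.comp_id _).trans ?_⟩
      have := MonoidalCategory.triangle (M.X i) (N.X j)
      rw [← tensorHom_id, ← id_tensorHom] at this
      exact this)

instance : MonoidalPreadditive (Mat_ C) where
  whiskerLeft_zero {M N K} := by
    ext i j
    exact MonoidalPreadditive.tensor_zero _
  zero_whiskerRight {M N K} := by
    ext i j
    exact MonoidalPreadditive.zero_tensor _
  whiskerLeft_add {M N K} f g := by
    ext i j
    exact MonoidalPreadditive.tensor_add _ _ _
  add_whiskerRight {M N K} f g := by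
    ext i j
    exact MonoidalPreadditive.add_tensor _ _ _

instance [Linear ℂ C] [MonoidalLinear ℂ C] : MonoidalLinear ℂ (Mat_ C) where
  whiskerLeft_smul M N K c f := by
    ext i j
    change (𝟙 M : M ⟶ M) i.1 j.1 ⊗ₘ (c • f i.2 j.2) = c • ((𝟙 M : M ⟶ M) i.1 j.1 ⊗ₘ f i.2 j.2)
    rw [MonoidalCategory.tensorHom_def, MonoidalLinear.whiskerLeft_smul, Linear.comp_smul,
      ← MonoidalCategory.tensorHom_def]
  smul_whiskerRight c M N f K := by
    ext i j
    change (c • f i.1 j.1) ⊗ₘ (𝟙 K : K ⟶ K) i.2 j.2 = c • (f i.1 j.1 ⊗ₘ (𝟙 K : K ⟶ K) i.2 j.2)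
    rw [MonoidalCategory.tensorHom_def, MonoidalLinear.smul_whiskerRight, Linear.smul_comp,
      ← MonoidalCategory.tensorHom_def]

variable [SymmetricCategory C]

/-- The symmetry of the additive envelope, on each pair of summands the given one. -/
noncomputable def swap (M N : Mat_ C) : M ⊗ N ⟶ N ⊗ M :=
  diag (M := M ⊗ N) (N := N ⊗ M) (Equiv.prodComm M.ι N.ι)
    (fun (i : M.ι × N.ι) => (β_ (M.X i.1) (N.X i.2)).hom)

noncomputable instance : SymmetricCategory (Mat_ C) :=
  symmetricOfSwap swap
    (fun {M N M' N'} f g => by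
      ext ⟨i, i'⟩ k
      obtain ⟨k, rfl⟩ := (Equiv.prodComm N.ι N'.ι).surjective k
      refine (comp_diag_apply _ _ _ _ _).trans (Eq.trans ?_ (diag_comp_apply _ _ _ _ _).symm)
      exact BraidedCategory.braiding_naturality _ _)
    (fun M N => by
      rw [id_eq_diag]
      refine (diag_comp_diag _ _ _ _).trans (diag_ext ?_)
      rintro ⟨i, j⟩
      refine ⟨rfl, ?_⟩
      refine (Category.comp_id _).trans ?_
      exact SymmetricCategory.symmetry _ _)
    (fun M N K => by
      refine (comp_eq_diag (AdditiveEnvelope.associator_hom M N K) (comp_eq_diag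
        (f := swap M (N ⊗ K)) rfl (AdditiveEnvelope.associator_hom N K M))).trans
        (Eq.trans ?_ (comp_eq_diag (tensorHom_eq_diag (f := swap M N) rfl (id_eq_diag K))
          (comp_eq_diag (AdditiveEnvelope.associator_hom N M K)
            (tensorHom_eq_diag (g := swap M K) (id_eq_diag N) rfl))).symm)
      refine diag_ext ?_
      rintro ⟨⟨i, j⟩, k⟩
      refine ⟨rfl, (Category.comp_id _).trans ?_⟩
      have := BraidedCategory.hexagon_forward (M.X i) (N.X j) (K.X k)
      rw [← tensorHom_id, ← id_tensorHom] at this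
      exact this)

end AdditiveEnvelope
end AdditiveEnvelope

/-! ### The idempotent completion as a linear symmetric monoidal category -/

section IdempotentCompletion

open CategoryTheory MonoidalCategory Idempotents

universe v u

variable {C : Type u} [Category.{v} C]

namespace IdempotentCompletion

/-- The morphism of the idempotent completion given by a morphism of the underlying objects that
commutes with the idempotents. -/
def ofComm {P Q : Karoubi C} (φ : P.X ⟶ Q.X) (h : P.p ≫ φ = φ ≫ Q.p) : P ⟶ Q :=
  ⟨P.p ≫ φ, by rw [Category.assoc, ← h, P.idem_assoc, P.idem_assoc]⟩

theorem ofComm_f {P Q : Karoubi C} (φ : P.X ⟶ Q.X) (h : P.p ≫ φ = φ ≫ Q.p) :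
    (ofComm φ h).f = P.p ≫ φ := rfl

/-- The morphism `f` is given by the morphism `φ`, which commutes with the idempotents. -/
def IsGivenBy {P Q : Karoubi C} (f : P ⟶ Q) (φ : P.X ⟶ Q.X) : Prop :=
  P.p ≫ φ = φ ≫ Q.p ∧ f.f = P.p ≫ φ

theorem isGivenBy_ofComm {P Q : Karoubi C} (φ : P.X ⟶ Q.X) (h : P.p ≫ φ = φ ≫ Q.p) :
    IsGivenBy (ofComm φ h) φ := ⟨h, rfl⟩

theorem isGivenBy_id (P : Karoubi C) : IsGivenBy (𝟙 P) (𝟙 P.X) :=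
  ⟨by simp, (Category.comp_id _).symm⟩

theorem IsGivenBy.comp {P Q R : Karoubi C} {f : P ⟶ Q} {g : Q ⟶ R} {φ : P.X ⟶ Q.X}
    {ψ : Q.X ⟶ R.X} (hf : IsGivenBy f φ) (hg : IsGivenBy g ψ) : IsGivenBy (f ≫ g) (φ ≫ ψ) := by
  refine ⟨by rw [← Category.assoc, hf.1, Category.assoc, hg.1, Category.assoc], ?_⟩
  rw [Karoubi.comp_f, hg.2, Karoubi.comp_p_assoc, hf.2, Category.assoc]

theorem IsGivenBy.ext {P Q : Karoubi C} {f g : P ⟶ Q} {φ ψ : P.X ⟶ Q.X} (hf : IsGivenBy f φ)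
    (hg : IsGivenBy g ψ) (e : φ = ψ) : f = g := by
  ext
  rw [hf.2, hg.2, e]

/-- A square commutes as soon as it does so on the underlying objects. -/
theorem IsGivenBy.natural {P Q P' Q' : Karoubi C} {f : P ⟶ P'} {g : Q ⟶ Q'} {a : P ⟶ Q}
    {b : P' ⟶ Q'} {φ : P.X ⟶ Q.X} {ψ : P'.X ⟶ Q'.X} (ha : IsGivenBy a φ) (hb : IsGivenBy b ψ)
    (e : f.f ≫ ψ = φ ≫ g.f) : f ≫ b = a ≫ g := by
  ext
  rw [Karoubi.comp_f, Karoubi.comp_f, ha.2, hb.2, Karoubi.comp_p_assoc, e, Category.assoc,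
    ← e, Karoubi.p_comp_assoc]

theorem inv_comm {P Q : Karoubi C} (φ : P.X ≅ Q.X) (h : P.p ≫ φ.hom = φ.hom ≫ Q.p) :
    Q.p ≫ φ.inv = φ.inv ≫ P.p := by
  rw [Iso.comp_inv_eq, Category.assoc, h, Iso.inv_hom_id_assoc]

/-- The isomorphism of the idempotent completion given by an isomorphism of the underlying objects
that commutes with the idempotents. -/
def isoOfComm {P Q : Karoubi C} (φ : P.X ≅ Q.X) (h : P.p ≫ φ.hom = φ.hom ≫ Q.p) : P ≅ Q where
  hom := ofComm φ.hom h
  inv := ofComm φ.inv (inv_comm φ h)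
  hom_inv_id := ((isGivenBy_ofComm _ _).comp (isGivenBy_ofComm _ _)).ext (isGivenBy_id P)
    φ.hom_inv_id
  inv_hom_id := ((isGivenBy_ofComm _ _).comp (isGivenBy_ofComm _ _)).ext (isGivenBy_id Q)
    φ.inv_hom_id

theorem isGivenBy_isoOfComm {P Q : Karoubi C} (φ : P.X ≅ Q.X) (h : P.p ≫ φ.hom = φ.hom ≫ Q.p) :
    IsGivenBy (isoOfComm φ h).hom φ.hom := ⟨h, rfl⟩

section Linear

variable [Preadditive C]

theorem add_f {P Q : Karoubi C} (f g : P ⟶ Q) : (f + g).f = f.f + g.f := rfl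

theorem zero_f (P Q : Karoubi C) : (0 : P ⟶ Q).f = 0 := rfl

variable [Linear ℂ C]

instance {P Q : Karoubi C} : SMul ℂ (P ⟶ Q) where
  smul c f := ⟨c • f.f, by rw [Linear.smul_comp, Linear.comp_smul, f.comm]⟩

theorem smul_f {P Q : Karoubi C} (c : ℂ) (f : P ⟶ Q) : (c • f).f = c • f.f := rfl

instance {P Q : Karoubi C} : Module ℂ (P ⟶ Q) where
  one_smul f := Karoubi.hom_ext _ _ (one_smul ℂ f.f)
  mul_smul a b f := Karoubi.hom_ext _ _ (mul_smul a b f.f)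
  smul_zero a := Karoubi.hom_ext _ _ (smul_zero a)
  smul_add a f g := Karoubi.hom_ext _ _ (smul_add a f.f g.f)
  add_smul a b f := Karoubi.hom_ext _ _ (add_smul a b f.f)
  zero_smul f := Karoubi.hom_ext _ _ (zero_smul ℂ f.f)

/-- The idempotent completion of a linear category is linear. -/
instance : Linear ℂ (Karoubi C) where
  homModule _ _ := inferInstance
  smul_comp _ _ _ c f g := Karoubi.hom_ext _ _ (Linear.smul_comp _ _ _ c f.f g.f)
  comp_smul _ _ _ f c g := Karoubi.hom_ext _ _ (Linear.comp_smul _ _ _ f.f c g.f)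

end Linear

variable [MonoidalCategory C]

/-- `(X, p) ⊗ (Y, q) = (X ⊗ Y, p ⊗ q)`. -/
def tensor (P Q : Karoubi C) : Karoubi C :=
  ⟨P.X ⊗ Q.X, P.p ⊗ₘ Q.p, by rw [tensorHom_comp_tensorHom, P.idem, Q.idem]⟩

/-- The tensor product of morphisms of the idempotent completion. -/
def tensorMap {P P' Q Q' : Karoubi C} (f : P ⟶ P') (g : Q ⟶ Q') : tensor P Q ⟶ tensor P' Q' :=
  ⟨f.f ⊗ₘ g.f, by
    change (P.p ⊗ₘ Q.p) ≫ (f.f ⊗ₘ g.f) ≫ (P'.p ⊗ₘ Q'.p) = _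
    rw [tensorHom_comp_tensorHom, tensorHom_comp_tensorHom, f.comm, g.comm]⟩

instance : MonoidalCategoryStruct (Karoubi C) where
  tensorObj := tensor
  tensorHom := tensorMap
  whiskerLeft P _ _ g := tensorMap (𝟙 P) g
  whiskerRight f Q := tensorMap f (𝟙 Q)
  tensorUnit := (toKaroubi C).obj (𝟙_ C)
  associator P Q R := isoOfComm (α_ P.X Q.X R.X)
    (MonoidalCategory.associator_naturality P.p Q.p R.p)
  leftUnitor P := isoOfComm (λ_ P.X) (by
    refine Eq.trans ?_ (MonoidalCategory.leftUnitor_naturality P.p)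
    rw [← id_tensorHom]
    rfl)
  rightUnitor P := isoOfComm (ρ_ P.X) (by
    refine Eq.trans ?_ (MonoidalCategory.rightUnitor_naturality P.p)
    rw [← tensorHom_id]
    rfl)

theorem tensorHom_f {P P' Q Q' : Karoubi C} (f : P ⟶ P') (g : Q ⟶ Q') :
    (f ⊗ₘ g).f = f.f ⊗ₘ g.f := rfl

theorem whiskerLeft_f (P : Karoubi C) {Q Q' : Karoubi C} (g : Q ⟶ Q') :
    (P ◁ g).f = P.p ⊗ₘ g.f := rfl

theorem whiskerRight_f {P P' : Karoubi C} (f : P ⟶ P') (Q : Karoubi C) :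
    (f ▷ Q).f = f.f ⊗ₘ Q.p := rfl

theorem IsGivenBy.tensor {P P' Q Q' : Karoubi C} {f : P ⟶ P'} {g : Q ⟶ Q'} {φ : P.X ⟶ P'.X}
    {ψ : Q.X ⟶ Q'.X} (hf : IsGivenBy f φ) (hg : IsGivenBy g ψ) :
    IsGivenBy (P := P ⊗ Q) (Q := P' ⊗ Q') (f ⊗ₘ g) (φ ⊗ₘ ψ) := by
  constructor
  · refine (tensorHom_comp_tensorHom _ _ _ _).trans
      (Eq.trans ?_ (tensorHom_comp_tensorHom _ _ _ _).symm)
    rw [hf.1, hg.1]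
  · rw [tensorHom_f, hf.2, hg.2]
    exact (tensorHom_comp_tensorHom _ _ _ _).symm

theorem isGivenBy_associator (P Q R : Karoubi C) :
    IsGivenBy (P := (P ⊗ Q) ⊗ R) (Q := P ⊗ (Q ⊗ R)) (α_ P Q R).hom (α_ P.X Q.X R.X).hom :=
  isGivenBy_isoOfComm _ _

theorem isGivenBy_leftUnitor (P : Karoubi C) :
    IsGivenBy (P := 𝟙_ (Karoubi C) ⊗ P) (λ_ P).hom (λ_ P.X).hom := isGivenBy_isoOfComm _ _

theorem isGivenBy_rightUnitor (P : Karoubi C) :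
    IsGivenBy (P := P ⊗ 𝟙_ (Karoubi C)) (ρ_ P).hom (ρ_ P.X).hom := isGivenBy_isoOfComm _ _

instance : MonoidalCategory (Karoubi C) :=
  MonoidalCategory.ofTensorHom
    (id_tensorHom_id := fun P Q => rfl)
    (id_tensorHom := fun _ _ _ _ => rfl)
    (tensorHom_id := fun _ _ => rfl)
    (tensorHom_comp_tensorHom := fun f₁ f₂ g₁ g₂ =>
      Karoubi.hom_ext _ _ (tensorHom_comp_tensorHom _ _ _ _))
    (associator_naturality := fun f₁ f₂ f₃ =>
      (isGivenBy_associator _ _ _).natural (isGivenBy_associator _ _ _)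
        (MonoidalCategory.associator_naturality f₁.f f₂.f f₃.f))
    (leftUnitor_naturality := fun f =>
      (isGivenBy_leftUnitor _).natural (isGivenBy_leftUnitor _) (by
        refine Eq.trans ?_ (MonoidalCategory.leftUnitor_naturality f.f)
        rw [← id_tensorHom]
        rfl))
    (rightUnitor_naturality := fun f =>
      (isGivenBy_rightUnitor _).natural (isGivenBy_rightUnitor _) (by
        refine Eq.trans ?_ (MonoidalCategory.rightUnitor_naturality f.f)
        rw [← tensorHom_id]
        rfl))
    (pentagon := fun P Q R S => by
      refine IsGivenBy.ext (((isGivenBy_associator P Q R).tensor (isGivenBy_id S)).comp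
        ((isGivenBy_associator P (Q ⊗ R) S).comp
          ((isGivenBy_id P).tensor (isGivenBy_associator Q R S))))
        ((isGivenBy_associator (P ⊗ Q) R S).comp (isGivenBy_associator P Q (R ⊗ S))) ?_
      have := MonoidalCategory.pentagon P.X Q.X R.X S.X
      rw [← tensorHom_id, ← id_tensorHom] at this
      exact this)
    (triangle := fun P Q => by
      refine IsGivenBy.ext ((isGivenBy_associator P (𝟙_ _) Q).comp
        ((isGivenBy_id P).tensor (isGivenBy_leftUnitor Q)))
        ((isGivenBy_rightUnitor P).tensor (isGivenBy_id Q)) ?_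
      have := MonoidalCategory.triangle P.X Q.X
      rw [← tensorHom_id, ← id_tensorHom] at this
      exact this)

section Linear

variable [Preadditive C] [MonoidalPreadditive C]

instance : MonoidalPreadditive (Karoubi C) where
  whiskerLeft_zero {P _ _} := by
    ext
    rw [whiskerLeft_f, zero_f, zero_f, MonoidalPreadditive.tensor_zero]
    rfl
  zero_whiskerRight {P _ _} := by
    ext
    rw [whiskerRight_f, zero_f, zero_f, MonoidalPreadditive.zero_tensor]
    rfl
  whiskerLeft_add {P _ _} f g := by
    ext
    rw [whiskerLeft_f, add_f, add_f, MonoidalPreadditive.tensor_add]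
    rfl
  add_whiskerRight {P _ _} f g := by
    ext
    rw [whiskerRight_f, add_f, add_f, MonoidalPreadditive.add_tensor]
    rfl

instance [Linear ℂ C] [MonoidalLinear ℂ C] : MonoidalLinear ℂ (Karoubi C) where
  whiskerLeft_smul P Q R c f := by
    ext
    rw [whiskerLeft_f, smul_f, smul_f, MonoidalCategory.tensorHom_def,
      MonoidalLinear.whiskerLeft_smul, Linear.comp_smul, ← MonoidalCategory.tensorHom_def]
    rfl
  smul_whiskerRight c P Q f R := by
    ext
    rw [whiskerRight_f, smul_f, smul_f, MonoidalCategory.tensorHom_def,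
      MonoidalLinear.smul_whiskerRight, Linear.smul_comp, ← MonoidalCategory.tensorHom_def]
    rfl

end Linear

variable [SymmetricCategory C]

/-- The symmetry of the idempotent completion. -/
def swap (P Q : Karoubi C) : P ⊗ Q ⟶ Q ⊗ P :=
  ofComm (P := P ⊗ Q) (Q := Q ⊗ P) (β_ P.X Q.X).hom
    (BraidedCategory.braiding_naturality P.p Q.p)

theorem isGivenBy_swap (P Q : Karoubi C) :
    IsGivenBy (P := P ⊗ Q) (Q := Q ⊗ P) (swap P Q) (β_ P.X Q.X).hom := isGivenBy_ofComm _ _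

instance : SymmetricCategory (Karoubi C) :=
  symmetricOfSwap swap
    (fun f g => (isGivenBy_swap _ _).natural (isGivenBy_swap _ _)
      (BraidedCategory.braiding_naturality f.f g.f))
    (fun P Q => ((isGivenBy_swap P Q).comp (isGivenBy_swap Q P)).ext (isGivenBy_id (P ⊗ Q))
      (SymmetricCategory.symmetry P.X Q.X))
    (fun P Q R => by
      refine IsGivenBy.ext ((isGivenBy_associator P Q R).comp
        ((isGivenBy_swap P (Q ⊗ R)).comp (isGivenBy_associator Q R P)))
        (((isGivenBy_swap P Q).tensor (isGivenBy_id R)).comp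
          ((isGivenBy_associator Q P R).comp ((isGivenBy_id Q).tensor (isGivenBy_swap P R)))) ?_
      have := BraidedCategory.hexagon_forward P.X Q.X R.X
      rw [← tensorHom_id, ← id_tensorHom] at this
      exact this)

end IdempotentCompletion
end IdempotentCompletion

/-! ### The two categories and the functor on generators -/

section Omega

open CategoryTheory MonoidalCategory Idempotents

/-- The category `Rep₀(H_t)`: morphisms are linear combinations of even partitions. -/
abbrev RepZero (t : ℂ) : Type := DiagramCat EvenPartition t

/-- The category `Par(ℤ/2, t)`: morphisms are linear combinations of coloured partitions. -/
abbrev ParZTwo (t : ℂ) : Type := DiagramCat ColouredPartition t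

/-- The Karoubian envelope: idempotent completion of the additive envelope. -/
abbrev KaroubianEnvelope (C : Type) [Category.{0} C] [Preadditive C] : Type 1 := Karoubi (Mat_ C)

/-- The embedding of a category into its Karoubian envelope. -/
noncomputable abbrev toEnvelope (C : Type) [Category.{0} C] [Preadditive C] :
    C ⥤ KaroubianEnvelope C :=
  Mat_.embedding C ⋙ toKaroubi (Mat_ C)

/-- The category `Rep(H_t)`. -/
abbrev RepH (t : ℂ) : Type 1 := KaroubianEnvelope (RepZero t)

/-- The Karoubian envelope of `Par(ℤ/2, t)`. -/
abbrev ParKar (t : ℂ) : Type 1 := KaroubianEnvelope (ParZTwo t)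

/-- The direct summand `(X, e)` of `X` given by an idempotent `e`. -/
noncomputable def summand {C : Type} [Category.{0} C] [Preadditive C] (X : C) (e : X ⟶ X)
    (he : e ≫ e = e) : KaroubianEnvelope C :=
  ⟨(Mat_.embedding C).obj X, (Mat_.embedding C).map e, by rw [← Functor.map_comp, he]⟩

/-- The morphism `(X, e) ⟶ (Y, e')` given by `e' ∘ f ∘ e`. -/
noncomputable def summandMap {C : Type} [Category.{0} C] [Preadditive C] {X Y : C} {e : X ⟶ X}
    {he : e ≫ e = e} {e' : Y ⟶ Y} {he' : e' ≫ e' = e'} (f : X ⟶ Y) :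
    summand X e he ⟶ summand Y e' he' :=
  ⟨(Mat_.embedding C).map (e ≫ f ≫ e'), by
    change (Mat_.embedding C).map e ≫ _ ≫ (Mat_.embedding C).map e' = _
    rw [← Functor.map_comp, ← Functor.map_comp]
    congr 1
    rw [Category.assoc, Category.assoc, he', ← Category.assoc, he]⟩

variable (t : ℂ)

/-- The morphism given by a single diagram. -/
noncomputable def ofDiagram {D : ℕ → ℕ → Type} [DiagramFamily D] {k l : ℕ} (p : D k l) :
    (⟨k⟩ : DiagramCat D t) ⟶ ⟨l⟩ := Finsupp.single p (1 : ℂ)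

/-- One strand with label `-1` at the lower and label `1` at the upper vertex. -/
def minusStrand : ColouredPartition 1 1 :=
  Quotient.mk _ (permPartition (Equiv.refl (Fin 1)), Sum.elim (fun _ => -1) (fun _ => 1))

/-- The idempotent `e' = (id - (-1)-strand) / 2`. -/
noncomputable def ePrime : (⟨1⟩ : ParZTwo t) ⟶ ⟨1⟩ :=
  (2⁻¹ : ℂ) • (𝟙 _ - ofDiagram t minusStrand)

theorem sem_minusStrand (i j : Fin 1 → ℤˣ) :
    DiagramFamily.sem minusStrand i j ↔ i = -j := by
  change ConstOnBlocks (permPartition (Equiv.refl (Fin 1)))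
    (Sum.elim i j * Sum.elim (fun _ => -1) (fun _ => 1)) ↔ _
  have : (Sum.elim i j * Sum.elim (fun _ => -1) (fun _ => 1) : Fin 1 ⊕ Fin 1 → ℤˣ) =
      Sum.elim (-i) j := by
    ext (x | x) <;> simp
  rw [this, constOnBlocks_permPartition]
  exact neg_eq_iff_eq_neg

theorem minusStrand_wcomp :
    wcomp (some (0, minusStrand)) (some (0, minusStrand)) =
      (wperm (Equiv.refl (Fin 1)) : WDiag ColouredPartition 1 1) := by
  classical
  refine wmat_injective fun i j => ?_
  rw [wmat_wcomp]
  simp only [wmat, wperm, sem_minusStrand, DiagramFamily.sem_perm, pow_zero]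
  rw [Finset.sum_eq_single (-j)]
  · simp
  · intro u _ hu
    simp [hu]
  · simp

theorem minusStrand_comp : ofDiagram t minusStrand ≫ ofDiagram t minusStrand = 𝟙 _ := by
  have : (ofDiagram t minusStrand : (⟨1⟩ : ParZTwo t) ⟶ ⟨1⟩) =
      DiagramCat.ofW (some (0, minusStrand)) := single_eq_eval t _
  rw [this]
  exact (DiagramCat.ofW_comp _ _).trans (congrArg DiagramCat.ofW minusStrand_wcomp)

theorem ePrime_comp : ePrime t ≫ ePrime t = ePrime t := by
  unfold ePrime
  rw [Linear.smul_comp, Linear.comp_smul, Preadditive.sub_comp, Preadditive.comp_sub,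
    Preadditive.comp_sub, minusStrand_comp, Category.comp_id, Category.id_comp, Category.comp_id,
    smul_smul]
  module

/-- The tensor powers of `e'`. -/
noncomputable def ePow : (k : ℕ) → ((⟨k⟩ : ParZTwo t) ⟶ ⟨k⟩)
  | 0 => 𝟙 _
  | k + 1 => ePow k ⊗ₘ ePrime t

theorem ePow_comp : ∀ k : ℕ, ePow t k ≫ ePow t k = ePow t k
  | 0 => Category.comp_id _
  | k + 1 => (tensorHom_comp_tensorHom _ _ _ _).trans
      (by rw [ePow_comp k, ePrime_comp]; rfl)

/-- The object `([k], e'^{⊗ k})`. -/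
noncomputable def omegaObj (k : ℕ) : ParKar t := summand ⟨k⟩ (ePow t k) (ePow_comp t k)

/-- The number of blocks of a partition. -/
noncomputable def blockNumber {k l : ℕ} (p : Partition k l) : ℕ := Nat.card (Quotient p)

/-- The value on an even partition `p` of size `(k, l)` with `s` blocks, the sizes of which sum up
to `k + l`: this is `2 ^ ((k + l - 2 * s) / 2) • e'^{⊗ l} ∘ p ∘ e'^{⊗ k}`. -/
noncomputable def omegaDiagram {k l : ℕ} (p : EvenPartition k l) : omegaObj t k ⟶ omegaObj t l :=
  (2 : ℂ) ^ (((k : ℤ) + l - 2 * blockNumber p.1) / 2) • summandMap (ofDiagram t (uncoloured p.1))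

/-- The linear extension of `omegaDiagram`. -/
noncomputable def omegaMap {s : ℂ} {k l : ℕ} (f : (⟨k⟩ : RepZero s) ⟶ ⟨l⟩) :
    omegaObj t k ⟶ omegaObj t l :=
  Finsupp.linearCombination ℂ (omegaDiagram t) f

/-- The restriction of `Ω` to the objects `[k]` of `Rep₀(H_t)` is given by `[k] ↦ ([k], e'^{⊗ k})`
and by `omegaMap` on morphisms. -/
def ExtendsOmegaZero {t : ℂ} (Ω : RepH t ⥤ ParKar (2 * t)) : Prop :=
  ∃ h : ∀ k : ℕ, Ω.obj ((toEnvelope (RepZero t)).obj ⟨k⟩) = omegaObj (2 * t) k,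
    ∀ (k l : ℕ) (f : (⟨k⟩ : RepZero t) ⟶ ⟨l⟩),
      Ω.map ((toEnvelope (RepZero t)).map f) =
        eqToHom (h k) ≫ omegaMap (2 * t) f ≫ eqToHom (h l).symm

end Omega

end PartitionDiagram

open CategoryTheory PartitionDiagram

namespace PartitionDiagram

open CategoryTheory MonoidalCategory Idempotents

/-! ### Counting labellings -/

section Counting

variable {X Y K L M : Type}

/-! Vertical strands with labels `z` form an action of `{1,-1}^k` on `[k̃]`, and the tensor power of
`e'` is the projector `2^{-k} ∑ sgn z · z` to its sign part (`ePow_eq`, `signIdem`). Call it `e_k`.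
Between two such projectors a coloured partition loses its labels: they are absorbed as a sign.
Labels constant on the blocks of a partition `p` pass through `p` without changing it. If some block
is odd, such labels exist with total product `-1`, so `e_l p e_k` equals its own negative and
vanishes (`sandwich_eq_zero`). Hence `e_l Hom e_k` is spanned by the `e_l p e_k` with `p` even, and
these are independent because sending a coloured even partition to its signed underlying partition
is well defined. This makes `omegaHom` a bijection onto `e_l Hom e_k` (`evenPart_omegaHom`,
`omegaHom_evenPart`).

For compatibility with composition, expand the middle projector in `(e_m q e_l)(e_l p e_k)` over
labellings `z` of the `l` middle points. The term of `z` vanishes unless `z` is a product of middle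
labels constant on the blocks of `p` and of `q`, that is, unless `z` lies in the range `R` of
`midProduct`. In that case the labels slide to the outside, all signs cancel by evenness, and the
term is `(2t)^ℓ e_m (qp) e_k` (`sandwich_comp`). The kernel of `midProduct` consists of the
labellings of the stacking, so `|R| · 2^(b(qp) + ℓ) = 2^(b(p) + b(q))` (`card_range_midProduct`).
One factor 2 per loop turns `(2t)^ℓ` into `t^ℓ`, and the other powers of 2 are matched by the
normalisation in the definition of the functor (`coef_concat`).

The map `omegaHom` sends identities to the `e_k`, so it becomes a functor only on idempotent
completions, as `(M, p) ↦ (M̃, Ω₀(p))` (`stdOmega`). The bijection on morphisms makes it full and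
faithful. It is essentially surjective because `id = e_1 + (1 - e_1)` on `[1̃]` and `1 - e_1`
factors through `e_2` via the one-block partitions of sizes `(1, 2)` and `(2, 1)`; taking tensor
powers, every `[k̃]` is a retract of a sum of images of the `e_n` (`exists_sum_signIdem_eq_id`). It
is symmetric monoidal with structure maps given by identities, since `Ω₀` respects horizontal
concatenation and permutations.

Finally, an additive functor on the Karoubian envelope is determined up to isomorphism by its
restriction to the original category (`extendIsoToKaroubi`). So every extension of `Ω₀` is
isomorphic to `stdOmega`, and all the asserted properties are invariant under isomorphism. -/

/-- The group of the labellings that are constant on the blocks of `p`. -/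
def constSubgroup (p : Setoid X) : Subgroup (X → ℤˣ) where
  carrier := {b | ConstOnBlocks p b}
  mul_mem' := ConstOnBlocks.mul
  one_mem' := constOnBlocks_one p
  inv_mem' := fun {b} h x y hxy => by simp [h x y hxy]

theorem mem_constSubgroup {p : Setoid X} {b : X → ℤˣ} :
    b ∈ constSubgroup p ↔ ConstOnBlocks p b := Iff.rfl

/-- Labellings that are constant on blocks are labellings of the blocks. -/
def constSubgroupEquiv (p : Setoid X) : constSubgroup p ≃ (Quotient p → ℤˣ) where
  toFun b := Quotient.lift b.1 b.2
  invFun c := ⟨fun x => c (Quotient.mk p x), fun _ _ h => congrArg c (Quotient.sound h)⟩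
  left_inv _ := rfl
  right_inv c := by
    funext x
    induction x using Quotient.inductionOn with
    | h x => rfl

theorem card_constSubgroup [Finite X] (p : Setoid X) :
    Nat.card (constSubgroup p) = 2 ^ Nat.card (Quotient p) := by
  rw [Nat.card_congr (constSubgroupEquiv p), Nat.card_fun]
  simp

/-- The products of the middle labels of a labelling that is constant on the blocks of the lower
partition and one that is constant on the blocks of the upper partition. -/
def midProduct (p : Setoid (K ⊕ L)) (q : Setoid (L ⊕ M)) :
    constSubgroup p × constSubgroup q →* (L → ℤˣ) where
  toFun ab := (ab.1.1 ∘ Sum.inr) * (ab.2.1 ∘ Sum.inl)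
  map_one' := by ext; simp
  map_mul' a b := by ext; simp [mul_mul_mul_comm]

theorem midProduct_apply (p : Setoid (K ⊕ L)) (q : Setoid (L ⊕ M))
    (ab : constSubgroup p × constSubgroup q) :
    midProduct p q ab = (ab.1.1 ∘ Sum.inr) * (ab.2.1 ∘ Sum.inl) := rfl

/-- The kernel of `midProduct` consists of the labellings of the stacking. -/
def kerMidProductEquiv (p : Setoid (K ⊕ L)) (q : Setoid (L ⊕ M)) :
    (midProduct p q).ker ≃ Σ b : K ⊕ M → ℤˣ, {m : L → ℤˣ //
      ConstOnBlocks p (Sum.elim (b ∘ Sum.inl) m) ∧ ConstOnBlocks q (Sum.elim m (b ∘ Sum.inr))} where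
  toFun ab := ⟨Sum.elim (ab.1.1.1 ∘ Sum.inl) (ab.1.2.1 ∘ Sum.inr), ab.1.1.1 ∘ Sum.inr, by
    -- Labels are their own inverses, so a trivial product of the two middle rows means that the
    -- rows coincide.
    have h1 : ab.1.1.1 ∘ Sum.inr = ab.1.2.1 ∘ Sum.inl := by
      rw [← mul_right_cancel_iff (a := ab.1.2.1 ∘ Sum.inl), mul_self_one]
      exact ab.2
    constructor
    · rw [Sum.elim_comp_inl, Sum.elim_comp_inl_inr]
      exact ab.1.1.2
    · rw [h1, Sum.elim_comp_inr, Sum.elim_comp_inl_inr]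
      exact ab.1.2.2⟩
  invFun b := ⟨(⟨Sum.elim (b.1 ∘ Sum.inl) b.2.1, b.2.2.1⟩,
    ⟨Sum.elim b.2.1 (b.1 ∘ Sum.inr), b.2.2.2⟩), mul_self_one b.2.1⟩
  left_inv := by
    rintro ⟨⟨⟨a, ha⟩, ⟨b, hb⟩⟩, h⟩
    have h1 : a ∘ Sum.inr = b ∘ Sum.inl := by
      rw [← mul_right_cancel_iff (a := b ∘ Sum.inl), mul_self_one]
      exact h
    refine Subtype.ext (Prod.ext (Subtype.ext ?_) (Subtype.ext ?_))
    · ext (x | x) <;> rfl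
    · ext (x | x)
      · exact congrArg Units.val (congrFun h1 x)
      · rfl
  right_inv := by
    rintro ⟨b, m, h⟩
    obtain ⟨i, j, rfl⟩ : ∃ i j, b = Sum.elim i j :=
      ⟨b ∘ Sum.inl, b ∘ Sum.inr, (Sum.elim_comp_inl_inr b).symm⟩
    rfl

-- The kernel is fibred over the labellings of the outer rows. By `card_middle` the fibre has `2^ℓ`
-- elements over those constant on the blocks of the concatenation, and is empty otherwise.
open Classical in
theorem card_ker_midProduct [Finite K] [Finite L] [Finite M] (p : Setoid (K ⊕ L))
    (q : Setoid (L ⊕ M)) :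
    Nat.card (midProduct p q).ker = 2 ^ (Nat.card (Quotient (concat p q)) + loopNumber p q) := by
  have := Fintype.ofFinite K
  have := Fintype.ofFinite M
  rw [Nat.card_congr (kerMidProductEquiv p q), Nat.card_sigma]
  have h : ∀ b : K ⊕ M → ℤˣ, Nat.card {m : L → ℤˣ // ConstOnBlocks p (Sum.elim (b ∘ Sum.inl) m) ∧
      ConstOnBlocks q (Sum.elim m (b ∘ Sum.inr))} =
      if ConstOnBlocks (concat p q) b then 2 ^ loopNumber p q else 0 := fun b => by
    rw [card_middle, Sum.elim_comp_inl_inr]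
  simp only [h]
  rw [← Finset.sum_filter, Finset.sum_const, smul_eq_mul, pow_add, ← card_constSubgroup]
  congr 1
  rw [Nat.card_eq_fintype_card, ← Fintype.card_subtype]
  rfl

/-- Lagrange and the first isomorphism theorem for `midProduct`. Multiplying by the order of the
kernel avoids an exponent given by a subtraction. -/
theorem card_range_midProduct [Finite K] [Finite L] [Finite M] (p : Setoid (K ⊕ L))
    (q : Setoid (L ⊕ M)) :
    Nat.card (midProduct p q).range * 2 ^ (Nat.card (Quotient (concat p q)) + loopNumber p q) =
      2 ^ (Nat.card (Quotient p) + Nat.card (Quotient q)) := by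
  rw [← card_ker_midProduct, pow_add, ← card_constSubgroup, ← card_constSubgroup,
    ← Nat.card_prod (constSubgroup p) (constSubgroup q),
    Subgroup.card_eq_card_quotient_mul_card_subgroup (midProduct p q).ker,
    Nat.card_congr (QuotientGroup.quotientKerEquivRange (midProduct p q)).toEquiv]

/-- Blocks are counted through the `2^b` labellings constant on them: for a juxtaposition such a
labelling is a pair of labellings of the two halves. -/
theorem blockNumber_juxtapose {k k' l l' : ℕ} (p : Partition k l) (q : Partition k' l') :
    blockNumber (juxtapose p q) = blockNumber p + blockNumber q := by
  refine Nat.pow_right_injective le_rfl ?_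
  change 2 ^ blockNumber (juxtapose p q) = 2 ^ (blockNumber p + blockNumber q)
  rw [pow_add, blockNumber, blockNumber, blockNumber, ← card_constSubgroup, ← card_constSubgroup,
    ← card_constSubgroup, ← Nat.card_prod]
  refine Nat.card_congr
    { toFun := fun b => (⟨Sum.elim ((b.1 ∘ Sum.inl) ∘ Fin.castAdd k')
          ((b.1 ∘ Sum.inr) ∘ Fin.castAdd l'), ?_⟩,
        ⟨Sum.elim ((b.1 ∘ Sum.inl) ∘ Fin.natAdd k) ((b.1 ∘ Sum.inr) ∘ Fin.natAdd l), ?_⟩)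
      invFun := fun ab => ⟨Sum.elim (Fin.append (ab.1.1 ∘ Sum.inl) (ab.2.1 ∘ Sum.inl))
        (Fin.append (ab.1.1 ∘ Sum.inr) (ab.2.1 ∘ Sum.inr)), ?_⟩
      left_inv := ?_
      right_inv := ?_ }
  · exact (constOnBlocks_juxtapose.1 (by rw [Sum.elim_comp_inl_inr]; exact b.2)).1
  · exact (constOnBlocks_juxtapose.1 (by rw [Sum.elim_comp_inl_inr]; exact b.2)).2
  · refine constOnBlocks_juxtapose.2 ?_
    have h1 := ab.1.2
    have h2 := ab.2.2
    rw [← Sum.elim_comp_inl_inr ab.1.1] at h1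
    rw [← Sum.elim_comp_inl_inr ab.2.1] at h2
    have e : ∀ {m n : ℕ} (u : Fin m → ℤˣ) (v : Fin n → ℤˣ),
        Fin.append u v ∘ Fin.castAdd n = u ∧ Fin.append u v ∘ Fin.natAdd m = v :=
      fun u v => ⟨by ext; simp, by ext; simp⟩
    rw [(e _ _).1, (e _ _).1, (e _ _).2, (e _ _).2]
    exact ⟨h1, h2⟩
  · rintro ⟨b, hb⟩
    refine Subtype.ext ?_
    funext x
    rcases x with x | x <;> refine Fin.addCases (fun x => ?_) (fun x => ?_) x <;> simp
  · rintro ⟨⟨a, ha⟩, ⟨b, hb⟩⟩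
    refine Prod.ext (Subtype.ext ?_) (Subtype.ext ?_) <;> ext (x | x) <;> simp

theorem blockNumber_permPartition {k : ℕ} (σ : Fin k ≃ Fin k) :
    blockNumber (permPartition σ) = k := by
  rw [blockNumber, permPartition, Nat.card_congr (Setoid.quotientKerEquivOfSurjective _
    (fun x => ⟨Sum.inr x, rfl⟩)), Nat.card_eq_fintype_card, Fintype.card_fin]

/-- Apply the product criterion for evenness to the labelling that is `-1` everywhere. -/
theorem IsEven.even_add {k l : ℕ} {p : Partition k l} (hp : IsEven p) : Even (k + l) := by
  have := isEven_iff.1 hp (fun _ => -1) (fun _ _ _ => rfl)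
  rw [Finset.prod_const, Finset.card_univ, Fintype.card_sum, Fintype.card_fin, Fintype.card_fin]
    at this
  by_contra hn
  rw [Nat.not_even_iff_odd] at hn
  rw [hn.neg_one_pow] at this
  exact absurd this (by decide)

end Counting

/-! ### Signs and strands -/

section Strands

open DiagramFamily

/-- The product of the labels. -/
def sgn {k : ℕ} (z : Fin k → ℤˣ) : ℂ := ((∏ i, z i : ℤˣ) : ℤ)

theorem sgn_mul {k : ℕ} (z w : Fin k → ℤˣ) : sgn (z * w) = sgn z * sgn w := by
  simp [sgn, Finset.prod_mul_distrib]

theorem sgn_mul_self {k : ℕ} (z : Fin k → ℤˣ) : sgn z * sgn z = 1 := by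
  rw [← sgn_mul, mul_self_one]
  simp [sgn]

theorem sgn_append {k l : ℕ} (z : Fin k → ℤˣ) (w : Fin l → ℤˣ) :
    sgn (Fin.append z w) = sgn z * sgn w := by
  simp [sgn, Fin.prod_univ_add]

theorem sgn_comp {k : ℕ} (z : Fin k → ℤˣ) (σ : Equiv.Perm (Fin k)) : sgn (z ∘ σ) = sgn z := by
  simp only [sgn, Function.comp_apply, Equiv.prod_comp σ z]

/-- Evenness says that a labelling constant on blocks has total product 1. This is the source of
every cancellation of signs below. -/
theorem IsEven.sgn_eq {k l : ℕ} {p : Partition k l} (hp : IsEven p) {i : Fin k → ℤˣ}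
    {j : Fin l → ℤˣ} (h : ConstOnBlocks p (Sum.elim i j)) : sgn i = sgn j := by
  have := isEven_iff.1 hp _ h
  rw [Fintype.prod_sum_type] at this
  simp only [Sum.elim_inl, Sum.elim_inr] at this
  rw [sgn, sgn, eq_inv_of_mul_eq_one_left this, Int.units_inv_eq_self]

/-- The vertical strands with the labels `z` at the bottom and the labels `1` at the top. -/
def strand {k : ℕ} (z : Fin k → ℤˣ) : ColouredPartition k k :=
  Quotient.mk _ (permPartition (Equiv.refl _), Sum.elim z 1)

theorem sem_strand {k : ℕ} (z i j : Fin k → ℤˣ) : sem (strand z) i j ↔ j = z * i := by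
  change ConstOnBlocks (permPartition (Equiv.refl _)) (Sum.elim i j * Sum.elim z 1) ↔ _
  have : (Sum.elim i j * Sum.elim z 1 : Fin k ⊕ Fin k → ℤˣ) = Sum.elim (z * i) j := by
    ext (x | x) <;> simp [mul_comm]
  rw [this, constOnBlocks_permPartition]
  exact eq_comm

theorem sem_uncoloured {k l : ℕ} (p : Partition k l) (i : Fin k → ℤˣ) (j : Fin l → ℤˣ) :
    sem (uncoloured p) i j ↔ ConstOnBlocks p (Sum.elim i j) := by
  change ConstOnBlocks p (Sum.elim i j * 1) ↔ _
  rw [mul_one]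

/-- The strands with labels `z` as a weighted diagram. -/
def wstrand {k : ℕ} (z : Fin k → ℤˣ) : WDiag ColouredPartition k k := some (0, strand z)

theorem wmat_wstrand {k : ℕ} (z i j : Fin k → ℤˣ) :
    wmat (wstrand z) i j = if j = z * i then 1 else 0 := by
  classical
  simp [wstrand, wmat, sem_strand]

/-- The matrix of a strand diagram is the permutation matrix of translation by `z`, so composing
with it translates the row index. Identities between strands and partitions thereby become
identities between labellings. -/
theorem wmat_wstrand_wcomp {k l : ℕ} (z : Fin k → ℤˣ) (x : WDiag ColouredPartition k l)
    (i : Fin k → ℤˣ) (j : Fin l → ℤˣ) : wmat (wcomp (wstrand z) x) i j = wmat x (z * i) j := by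
  rw [wmat_wcomp, Finset.sum_eq_single (z * i)]
  · rw [wmat_wstrand, if_pos rfl, one_mul]
  · intro u _ hu
    rw [wmat_wstrand, if_neg hu, zero_mul]
  · simp

theorem wmat_wcomp_wstrand {k l : ℕ} (z : Fin l → ℤˣ) (x : WDiag ColouredPartition k l)
    (i : Fin k → ℤˣ) (j : Fin l → ℤˣ) : wmat (wcomp x (wstrand z)) i j = wmat x i (z * j) := by
  rw [wmat_wcomp, Finset.sum_eq_single (z * j)]
  · rw [wmat_wstrand, if_pos (by rw [← mul_assoc, mul_self_one, one_mul]), mul_one]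
  · intro u _ hu
    rw [wmat_wstrand, if_neg, mul_zero]
    rintro rfl
    exact hu (by rw [← mul_assoc, mul_self_one, one_mul])
  · simp

theorem wstrand_one (k : ℕ) : wstrand (1 : Fin k → ℤˣ) = wperm (Equiv.refl _) :=
  wmat_injective fun i j => by
    rw [wmat_wstrand, wmat_wperm, one_mul]
    exact if_congr eq_comm rfl rfl

theorem wstrand_wcomp_wstrand {k : ℕ} (z w : Fin k → ℤˣ) :
    wcomp (wstrand z) (wstrand w) = wstrand (z * w) :=
  wmat_injective fun i j => by
    rw [wmat_wstrand_wcomp, wmat_wstrand, wmat_wstrand, ← mul_assoc, mul_comm w]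

/-- Labels slide along the strands of a permutation diagram. -/
theorem wstrand_wcomp_wperm {k : ℕ} (z : Fin k → ℤˣ) (σ : Equiv.Perm (Fin k)) :
    wcomp (wstrand (z ∘ σ)) (wperm σ) = wcomp (wperm σ) (wstrand z) :=
  wmat_injective fun i j => by
    rw [wmat_wstrand_wcomp, wmat_wcomp_wstrand, wmat_wperm, wmat_wperm]
    refine if_congr ?_ rfl rfl
    constructor
    · intro h
      rw [Pi.mul_comp, ← h, ← mul_assoc, mul_self_one, one_mul]
    · rintro rfl
      rw [Pi.mul_comp, ← mul_assoc, mul_self_one, one_mul]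

theorem wtensor_wstrand {k l : ℕ} (z : Fin k → ℤˣ) (w : Fin l → ℤˣ) :
    wtensor (wstrand z) (wstrand w) = wstrand (Fin.append z w) :=
  wmat_injective fun i j => by
    rw [wmat_wtensor, wmat_wstrand, wmat_wstrand, wmat_wstrand]
    have : j = Fin.append z w * i ↔ j ∘ Fin.castAdd l = z * i ∘ Fin.castAdd l ∧
        j ∘ Fin.natAdd k = w * i ∘ Fin.natAdd k := by
      constructor
      · rintro rfl
        exact ⟨by ext; simp, by ext; simp⟩
      · rintro ⟨h1, h2⟩
        funext x
        refine Fin.addCases (fun x => ?_) (fun x => ?_) x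
        · simpa using congrFun h1 x
        · simpa using congrFun h2 x
    simp only [this]
    split_ifs <;> simp_all

/-- Multiply all labels by `c`. -/
def relabel {k l : ℕ} (c : Fin k ⊕ Fin l → ℤˣ) (P : ColouredPartition k l) :
    ColouredPartition k l :=
  Quotient.map (fun a => (a.1, c * a.2)) (fun a b h => by
    obtain ⟨h, d, hd, hb⟩ := h
    exact ⟨h, d, hd, by rw [hb, mul_left_comm]⟩) P

theorem sem_relabel {k l : ℕ} (z : Fin k → ℤˣ) (w : Fin l → ℤˣ) (P : ColouredPartition k l)
    (i : Fin k → ℤˣ) (j : Fin l → ℤˣ) :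
    sem (relabel (Sum.elim z w) P) i j ↔ sem P (z * i) (w * j) := by
  induction P using Quotient.inductionOn with
  | h a =>
    change ConstOnBlocks a.1 _ ↔ ConstOnBlocks a.1 _
    refine iff_of_eq (congrArg _ ?_)
    ext (x | x) <;> simp [mul_left_comm, mul_assoc]

theorem wstrand_wcomp_wcomp_wstrand {k l : ℕ} (z : Fin k → ℤˣ) (w : Fin l → ℤˣ) (a : ℕ)
    (P : ColouredPartition k l) :
    wcomp (wstrand z) (wcomp (some (a, P)) (wstrand w)) = some (a, relabel (Sum.elim z w) P) := by
  classical
  refine wmat_injective fun i j => ?_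
  rw [wmat_wstrand_wcomp, wmat_wcomp_wstrand]
  simp only [wmat, sem_relabel]

theorem relabel_uncoloured {k l : ℕ} {p : Partition k l} {a : Fin k ⊕ Fin l → ℤˣ}
    (h : ConstOnBlocks p a) : relabel a (uncoloured p) = uncoloured p :=
  (Quotient.sound ⟨rfl, a, h, rfl⟩ : uncoloured p = Quotient.mk _ (p, a * 1)).symm

/-- Both matrices count the middle labellings compatible with `p` and `q`. Going through matrices
avoids the choice of representatives in the definition of composition. -/
theorem wcomp_uncoloured {k l m : ℕ} (p : Partition k l) (q : Partition l m) :
    wcomp (some (0, uncoloured p)) (some (0, uncoloured q)) =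
      some (loopNumber p q, uncoloured (concat p q)) := by
  classical
  refine wmat_injective fun i j => ?_
  rw [wmat_wcomp]
  simp only [wmat, sem_uncoloured, pow_zero, ← card_middle, mul_ite, mul_one, mul_zero]
  rw [Nat.card_eq_fintype_card, Fintype.card_subtype, Finset.card_filter]
  refine Finset.sum_congr rfl fun u _ => ?_
  by_cases h1 : ConstOnBlocks p (Sum.elim i u) <;>
    by_cases h2 : ConstOnBlocks q (Sum.elim u j) <;> simp [h1, h2]

/-- A non-zero matrix entry would give a middle row `u` fitting `p` from above with `z * u` fitting
`q` from below, and their product is `z`. -/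
theorem wcomp_uncoloured_wstrand {k l m : ℕ} (p : Partition k l) (q : Partition l m)
    {z : Fin l → ℤˣ} (hz : z ∉ (midProduct p q).range) :
    wcomp (some (0, uncoloured p)) (wcomp (wstrand z) (some (0, uncoloured q))) = none := by
  classical
  refine wmat_injective fun i j => ?_
  rw [wmat_wcomp]
  refine Finset.sum_eq_zero fun u _ => ?_
  rw [wmat_wstrand_wcomp]
  simp only [wmat, sem_uncoloured]
  by_cases h1 : ConstOnBlocks p (Sum.elim i u)
  · refine mul_eq_zero_of_right _ (if_neg fun h2 => ?_)
    refine hz ⟨(⟨_, h1⟩, ⟨_, h2⟩), ?_⟩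
    rw [midProduct_apply, Sum.elim_comp_inl, Sum.elim_comp_inr, mul_left_comm, mul_self_one,
      mul_one]
  · rw [if_neg h1, zero_mul]

theorem hconcat_uncoloured {k k' l l' : ℕ} (p : Partition k l) (q : Partition k' l') :
    hconcat (uncoloured p) (uncoloured q) = uncoloured (juxtapose p q) :=
  sem_injective _ _ fun i j => by
    rw [sem_hconcat, sem_uncoloured, sem_uncoloured, sem_uncoloured, constOnBlocks_juxtapose]

end Strands

/-! ### The sign idempotent -/

section SignIdempotent

variable (T : ℂ)

theorem ofDiagram_eq {k l : ℕ} (P : ColouredPartition k l) :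
    (ofDiagram T P : (⟨k⟩ : ParZTwo T) ⟶ ⟨l⟩) = DiagramCat.ofW (some (0, P)) :=
  single_eq_eval T P

/-- The strands with labels `z` as a morphism. -/
noncomputable def strandHom {k : ℕ} (z : Fin k → ℤˣ) : (⟨k⟩ : ParZTwo T) ⟶ ⟨k⟩ :=
  DiagramCat.ofW (wstrand z)

theorem strandHom_one (k : ℕ) : strandHom T (1 : Fin k → ℤˣ) = 𝟙 _ :=
  congrArg DiagramCat.ofW (wstrand_one k)

theorem strandHom_comp {k : ℕ} (z w : Fin k → ℤˣ) :
    strandHom T z ≫ strandHom T w = strandHom T (z * w) :=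
  (DiagramCat.ofW_comp _ _).trans (congrArg DiagramCat.ofW (wstrand_wcomp_wstrand z w))

theorem strandHom_comp_self {k : ℕ} (z : Fin k → ℤˣ) : strandHom T z ≫ strandHom T z = 𝟙 _ := by
  rw [strandHom_comp, mul_self_one, strandHom_one]

theorem strandHom_tensor {k l : ℕ} (z : Fin k → ℤˣ) (w : Fin l → ℤˣ) :
    strandHom T z ⊗ₘ strandHom T w = strandHom T (Fin.append z w) :=
  (DiagramCat.ofW_tensor _ _).trans (congrArg DiagramCat.ofW (wtensor_wstrand z w))

/-- The morphism given by a permutation. -/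
noncomputable def permHom {k l : ℕ} (σ : Fin k ≃ Fin l) : (⟨k⟩ : ParZTwo T) ⟶ ⟨l⟩ :=
  DiagramCat.ofW (wperm σ)

theorem strandHom_permHom {k : ℕ} (z : Fin k → ℤˣ) (σ : Equiv.Perm (Fin k)) :
    strandHom T (z ∘ σ) ≫ permHom T σ = permHom T σ ≫ strandHom T z :=
  (DiagramCat.ofW_comp _ _).trans ((congrArg DiagramCat.ofW (wstrand_wcomp_wperm z σ)).trans
    (DiagramCat.ofW_comp _ _).symm)

theorem strandHom_diagram_strandHom {k l : ℕ} (z : Fin k → ℤˣ) (w : Fin l → ℤˣ)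
    (P : ColouredPartition k l) :
    strandHom T z ≫ ofDiagram T P ≫ strandHom T w = ofDiagram T (relabel (Sum.elim z w) P) := by
  rw [ofDiagram_eq, ofDiagram_eq]
  exact (congrArg _ (DiagramCat.ofW_comp _ _)).trans ((DiagramCat.ofW_comp _ _).trans
    (congrArg DiagramCat.ofW (wstrand_wcomp_wcomp_wstrand z w 0 P)))

theorem uncoloured_comp {k l m : ℕ} (p : Partition k l) (q : Partition l m) :
    ofDiagram T (uncoloured p) ≫ ofDiagram T (uncoloured q) =
      T ^ loopNumber p q • ofDiagram T (uncoloured (concat p q)) := by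
  rw [ofDiagram_eq, ofDiagram_eq]
  refine (DiagramCat.ofW_comp _ _).trans ((congrArg DiagramCat.ofW (wcomp_uncoloured p q)).trans ?_)
  exact (Finsupp.smul_single_one _ _).symm

theorem uncoloured_tensor {k k' l l' : ℕ} (p : Partition k l) (q : Partition k' l') :
    ofDiagram T (uncoloured p) ⊗ₘ ofDiagram T (uncoloured q) =
      ofDiagram T (uncoloured (juxtapose p q)) := by
  rw [ofDiagram_eq, ofDiagram_eq, ofDiagram_eq, ← hconcat_uncoloured]
  exact DiagramCat.ofW_tensor _ _

/-- Labels that are constant on blocks can be moved through a partition. -/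
theorem uncoloured_comp_strandHom {k l : ℕ} {p : Partition k l} {a : Fin k ⊕ Fin l → ℤˣ}
    (h : ConstOnBlocks p a) :
    ofDiagram T (uncoloured p) ≫ strandHom T (a ∘ Sum.inr) =
      strandHom T (a ∘ Sum.inl) ≫ ofDiagram T (uncoloured p) := by
  -- Relabelling `p` by `a` does nothing, so `p` equals itself with strands `a` on both sides; the
  -- bottom strand is an involution and cancels.
  have := strandHom_diagram_strandHom T (a ∘ Sum.inl) (a ∘ Sum.inr) (uncoloured p)
  rw [Sum.elim_comp_inl_inr, relabel_uncoloured h] at this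
  nth_rewrite 2 [← this]
  rw [← Category.assoc (strandHom T (a ∘ Sum.inl)), strandHom_comp_self, Category.id_comp]

/-- The projection to the part of `[k]` on which the strands with labels `z` act by the product of
the labels. -/
noncomputable def signIdem (k : ℕ) : (⟨k⟩ : ParZTwo T) ⟶ ⟨k⟩ :=
  ((2 : ℂ) ^ k)⁻¹ • ∑ z : Fin k → ℤˣ, sgn z • strandHom T z

theorem card_labels (k : ℕ) : (Finset.univ : Finset (Fin k → ℤˣ)).card = 2 ^ k := by
  simp

/-- Reindexing the sum by `z ↦ w * z` costs the factor `sgn w`, because `sgn` is a character with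
values `±1`. -/
theorem strandHom_signIdem {k : ℕ} (w : Fin k → ℤˣ) :
    strandHom T w ≫ signIdem T k = sgn w • signIdem T k := by
  unfold signIdem
  rw [Linear.comp_smul, Preadditive.comp_sum, smul_comm (sgn w), Finset.smul_sum (r := sgn w)]
  refine congrArg (((2 : ℂ) ^ k)⁻¹ • ·) ?_
  refine Fintype.sum_equiv (Equiv.mulLeft w) _ _ fun z => ?_
  rw [Linear.comp_smul, strandHom_comp, Equiv.coe_mulLeft, sgn_mul, smul_smul, ← mul_assoc,
    sgn_mul_self, one_mul]

theorem signIdem_strandHom {k : ℕ} (w : Fin k → ℤˣ) :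
    signIdem T k ≫ strandHom T w = sgn w • signIdem T k := by
  rw [← strandHom_signIdem]
  unfold signIdem
  rw [Linear.comp_smul, Linear.smul_comp, Preadditive.comp_sum, Preadditive.sum_comp]
  simp only [Linear.comp_smul, Linear.smul_comp, strandHom_comp, mul_comm w]

/-- Each of the `2^k` terms of the left factor acts by `sgn z`, which meets its coefficient `sgn z`
and gives one copy of the idempotent. -/
theorem signIdem_idem (k : ℕ) : signIdem T k ≫ signIdem T k = signIdem T k := by
  conv_lhs => enter [1]; unfold signIdem
  rw [Linear.smul_comp, Preadditive.sum_comp]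
  simp only [Linear.smul_comp, strandHom_signIdem, smul_smul, sgn_mul_self]
  rw [Finset.sum_const, card_labels, one_smul, ← Nat.cast_smul_eq_nsmul ℂ, smul_smul]
  push_cast
  rw [inv_mul_cancel₀ (pow_ne_zero k two_ne_zero), one_smul]

/-- Moving the labels past `σ` permutes the summands and does not change the product of the labels.
-/
theorem signIdem_permHom {k : ℕ} (σ : Equiv.Perm (Fin k)) :
    signIdem T k ≫ permHom T σ = permHom T σ ≫ signIdem T k := by
  unfold signIdem
  rw [Linear.comp_smul, Linear.smul_comp, Preadditive.comp_sum, Preadditive.sum_comp]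
  congr 1
  refine Fintype.sum_equiv (Equiv.arrowCongr σ (Equiv.refl _)) _ _ fun z => ?_
  have : z = (Equiv.arrowCongr σ (Equiv.refl ℤˣ) z) ∘ σ := by ext; simp [Equiv.arrowCongr]
  conv_lhs => rw [this]
  rw [Linear.comp_smul, Linear.smul_comp, strandHom_permHom, sgn_comp]

theorem signIdem_tensor (k l : ℕ) :
    signIdem T k ⊗ₘ signIdem T l = signIdem T (k + l) := by
  unfold signIdem
  rw [DiagramCat.smul_tensorHom, DiagramCat.tensorHom_smul, sum_tensor, smul_smul, ← mul_inv,
    ← pow_add]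
  refine congrArg (((2 : ℂ) ^ (k + l))⁻¹ • ·) ?_
  simp only [tensor_sum]
  rw [← Finset.sum_product']
  refine Fintype.sum_equiv (Fin.appendEquiv k l) _ _ fun z => ?_
  rw [DiagramCat.smul_tensorHom, DiagramCat.tensorHom_smul, strandHom_tensor, smul_smul]
  exact congrArg (· • strandHom T (Fin.append z.1 z.2)) (sgn_append z.1 z.2).symm

theorem signIdem_zero : signIdem T 0 = 𝟙 _ := by
  unfold signIdem
  rw [Fintype.sum_eq_single 1 (fun z hz => absurd (Subsingleton.elim _ _) hz), strandHom_one]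
  simp [sgn]

theorem signIdem_one : signIdem T 1 = ePrime T := by
  have h : ∀ z : Fin 1 → ℤˣ, z = 1 ∨ z = -1 := fun z => by
    rcases Int.units_eq_one_or (z 0) with h | h
    · exact .inl (funext fun x => by rw [Subsingleton.elim x 0, h]; rfl)
    · exact .inr (funext fun x => by rw [Subsingleton.elim x 0, h]; rfl)
  have hne : (1 : Fin 1 → ℤˣ) ≠ -1 := fun h => absurd (congrFun h 0) (by decide)
  have hm : strandHom T (-1 : Fin 1 → ℤˣ) = ofDiagram T minusStrand := by
    rw [ofDiagram_eq]
    rfl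
  unfold signIdem ePrime
  rw [Fintype.sum_eq_add 1 (-1) hne (fun z hz => absurd (h z) (by tauto)), strandHom_one, hm,
    pow_one]
  simp [sgn, sub_eq_add_neg]

/-- Replaces the recursive tensor power in the statement by a closed sum, on which strands,
permutations and tensor products act by reindexing. -/
theorem ePow_eq : ∀ k : ℕ, ePow T k = signIdem T k
  | 0 => (signIdem_zero T).symm
  | k + 1 => by
    rw [← signIdem_tensor, signIdem_one, ← ePow_eq k]
    rfl

end SignIdempotent

/-! ### Partitions between sign idempotents -/

section Sandwich

variable (T : ℂ)

/-- A partition between two sign idempotents. -/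
noncomputable def sandwich {k l : ℕ} (p : Partition k l) : (⟨k⟩ : ParZTwo T) ⟶ ⟨l⟩ :=
  signIdem T k ≫ ofDiagram T (uncoloured p) ≫ signIdem T l

/-- Strands next to a sign idempotent are absorbed as scalars. Labels on a diagram therefore only
matter through their product. -/
theorem signIdem_strandHom_signIdem {k l : ℕ} (z : Fin k → ℤˣ) (w : Fin l → ℤˣ)
    (f : (⟨k⟩ : ParZTwo T) ⟶ ⟨l⟩) :
    signIdem T k ≫ (strandHom T z ≫ f ≫ strandHom T w) ≫ signIdem T l =
      (sgn z * sgn w) • (signIdem T k ≫ f ≫ signIdem T l) := by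
  simp only [Category.assoc]
  rw [strandHom_signIdem, ← Category.assoc (signIdem T k), signIdem_strandHom, Linear.smul_comp,
    Linear.comp_smul, Linear.comp_smul, smul_smul]

/-- The terms of the middle projector with `z` in the range all contribute equally, independently of
`z`. -/
theorem sandwich_strandHom_sandwich {k l m : ℕ} {p : Partition k l} {q : Partition l m}
    (hp : IsEven p) (hq : IsEven q) {z : Fin l → ℤˣ} (hz : z ∈ (midProduct p q).range) :
    sgn z • (signIdem T k ≫ (ofDiagram T (uncoloured p) ≫ strandHom T z ≫
      ofDiagram T (uncoloured q)) ≫ signIdem T m) =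
      T ^ loopNumber p q • sandwich T (concat p q) := by
  obtain ⟨⟨⟨a, ha⟩, ⟨b, hb⟩⟩, rfl⟩ := hz
  rw [mem_constSubgroup] at ha hb
  -- The part of the middle label coming from `p` slides down through `p`, the part coming from `q`
  -- slides up through `q`.
  have hs : ofDiagram T (uncoloured p) ≫ strandHom T ((a ∘ Sum.inr) * (b ∘ Sum.inl)) ≫
      ofDiagram T (uncoloured q) = strandHom T (a ∘ Sum.inl) ≫ (T ^ loopNumber p q •
        ofDiagram T (uncoloured (concat p q))) ≫ strandHom T (b ∘ Sum.inr) := by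
    rw [← uncoloured_comp, Category.assoc, uncoloured_comp_strandHom T hb, ← strandHom_comp,
      ← Category.assoc (strandHom T (a ∘ Sum.inl)), ← uncoloured_comp_strandHom T ha]
    simp only [Category.assoc]
  -- Evenness identifies the sign of the bottom row of `a` with that of its middle row, and the sign
  -- of the top row of `b` with that of its middle row. Every sign then occurs twice.
  rw [midProduct_apply, hs, signIdem_strandHom_signIdem, sgn_mul,
    ← hp.sgn_eq (by rwa [Sum.elim_comp_inl_inr] : ConstOnBlocks p (Sum.elim (a ∘ Sum.inl)
      (a ∘ Sum.inr))), hq.sgn_eq (by rwa [Sum.elim_comp_inl_inr] : ConstOnBlocks q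
      (Sum.elim (b ∘ Sum.inl) (b ∘ Sum.inr))), smul_smul, mul_mul_mul_comm, sgn_mul_self,
    sgn_mul_self, one_mul, one_smul, Linear.smul_comp, Linear.comp_smul, sandwich]

theorem sandwich_strandHom_sandwich_eq_zero {k l m : ℕ} {p : Partition k l} {q : Partition l m}
    {z : Fin l → ℤˣ} (hz : z ∉ (midProduct p q).range) :
    ofDiagram T (uncoloured p) ≫ strandHom T z ≫ ofDiagram T (uncoloured q) = 0 := by
  rw [ofDiagram_eq, ofDiagram_eq]
  exact (congrArg _ (DiagramCat.ofW_comp _ _)).trans ((DiagramCat.ofW_comp _ _).trans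
    (congrArg DiagramCat.ofW (wcomp_uncoloured_wstrand p q hz)))

/-- Expanding the middle projector leaves `2^{-l}` times one equal term for each `z` in the range of
`midProduct`; the other terms vanish. -/
theorem sandwich_comp {k l m : ℕ} {p : Partition k l} {q : Partition l m}
    (hp : IsEven p) (hq : IsEven q) :
    sandwich T p ≫ sandwich T q =
      (((2 : ℂ) ^ l)⁻¹ * Nat.card (midProduct p q).range * T ^ loopNumber p q) •
        sandwich T (concat p q) := by
  classical
  have h1 : sandwich T p ≫ sandwich T q = signIdem T k ≫ (ofDiagram T (uncoloured p) ≫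
      signIdem T l ≫ ofDiagram T (uncoloured q)) ≫ signIdem T m := by
    unfold sandwich
    simp only [Category.assoc]
    rw [← Category.assoc (signIdem T l) (signIdem T l), signIdem_idem]
  have h2 : sandwich T p ≫ sandwich T q = ((2 : ℂ) ^ l)⁻¹ • ∑ z : Fin l → ℤˣ,
      sgn z • (signIdem T k ≫ (ofDiagram T (uncoloured p) ≫ strandHom T z ≫
        ofDiagram T (uncoloured q)) ≫ signIdem T m) := by
    rw [h1]
    conv_lhs => enter [2, 1, 2, 1]; unfold signIdem
    simp only [Linear.smul_comp, Linear.comp_smul, Preadditive.sum_comp, Preadditive.comp_sum]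
  rw [h2, mul_assoc, ← smul_smul]
  refine congrArg (((2 : ℂ) ^ l)⁻¹ • ·) ?_
  have h3 : ∀ z : Fin l → ℤˣ, sgn z • (signIdem T k ≫ (ofDiagram T (uncoloured p) ≫
      strandHom T z ≫ ofDiagram T (uncoloured q)) ≫ signIdem T m) =
      if z ∈ (midProduct p q).range then T ^ loopNumber p q • sandwich T (concat p q) else 0 := by
    intro z
    split_ifs with hz
    · exact sandwich_strandHom_sandwich T hp hq hz
    · rw [sandwich_strandHom_sandwich_eq_zero T hz, Limits.zero_comp, Limits.comp_zero, smul_zero]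
  rw [Finset.sum_congr rfl fun z _ => h3 z, ← Finset.sum_filter, Finset.sum_const,
    ← Nat.cast_smul_eq_nsmul ℂ, smul_smul, Nat.card_eq_fintype_card, ← Fintype.card_subtype]

/-- The coefficient of a partition in the definition of `omegaDiagram`. -/
noncomputable def coef {k l : ℕ} (p : Partition k l) : ℂ :=
  (2 : ℂ) ^ (((k : ℤ) + l - 2 * blockNumber p) / 2)

theorem coef_ne_zero {k l : ℕ} (p : Partition k l) : coef p ≠ 0 := zpow_ne_zero _ two_ne_zero

/-- For `k + l` even the integer division in the exponent is exact. In this form the block numbers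
can be cancelled as natural powers of 2. -/
theorem coef_mul_pow {k l h : ℕ} (p : Partition k l) (hkl : k + l = h + h) :
    coef p * 2 ^ blockNumber p = 2 ^ h := by
  have : ((k : ℤ) + l - 2 * blockNumber p) / 2 = h - blockNumber p := by omega
  rw [coef, this, zpow_sub₀ two_ne_zero, zpow_natCast, zpow_natCast,
    div_mul_cancel₀ _ (pow_ne_zero _ two_ne_zero)]

theorem coef_permPartition {k : ℕ} (σ : Equiv.Perm (Fin k)) : coef (permPartition σ) = 1 := by
  have := coef_mul_pow (permPartition σ) rfl
  rw [blockNumber_permPartition] at this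
  exact mul_right_cancel₀ (pow_ne_zero k two_ne_zero) (this.trans (one_mul _).symm)

theorem coef_juxtapose {k l k' l' : ℕ} {p : Partition k l} {q : Partition k' l'} (hp : IsEven p)
    (hq : IsEven q) : coef (juxtapose p q) = coef p * coef q := by
  obtain ⟨h, hh⟩ := hp.even_add
  obtain ⟨h', hh'⟩ := hq.even_add
  have e : k + k' + (l + l') = (h + h') + (h + h') := by omega
  have := coef_mul_pow (juxtapose p q) e
  rw [blockNumber_juxtapose, pow_add, pow_add, ← coef_mul_pow p hh, ← coef_mul_pow q hh'] at this
  refine mul_right_cancel₀ (mul_ne_zero (pow_ne_zero (blockNumber p) (two_ne_zero (α := ℂ)))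
    (pow_ne_zero (blockNumber q) two_ne_zero)) (this.trans (by ring))

/-- The normalisation was chosen for this identity. The powers of 2 balance by the size of the range
of `midProduct` together with `(k + l)/2 + (l + m)/2 = (k + m)/2 + l`, and each loop uses up the 2
in `2 * t`. -/
theorem coef_concat (t : ℂ) {k l m : ℕ} {p : Partition k l} {q : Partition l m} (hp : IsEven p)
    (hq : IsEven q) : coef p * coef q * (((2 : ℂ) ^ l)⁻¹ * Nat.card (midProduct p q).range *
      (2 * t) ^ loopNumber p q) = t ^ loopNumber p q * coef (concat p q) := by
  obtain ⟨h, hh⟩ := hp.even_add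
  obtain ⟨h', hh'⟩ := hq.even_add
  obtain ⟨h'', hh''⟩ := (hp.concat hq).even_add
  have h1 := coef_mul_pow p hh
  have h2 := coef_mul_pow q hh'
  have h3 := coef_mul_pow (concat p q) hh''
  have h4 : (Nat.card (midProduct p q).range : ℂ) *
      2 ^ (blockNumber (concat p q) + loopNumber p q) = 2 ^ (blockNumber p + blockNumber q) :=
    mod_cast card_range_midProduct p q
  have h5 : (2 : ℂ) ^ h * 2 ^ h' = 2 ^ h'' * 2 ^ l := by
    rw [← pow_add, ← pow_add]
    congr 1
    omega
  have h6 : (2 : ℂ) ^ l ≠ 0 := pow_ne_zero _ two_ne_zero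
  refine mul_right_cancel₀ (mul_ne_zero (pow_ne_zero (blockNumber (concat p q))
    (two_ne_zero (α := ℂ))) h6) ?_
  calc _ = coef p * coef q * t ^ loopNumber p q * (Nat.card (midProduct p q).range *
        2 ^ (blockNumber (concat p q) + loopNumber p q)) * ((2 ^ l)⁻¹ * 2 ^ l) := by
        rw [mul_pow, pow_add]; ring
    _ = t ^ loopNumber p q * ((coef p * 2 ^ blockNumber p) * (coef q * 2 ^ blockNumber q)) := by
        rw [h4, inv_mul_cancel₀ h6, pow_add]; ring
    _ = t ^ loopNumber p q * ((coef (concat p q) * 2 ^ blockNumber (concat p q)) * 2 ^ l) := by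
        rw [h1, h2, h3, h5]
    _ = _ := by ring

theorem sandwich_permPartition {k : ℕ} (σ : Equiv.Perm (Fin k)) :
    sandwich T (permPartition σ) = permHom T σ ≫ signIdem T k := by
  have : ofDiagram T (uncoloured (permPartition σ)) = permHom T σ := ofDiagram_eq T _
  rw [sandwich, this, ← Category.assoc, signIdem_permHom, Category.assoc, signIdem_idem]

theorem sandwich_tensor {k l k' l' : ℕ} (p : Partition k l) (q : Partition k' l') :
    sandwich T p ⊗ₘ sandwich T q = sandwich T (juxtapose p q) := by
  unfold sandwich
  rw [← tensorHom_comp_tensorHom, ← tensorHom_comp_tensorHom, signIdem_tensor, signIdem_tensor,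
    uncoloured_tensor]

/-- Some labelling constant on the blocks has product `-1`. Relabelling by it fixes `p`, while the
projectors absorb it as `-1`, so the morphism is its own negative. -/
theorem sandwich_eq_zero {k l : ℕ} {p : Partition k l} (hp : ¬ IsEven p) : sandwich T p = 0 := by
  classical
  rw [isEven_iff] at hp
  push Not at hp
  obtain ⟨b, hb, hne⟩ := hp
  have hs : sgn (b ∘ Sum.inl) * sgn (b ∘ Sum.inr) = -1 := by
    rw [Fintype.prod_sum_type] at hne
    have := (Int.units_eq_one_or _).resolve_left hne
    simp only [sgn, Function.comp_apply]
    rw [← Int.cast_mul, ← Units.val_mul, this]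
    simp
  have := signIdem_strandHom_signIdem T (b ∘ Sum.inl) (b ∘ Sum.inr) (ofDiagram T (uncoloured p))
  rw [strandHom_diagram_strandHom, Sum.elim_comp_inl_inr, relabel_uncoloured hb, hs] at this
  rw [sandwich]
  have h2 : (2 : ℂ) • (signIdem T k ≫ ofDiagram T (uncoloured p) ≫ signIdem T l) = 0 := by
    rw [two_smul]
    nth_rewrite 1 [this]
    rw [neg_smul, one_smul, neg_add_cancel]
  exact (smul_eq_zero.1 h2).resolve_left two_ne_zero

end Sandwich

/-! ### The functor on morphisms and its inverse -/

section OmegaHom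

variable {t : ℂ}

/-- The object `[k̃]` for the object `[k]`. -/
abbrev colourObj (X : RepZero t) : ParZTwo (2 * t) := ⟨X.n⟩

/-- The map `f ↦ Ω₀(f)` on morphisms, with values in `Par(ℤ/2, 2t)`. -/
noncomputable def omegaHom {X Y : RepZero t} : (X ⟶ Y) →ₗ[ℂ] (colourObj X ⟶ colourObj Y) :=
  (Finsupp.linearCombination ℂ fun p : EvenPartition X.n Y.n =>
    (coef p.1 • sandwich (2 * t) p.1 : colourObj X ⟶ colourObj Y) :
    (EvenPartition X.n Y.n →₀ ℂ) →ₗ[ℂ] (colourObj X ⟶ colourObj Y))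

theorem omegaHom_single {X Y : RepZero t} (p : EvenPartition X.n Y.n) (c : ℂ) :
    omegaHom (X := X) (Y := Y) (Finsupp.single p c) = c • coef p.1 • sandwich (2 * t) p.1 :=
  Finsupp.linearCombination_single ℂ c p

/-- To prove a linear identity, it suffices to treat single diagrams. -/
theorem diagram_induction {D : ℕ → ℕ → Type} [DiagramFamily D] {s : ℂ} {X Y : DiagramCat D s}
    {P : (X ⟶ Y) → Prop} (f : X ⟶ Y) (zero : P 0) (add : ∀ f g, P f → P g → P (f + g))
    (smul : ∀ (c : ℂ) f, P f → P (c • f)) (single : ∀ p : D X.n Y.n, P (Finsupp.single p (1 : ℂ))) :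
    P f := by
  refine Finsupp.induction_linear (motive := P) f zero add fun p c => ?_
  have : (Finsupp.single p c : D X.n Y.n →₀ ℂ) = c • Finsupp.single p (1 : ℂ) := by simp
  rw [this]
  exact smul c _ (single p)

theorem single_comp {X Y Z : RepZero t} (p : EvenPartition X.n Y.n) (q : EvenPartition Y.n Z.n) :
    (show X ⟶ Y from Finsupp.single p (1 : ℂ)) ≫ (show Y ⟶ Z from Finsupp.single q (1 : ℂ)) =
      (show X ⟶ Z from Finsupp.single ⟨concat p.1 q.1, p.2.concat q.2⟩
        (t ^ loopNumber p.1 q.1)) := by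
  have := DiagramCat.ofW_comp (t := t) (X := X) (Y := Y) (Z := Z) (some (0, p)) (some (0, q))
  refine Eq.trans ?_ (this.trans ?_)
  · exact congrArg₂ (fun f g => (show X ⟶ Y from f) ≫ (show Y ⟶ Z from g))
      (single_eq_eval t p) (single_eq_eval t q)
  · change evalLoops t (some (0 + 0 + loopNumber p.1 q.1, _)) = _
    rw [zero_add, zero_add]
    rfl

/-- By bilinearity it suffices to treat two even partitions, where `sandwich_comp` at the parameter
`2 * t` meets the normalisation identity `coef_concat`. -/
theorem omegaHom_comp {X Y Z : RepZero t} (f : X ⟶ Y) (g : Y ⟶ Z) :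
    omegaHom (f ≫ g) = omegaHom f ≫ omegaHom g := by
  induction f using diagram_induction
  case zero => simp
  case add f f' hf hf' => simp [hf, hf']
  case smul c f hf => simp [hf]
  rename_i p
  induction g using diagram_induction
  case zero => simp
  case add f f' hf hf' => simp [hf, hf']
  case smul c f hf => simp [hf]
  rename_i q
  refine (congrArg omegaHom (single_comp p q)).trans ?_
  refine (omegaHom_single _ _).trans ?_
  rw [omegaHom_single, omegaHom_single, one_smul, one_smul, Linear.smul_comp, Linear.comp_smul]
  refine Eq.trans ?_ (congrArg (fun f => coef p.1 • coef q.1 • f)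
    (sandwich_comp (2 * t) p.2 q.2)).symm
  rw [smul_smul, smul_smul, smul_smul, coef_concat t p.2 q.2]

theorem omegaHom_perm {X : RepZero t} (σ : Equiv.Perm (Fin X.n)) :
    omegaHom (DiagramCat.ofW (wperm σ) : X ⟶ X) =
      (permHom (2 * t) σ ≫ signIdem (2 * t) X.n : colourObj X ⟶ colourObj X) := by
  have : (DiagramCat.ofW (wperm σ) : X ⟶ X) = Finsupp.single
      (⟨permPartition σ, isEven_permPartition σ⟩ : EvenPartition X.n X.n) (1 : ℂ) :=
    (single_eq_eval t _).symm
  rw [this]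
  refine (omegaHom_single _ _).trans ?_
  rw [one_smul, coef_permPartition, one_smul, sandwich_permPartition]

theorem omegaHom_tensor {X Y X' Y' : RepZero t} (f : X ⟶ Y) (g : X' ⟶ Y') :
    omegaHom (f ⊗ₘ g) = omegaHom f ⊗ₘ omegaHom g := by
  induction f using diagram_induction
  case zero =>
    rw [DiagramCat.zero_tensorHom, map_zero, map_zero, DiagramCat.zero_tensorHom]
  case add f f' hf hf' =>
    rw [DiagramCat.add_tensorHom, map_add, map_add, DiagramCat.add_tensorHom, hf, hf']
  case smul c f hf =>
    rw [DiagramCat.smul_tensorHom, map_smul, map_smul, DiagramCat.smul_tensorHom, hf]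
  rename_i p
  induction g using diagram_induction
  case zero =>
    rw [DiagramCat.tensorHom_zero, map_zero, map_zero, DiagramCat.tensorHom_zero]
  case add f f' hf hf' =>
    rw [DiagramCat.tensorHom_add, map_add, map_add, DiagramCat.tensorHom_add, hf, hf']
  case smul c f hf =>
    rw [DiagramCat.tensorHom_smul, map_smul, map_smul, DiagramCat.tensorHom_smul, hf]
  rename_i q
  have h : (show X ⟶ Y from Finsupp.single p (1 : ℂ)) ⊗ₘ
      (show X' ⟶ Y' from Finsupp.single q (1 : ℂ)) =
      (show X ⊗ X' ⟶ Y ⊗ Y' from Finsupp.single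
        (⟨juxtapose p.1 q.1, p.2.juxtapose q.2⟩ : EvenPartition _ _) (1 : ℂ)) := by
    refine (congrArg₂ (fun f g => (show X ⟶ Y from f) ⊗ₘ (show X' ⟶ Y' from g))
      (single_eq_eval t p) (single_eq_eval t q)).trans ?_
    exact (DiagramCat.ofW_tensor (some (0, p)) (some (0, q))).trans (single_eq_eval t _).symm
  refine (congrArg omegaHom h).trans ((omegaHom_single _ _).trans ?_)
  rw [omegaHom_single, omegaHom_single, one_smul, one_smul, one_smul, DiagramCat.smul_tensorHom,
    DiagramCat.tensorHom_smul]
  refine Eq.trans ?_ (congrArg (fun f => coef p.1 • coef q.1 • f)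
    (sandwich_tensor (2 * t) p.1 q.1)).symm
  rw [smul_smul]
  exact congrArg (· • sandwich (2 * t) (juxtapose p.1 q.1)) (coef_juxtapose p.2 q.2)

open Classical in
/-- The even partition underlying a coloured partition, with the product of the labels as a sign;
zero if the underlying partition is not even. -/
noncomputable def evenDiagram {k l : ℕ} (P : ColouredPartition k l) : EvenPartition k l →₀ ℂ :=
  Quotient.lift (fun a : Labelled (Fin k ⊕ Fin l) => if h : IsEven a.1 then
    Finsupp.single ⟨a.1, h⟩ ((coef a.1)⁻¹ * (sgn (a.2 ∘ Sum.inl) * sgn (a.2 ∘ Sum.inr))) else 0)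
    -- Equivalent labellings differ by a `c` constant on blocks. If all blocks are even, the bottom
    -- and top signs of `c` agree and cancel, so the sign depends on the class only.
    (by
      rintro ⟨p, z⟩ ⟨q, w⟩ ⟨h, c, hc, hw⟩
      dsimp only at h hc hw
      subst h hw
      dsimp only
      split_ifs with hp
      · rw [Pi.mul_comp, Pi.mul_comp, sgn_mul, sgn_mul, mul_mul_mul_comm,
          hp.sgn_eq (by rwa [Sum.elim_comp_inl_inr] : ConstOnBlocks p (Sum.elim (c ∘ Sum.inl)
            (c ∘ Sum.inr))), sgn_mul_self, one_mul]
      · rfl) P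

theorem evenDiagram_uncoloured {k l : ℕ} (p : EvenPartition k l) :
    evenDiagram (uncoloured p.1) = Finsupp.single p (coef p.1)⁻¹ := by
  refine (dif_pos p.2).trans ?_
  simp [sgn]

theorem evenDiagram_relabel {k l : ℕ} (z : Fin k → ℤˣ) (w : Fin l → ℤˣ)
    (P : ColouredPartition k l) :
    evenDiagram (relabel (Sum.elim z w) P) = (sgn z * sgn w) • evenDiagram P := by
  classical
  induction P using Quotient.inductionOn with
  | h a =>
    change dite _ _ _ = _ • dite _ _ _
    dsimp only
    split_ifs with h
    · rw [Pi.mul_comp, Pi.mul_comp, sgn_mul, sgn_mul, Sum.elim_comp_inl, Sum.elim_comp_inr,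
        Finsupp.smul_single, smul_eq_mul, mul_mul_mul_comm (sgn z), mul_left_comm]
    · rw [smul_zero]

/-- The inverse of `omegaHom`. -/
noncomputable def evenPart {X Y : RepZero t} : (colourObj X ⟶ colourObj Y) →ₗ[ℂ] (X ⟶ Y) :=
  (Finsupp.linearCombination ℂ (fun P : ColouredPartition X.n Y.n => (evenDiagram P : X ⟶ Y)) :
    (ColouredPartition X.n Y.n →₀ ℂ) →ₗ[ℂ] (X ⟶ Y))

theorem evenPart_ofDiagram {X Y : RepZero t} (P : ColouredPartition X.n Y.n) :
    (evenPart (ofDiagram (2 * t) P) : X ⟶ Y) = evenDiagram P :=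
  (Finsupp.linearCombination_single ℂ 1 P).trans (one_smul _ _)

/-- In the double sum over labels at the bottom and the top, relabelling changes `evenDiagram P` by
the very sign in front. All terms are equal, and their number cancels the two normalising factors.
-/
theorem evenPart_signIdem_signIdem {X Y : RepZero t} (P : ColouredPartition X.n Y.n) :
    (evenPart (signIdem (2 * t) X.n ≫ ofDiagram (2 * t) P ≫ signIdem (2 * t) Y.n) : X ⟶ Y) =
      evenDiagram P := by
  have h : (signIdem (2 * t) X.n ≫ ofDiagram (2 * t) P ≫ signIdem (2 * t) Y.n) =
      (((2 : ℂ) ^ X.n)⁻¹ * ((2 : ℂ) ^ Y.n)⁻¹) • ∑ z : Fin X.n → ℤˣ, ∑ w : Fin Y.n → ℤˣ,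
        (sgn z * sgn w) • ofDiagram (2 * t) (relabel (Sum.elim z w) P) := by
    unfold signIdem
    simp only [Linear.smul_comp, Linear.comp_smul, Preadditive.sum_comp, Preadditive.comp_sum,
      smul_smul, strandHom_diagram_strandHom, Finset.smul_sum]
    rw [Finset.sum_comm]
    refine Finset.sum_congr rfl fun z _ => Finset.sum_congr rfl fun w _ => ?_
    congr 1
    ring
  have e : ∀ (z : Fin X.n → ℤˣ) (w : Fin Y.n → ℤˣ), (evenPart ((sgn z * sgn w) •
      ofDiagram (2 * t) (relabel (Sum.elim z w) P)) : X ⟶ Y) = evenDiagram P := fun z w => by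
    refine (map_smul evenPart _ _).trans ?_
    rw [evenPart_ofDiagram, evenDiagram_relabel]
    refine (smul_smul _ _ _).trans ?_
    rw [mul_mul_mul_comm, sgn_mul_self, sgn_mul_self, one_mul]
    exact one_smul _ _
  rw [h]
  refine (map_smul evenPart _ _).trans ?_
  rw [map_sum]
  simp only [map_sum, e, Finset.sum_const, card_labels, ← Nat.cast_smul_eq_nsmul ℂ, smul_smul]
  have hX : (2 : ℂ) ^ X.n ≠ 0 := pow_ne_zero _ two_ne_zero
  have hY : (2 : ℂ) ^ Y.n ≠ 0 := pow_ne_zero _ two_ne_zero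
  push_cast
  rw [show ((2 : ℂ) ^ X.n)⁻¹ * ((2 : ℂ) ^ Y.n)⁻¹ * (2 ^ X.n * 2 ^ Y.n) = 1 by field_simp]
  exact one_smul _ _

theorem evenPart_omegaHom {X Y : RepZero t} (f : X ⟶ Y) : evenPart (omegaHom f) = f := by
  induction f using diagram_induction
  case zero => rw [map_zero, map_zero]
  case add f f' hf hf' => rw [map_add, map_add, hf, hf']
  case smul c f hf => rw [map_smul, map_smul, hf]
  rename_i p
  rw [omegaHom_single, one_smul, map_smul]
  refine (congrArg (coef p.1 • ·) (evenPart_signIdem_signIdem (uncoloured p.1))).trans ?_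
  rw [evenDiagram_uncoloured]
  refine (Finsupp.smul_single _ _ _).trans ?_
  rw [smul_eq_mul, mul_inv_cancel₀ (coef_ne_zero _)]

/-- Between projectors a coloured diagram is a sign times its underlying partition. This is the
image of its even part if the partition is even; otherwise both sides are zero. So `omegaHom` hits
everything fixed by the projectors. -/
theorem omegaHom_evenPart {X Y : RepZero t} (h : colourObj X ⟶ colourObj Y) :
    omegaHom (evenPart h) =
      (signIdem (2 * t) X.n ≫ h ≫ signIdem (2 * t) Y.n : colourObj X ⟶ colourObj Y) := by
  classical
  induction h using diagram_induction
  case zero => rw [map_zero, map_zero, Limits.zero_comp, Limits.comp_zero]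
  case add f f' hf hf' =>
    rw [map_add, map_add, hf, hf', Preadditive.add_comp, Preadditive.comp_add]
  case smul c f hf => rw [map_smul, map_smul, hf, Linear.smul_comp, Linear.comp_smul]
  rename_i P
  refine (congrArg omegaHom (evenPart_ofDiagram P)).trans ?_
  induction P using Quotient.inductionOn with
  | h a =>
    obtain ⟨p, z⟩ := a
    -- A coloured partition is its underlying partition with strands carrying the labels attached to
    -- both rows, so the absorption of strands applies.
    have h1 : (Quotient.mk _ (p, z) : ColouredPartition X.n Y.n) =
        relabel (Sum.elim (z ∘ Sum.inl) (z ∘ Sum.inr)) (uncoloured p) := by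
      rw [Sum.elim_comp_inl_inr]
      exact congrArg (fun z => Quotient.mk _ (p, z)) (mul_one z).symm
    have h2 := signIdem_strandHom_signIdem (2 * t) (z ∘ Sum.inl) (z ∘ Sum.inr)
      (ofDiagram (2 * t) (uncoloured p))
    rw [strandHom_diagram_strandHom, ← h1] at h2
    refine Eq.trans ?_ h2.symm
    by_cases hp : IsEven p
    · refine (congrArg omegaHom (dif_pos hp)).trans ((omegaHom_single _ _).trans ?_)
      rw [smul_smul, mul_right_comm, inv_mul_cancel₀ (coef_ne_zero _), one_mul]
      rfl
    · refine (congrArg omegaHom (dif_neg hp)).trans ((map_zero _).trans ?_)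
      have := sandwich_eq_zero (2 * t) hp
      rw [sandwich] at this
      rw [this, smul_zero]

end OmegaHom

/-! ### Splitting the identities of `Par(ℤ/2, T)` -/

section Splitting

variable (T : ℂ)

theorem constOnBlocks_top_one_two {i : Fin 1 → ℤˣ} {u : Fin 2 → ℤˣ} :
    ConstOnBlocks (⊤ : Partition 1 2) (Sum.elim i u) ↔ u = fun _ => i 0 := by
  constructor
  · exact fun h => funext fun x => (h (.inl 0) (.inr x) trivial).symm
  · rintro rfl (x | x) (y | y) _ <;> simp [Subsingleton.elim _ (0 : Fin 1)]

theorem constOnBlocks_top_two_one {i : Fin 1 → ℤˣ} {u : Fin 2 → ℤˣ} :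
    ConstOnBlocks (⊤ : Partition 2 1) (Sum.elim u i) ↔ u = fun _ => i 0 := by
  constructor
  · exact fun h => funext fun x => h (.inl x) (.inr 0) trivial
  · rintro rfl (x | x) (y | y) _ <;> simp [Subsingleton.elim _ (0 : Fin 1)]

/-- The lower block forces both middle points to carry the label of the bottom point. The upper
block tolerates `z` only if it changes both labels equally, and the result is a single strand with
that label. -/
theorem wcomp_top_wstrand_top (z : Fin 2 → ℤˣ) :
    wcomp (some (0, uncoloured (⊤ : Partition 1 2)))
      (wcomp (wstrand z) (some (0, uncoloured (⊤ : Partition 2 1)))) =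
      if z 0 = z 1 then wstrand fun _ => z 0 else none := by
  classical
  refine wmat_injective fun i j => ?_
  rw [wmat_wcomp, Finset.sum_eq_single (fun _ => i 0)]
  · rw [wmat_wstrand_wcomp]
    have h0 : ∀ {k l : ℕ} (p : Partition k l) (i : Fin k → ℤˣ) (j : Fin l → ℤˣ),
        wmat (some (0, uncoloured p)) i j = if ConstOnBlocks p (Sum.elim i j) then 1 else 0 :=
      fun p i j => by simp only [wmat, sem_uncoloured, pow_zero]
    rw [h0, h0, if_pos (constOnBlocks_top_one_two.2 rfl), one_mul]
    simp only [constOnBlocks_top_two_one]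
    split_ifs with h1 h2 h2
    · rw [wmat_wstrand, if_pos]
      funext x
      rw [Subsingleton.elim x 0]
      exact (congrFun h1 0).symm
    · refine absurd ?_ h2
      exact mul_right_cancel ((congrFun h1 0).trans (congrFun h1 1).symm)
    · rw [wmat_wstrand, if_neg]
      rintro rfl
      refine h1 (funext fun x => ?_)
      fin_cases x
      · rfl
      · simp [h2]
    · rfl
  · intro u _ hu
    simp only [wmat, sem_uncoloured, constOnBlocks_top_one_two]
    rw [if_neg hu, zero_mul]
  · simp

/-- Twice this is the complement of `e'`, which therefore factors through the sign part of `[2̃]`.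
The parameter does not enter, since no loops arise. -/
theorem top_comp_signIdem_comp_top :
    ofDiagram T (uncoloured (⊤ : Partition 1 2)) ≫ signIdem T 2 ≫
      ofDiagram T (uncoloured (⊤ : Partition 2 1)) =
      (4⁻¹ : ℂ) • (𝟙 _ + ofDiagram T minusStrand) := by
  classical
  have h : ∀ z : Fin 2 → ℤˣ, ofDiagram T (uncoloured (⊤ : Partition 1 2)) ≫ strandHom T z ≫
      ofDiagram T (uncoloured (⊤ : Partition 2 1)) =
      if z 0 = z 1 then strandHom T (fun _ => z 0) else 0 := fun z => by
    rw [ofDiagram_eq, ofDiagram_eq]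
    refine (congrArg _ (DiagramCat.ofW_comp _ _)).trans ((DiagramCat.ofW_comp _ _).trans
      ((congrArg DiagramCat.ofW (wcomp_top_wstrand_top z)).trans ?_))
    split_ifs <;> rfl
  have hm : strandHom T (fun _ : Fin 1 => (-1 : ℤˣ)) = ofDiagram T minusStrand := by
    rw [ofDiagram_eq]
    rfl
  have ho : strandHom T (fun _ : Fin 1 => (1 : ℤˣ)) = 𝟙 _ := strandHom_one T 1
  unfold signIdem
  simp only [Linear.smul_comp, Linear.comp_smul, Preadditive.sum_comp, Preadditive.comp_sum, h]
  -- Of the four labellings of two points only the two constant ones survive, both with sign `+1`;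
  -- the factor `4⁻¹` is the normalisation of the projector.
  rw [Fintype.sum_equiv (finTwoArrowEquiv ℤˣ) _ (fun z => (((z.1 * z.2 : ℤˣ) : ℤ) : ℂ) •
    if z.1 = z.2 then strandHom T (fun _ => z.1) else 0) (fun z => by simp [sgn, finTwoArrowEquiv]),
    Fintype.sum_prod_type]
  have hu : (Finset.univ : Finset ℤˣ) = {1, -1} := by decide
  have hn : (1 : ℤˣ) ≠ -1 := by decide
  rw [hu]
  simp only [Finset.sum_pair hn]
  simp only [if_true, if_neg hn, if_neg hn.symm, ho, hm]
  norm_num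

/-- The identity of `[k̃]` factors through the images of sign idempotents. -/
theorem exists_sum_signIdem_eq_id (k : ℕ) : ∃ (A : Type) (_ : Fintype A) (n : A → ℕ)
    (f : ∀ a, (⟨k⟩ : ParZTwo T) ⟶ ⟨n a⟩) (g : ∀ a, (⟨n a⟩ : ParZTwo T) ⟶ ⟨k⟩),
    ∑ a, f a ≫ signIdem T (n a) ≫ g a = 𝟙 _ := by
  induction k with
  | zero =>
    refine ⟨Unit, inferInstance, fun _ => 0, fun _ => 𝟙 _, fun _ => 𝟙 _, ?_⟩
    simp [signIdem_zero]
  | succ k ih =>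
    obtain ⟨A, hA, n, f, g, h⟩ := ih
    -- The case of one point: the identity is the sign part plus its complement, and the complement
    -- goes through two points.
    have h1 : signIdem T 1 + (2 : ℂ) • (ofDiagram T (uncoloured (⊤ : Partition 1 2)) ≫
        signIdem T 2 ≫ ofDiagram T (uncoloured (⊤ : Partition 2 1))) =
        𝟙 (⟨1⟩ : ParZTwo T) := by
      rw [top_comp_signIdem_comp_top, signIdem_one, ePrime]
      module
    -- Tensoring the decomposition of `[k̃]` with that of `[1̃]` splits each summand in two, with
    -- one or two further points. The scalar 2 is put into the second map.
    refine ⟨A ⊕ A, inferInstance, Sum.elim (fun a => n a + 1) (fun a => n a + 2),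
      fun a => Sum.rec (fun a => f a ⊗ₘ 𝟙 (⟨1⟩ : ParZTwo T))
        (fun a => f a ⊗ₘ ofDiagram T (uncoloured (⊤ : Partition 1 2))) a,
      fun a => Sum.rec (fun a => g a ⊗ₘ 𝟙 (⟨1⟩ : ParZTwo T))
        (fun a => (2 : ℂ) • (g a ⊗ₘ ofDiagram T (uncoloured (⊤ : Partition 2 1)))) a, ?_⟩
    rw [Fintype.sum_sum_type]
    have e1 : ∀ a, (f a ⊗ₘ 𝟙 (⟨1⟩ : ParZTwo T)) ≫ signIdem T (n a + 1) ≫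
        (g a ⊗ₘ 𝟙 (⟨1⟩ : ParZTwo T)) = (f a ≫ signIdem T (n a) ≫ g a) ⊗ₘ signIdem T 1 := fun a => by
      rw [← signIdem_tensor]
      refine (congrArg _ (tensorHom_comp_tensorHom _ _ _ _)).trans
        ((tensorHom_comp_tensorHom _ _ _ _).trans ?_)
      rw [Category.comp_id, Category.id_comp]
    have e2 : ∀ a, (f a ⊗ₘ ofDiagram T (uncoloured (⊤ : Partition 1 2))) ≫ signIdem T (n a + 2) ≫
        ((2 : ℂ) • (g a ⊗ₘ ofDiagram T (uncoloured (⊤ : Partition 2 1)))) =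
        (f a ≫ signIdem T (n a) ≫ g a) ⊗ₘ ((2 : ℂ) • (ofDiagram T (uncoloured (⊤ : Partition 1 2)) ≫
          signIdem T 2 ≫ ofDiagram T (uncoloured (⊤ : Partition 2 1)))) := fun a => by
      rw [← signIdem_tensor, DiagramCat.tensorHom_smul, ← tensorHom_comp_tensorHom,
        ← tensorHom_comp_tensorHom]
      refine (congrArg _ (Linear.comp_smul _ _ _ _ _ _)).trans ?_
      exact Linear.comp_smul _ _ _ _ _ _
    refine (congrArg₂ (· + ·) (Finset.sum_congr rfl fun a _ => e1 a)
      (Finset.sum_congr rfl fun a _ => e2 a)).trans ?_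
    rw [← sum_tensor, ← sum_tensor, h, ← DiagramCat.tensorHom_add, h1]
    exact id_tensorHom_id _ _

end Splitting

/-! ### The functor on the Karoubian envelopes -/

section StdOmega

variable {t : ℂ}

/-- The formal direct sum of the objects `[k̃ᵢ]` for the formal direct sum of the `[kᵢ]`. -/
abbrev colourMat (M : Mat_ (RepZero t)) : Mat_ (ParZTwo (2 * t)) :=
  ⟨M.ι, fun i => colourObj (M.X i)⟩

/-- The map `omegaHom` on all entries of a matrix. -/
noncomputable def omegaMat {M N : Mat_ (RepZero t)} (f : M ⟶ N) : colourMat M ⟶ colourMat N :=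
  fun i j => omegaHom (f i j)

/-- The map `evenPart` on all entries of a matrix. -/
noncomputable def evenMat {M N : Mat_ (RepZero t)} (f : colourMat M ⟶ colourMat N) : M ⟶ N :=
  fun i j => evenPart (f i j)

theorem omegaMat_apply {M N : Mat_ (RepZero t)} (f : M ⟶ N) (i : M.ι) (j : N.ι) :
    omegaMat f i j = omegaHom (f i j) := rfl

theorem omegaMat_comp {M N K : Mat_ (RepZero t)} (f : M ⟶ N) (g : N ⟶ K) :
    omegaMat (f ≫ g) = omegaMat f ≫ omegaMat g := by
  ext i k
  rw [omegaMat_apply, Mat_.comp_apply, Mat_.comp_apply, map_sum]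
  exact Finset.sum_congr rfl fun j _ => omegaHom_comp _ _

theorem omegaMat_add {M N : Mat_ (RepZero t)} (f g : M ⟶ N) :
    omegaMat (f + g) = omegaMat f + omegaMat g := by
  ext i j
  exact map_add omegaHom (f i j) (g i j)

theorem omegaMat_smul {M N : Mat_ (RepZero t)} (c : ℂ) (f : M ⟶ N) :
    omegaMat (c • f) = c • omegaMat f := by
  ext i j
  exact map_smul omegaHom c (f i j)

theorem omegaMat_diag {M N : Mat_ (RepZero t)} (e : M.ι ≃ N.ι) (φ : ∀ i, M.X i ⟶ N.X (e i)) :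
    omegaMat (AdditiveEnvelope.diag e φ) = AdditiveEnvelope.diag (M := colourMat M)
      (N := colourMat N) e (fun i => omegaHom (φ i)) := by
  ext i j
  rw [omegaMat_apply]
  by_cases h : e i = j
  · subst h
    rw [AdditiveEnvelope.diag_apply_self]
    exact (AdditiveEnvelope.diag_apply_self (M := colourMat M) (N := colourMat N) e
      (fun i => omegaHom (φ i)) i).symm
  · rw [AdditiveEnvelope.diag_apply_ne _ _ h, map_zero]
    exact (AdditiveEnvelope.diag_apply_ne (M := colourMat M) (N := colourMat N) e _ h).symm

/-- Identities go to projectors, so `omegaHom` is not a functor into `Par(ℤ/2, 2t)` itself; it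
becomes one after idempotent completion. -/
theorem omegaHom_id (X : RepZero t) :
    omegaHom (𝟙 X) = (signIdem (2 * t) X.n : colourObj X ⟶ colourObj X) :=
  (omegaHom_perm (X := X) (Equiv.refl _)).trans (Category.id_comp _)

theorem omegaMat_id (M : Mat_ (RepZero t)) : omegaMat (𝟙 M) =
    AdditiveEnvelope.diag (M := colourMat M) (N := colourMat M) (Equiv.refl M.ι)
      (fun i => signIdem (2 * t) (M.X i).n) := by
  rw [AdditiveEnvelope.id_eq_diag]
  refine (omegaMat_diag (Equiv.refl M.ι) (fun i => 𝟙 (M.X i))).trans ?_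
  exact congrArg _ (funext fun i => omegaHom_id (M.X i))

theorem omegaMat_evenMat {M N : Mat_ (RepZero t)} (h : colourMat M ⟶ colourMat N) :
    omegaMat (evenMat h) = omegaMat (𝟙 M) ≫ h ≫ omegaMat (𝟙 N) := by
  ext i j
  rw [omegaMat_id, omegaMat_id]
  refine (omegaHom_evenPart _).trans (Eq.trans (congrArg _ ?_)
    (AdditiveEnvelope.diag_comp_apply (M := colourMat M) (N := colourMat M) (Equiv.refl M.ι)
      (fun i => signIdem (2 * t) (M.X i).n) _ i j).symm)
  exact (AdditiveEnvelope.comp_diag_apply (M := colourMat N) (N := colourMat N) (Equiv.refl N.ι)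
    (fun i => signIdem (2 * t) (N.X i).n) h i j).symm

theorem evenMat_omegaMat {M N : Mat_ (RepZero t)} (f : M ⟶ N) : evenMat (omegaMat f) = f := by
  ext i j
  exact evenPart_omegaHom (f i j)

theorem omegaMat_injective {M N : Mat_ (RepZero t)} {f g : M ⟶ N} (h : omegaMat f = omegaMat g) :
    f = g := by
  rw [← evenMat_omegaMat f, h, evenMat_omegaMat]

/-- The functor with `(M, p) ↦ (M̃, Ω₀(p))`. -/
noncomputable def stdOmega (t : ℂ) : RepH t ⥤ ParKar (2 * t) where
  obj P := ⟨colourMat P.X, omegaMat P.p, by rw [← omegaMat_comp, P.idem]⟩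
  map {P Q} f := ⟨omegaMat f.f, by
    change omegaMat P.p ≫ omegaMat f.f ≫ omegaMat Q.p = _
    rw [← omegaMat_comp, ← omegaMat_comp, f.comm]⟩
  map_comp f g := Karoubi.hom_ext _ _ (omegaMat_comp f.f g.f)

instance : (stdOmega t).Additive where
  map_add {_ _ f g} := Karoubi.hom_ext _ _ (omegaMat_add f.f g.f)

instance : (stdOmega t).Linear ℂ where
  map_smul f c := Karoubi.hom_ext _ _ (omegaMat_smul c f.f)

instance : (stdOmega t).Faithful where
  map_injective h := Karoubi.hom_ext _ _ (omegaMat_injective (congrArg Karoubi.Hom.f h))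

/-- A morphism between the images of `Ω₀(P.p)` and `Ω₀(Q.p)` is fixed by the larger projectors
`Ω₀(𝟙)`, so it lies in the range of `omegaMat`. -/
theorem omegaMat_evenMat_of_comm {P Q : RepH t} {h : colourMat P.X ⟶ colourMat Q.X}
    (hc : omegaMat P.p ≫ h ≫ omegaMat Q.p = h) : omegaMat (evenMat h) = h := by
  rw [omegaMat_evenMat, ← hc]
  simp only [Category.assoc]
  rw [← omegaMat_comp, Category.comp_id, ← Category.assoc (omegaMat (𝟙 _)), ← omegaMat_comp,
    Category.id_comp]

/-- The preimage is the entrywise even part. That it is compatible with the idempotents is checked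
after applying the injective `omegaMat`. -/
instance : (stdOmega t).Full where
  map_surjective {P Q} h := by
    have h1 := omegaMat_evenMat_of_comm (P := P) (Q := Q) h.comm
    refine ⟨⟨evenMat h.f, omegaMat_injective ?_⟩, Karoubi.hom_ext _ _ h1⟩
    rw [omegaMat_comp, omegaMat_comp]
    exact (congrArg (fun u => omegaMat P.p ≫ u ≫ omegaMat Q.p) h1).trans (h.comm.trans h1.symm)

/-- Decompose the identity of each summand separately. The new index set consists of pairs (summand,
term of its decomposition), and `F` and `G` are block diagonal. -/
theorem exists_omegaMat_id_eq_id (M : Mat_ (ParZTwo (2 * t))) :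
    ∃ (N : Mat_ (RepZero t)) (f : M ⟶ colourMat N) (g : colourMat N ⟶ M),
      f ≫ omegaMat (𝟙 N) ≫ g = 𝟙 M := by
  classical
  choose A hA n f g h using fun i : M.ι => exists_sum_signIdem_eq_id (2 * t) (M.X i).n
  let N : Mat_ (RepZero t) := ⟨Σ i, A i, fun b => ⟨n b.1 b.2⟩⟩
  let F : M ⟶ colourMat N := fun i b =>
    if h : i = b.1 then eqToHom (congrArg M.X h) ≫ f b.1 b.2 else 0
  let G : colourMat N ⟶ M := fun b i =>
    if h : b.1 = i then g b.1 b.2 ≫ eqToHom (congrArg M.X h) else 0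
  have hF : ∀ (i : M.ι) (a : A i), F i ⟨i, a⟩ = f i a := fun i a =>
    (dif_pos rfl).trans (Category.id_comp _)
  have hF' : ∀ (i j : M.ι) (a : A j), i ≠ j → F i ⟨j, a⟩ = 0 := fun i j a h => dif_neg h
  have hG : ∀ (i : M.ι) (a : A i), G ⟨i, a⟩ i = g i a := fun i a =>
    (dif_pos rfl).trans (Category.comp_id _)
  have hG' : ∀ (i j : M.ι) (a : A i), i ≠ j → G ⟨i, a⟩ j = 0 := fun i j a h => dif_neg h
  refine ⟨N, F, G, ?_⟩
  ext i j
  have hsum : (F ≫ omegaMat (𝟙 N) ≫ G) i j = ∑ i' : M.ι, ∑ a : A i',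
      F i ⟨i', a⟩ ≫ signIdem (2 * t) (n i' a) ≫ G ⟨i', a⟩ j := by
    rw [omegaMat_id, Mat_.comp_apply]
    refine (Fintype.sum_sigma _).trans ?_
    refine Finset.sum_congr rfl fun i' _ => Finset.sum_congr rfl fun a _ => congrArg _ ?_
    exact AdditiveEnvelope.diag_comp_apply (M := colourMat N) (N := colourMat N) _ _ _ _ _
  rw [hsum, Finset.sum_eq_single i]
  · by_cases hij : i = j
    · subst hij
      rw [Mat_.id_apply_self]
      simp only [hF, hG]
      exact h i
    · rw [Mat_.id_apply_of_ne M i j hij]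
      refine Finset.sum_eq_zero fun a _ => ?_
      rw [hG' i j a hij, Limits.comp_zero, Limits.comp_zero]
  · intro b _ hb
    refine Finset.sum_eq_zero fun a _ => ?_
    rw [hF' i b a hb.symm, Limits.zero_comp]
  · simp

/-- The underlying object is a retract of the sign part of some `colourMat N`. Transporting the
idempotent `P.p` along this retraction gives an idempotent between sign projectors, and these come
from `N` by fullness on matrices. -/
instance : (stdOmega t).EssSurj where
  mem_essImage P := by
    obtain ⟨N, f, g, h⟩ := exists_omegaMat_id_eq_id P.X
    have hfg : ∀ {K : Mat_ (ParZTwo (2 * t))} (u : P.X ⟶ K),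
        f ≫ omegaMat (𝟙 N) ≫ g ≫ u = u := fun u => by
      have := congrArg (· ≫ u) h
      simpa only [Category.assoc, Category.id_comp] using this
    have hS : ∀ {K : Mat_ (ParZTwo (2 * t))} (u : colourMat N ⟶ K),
        omegaMat (𝟙 N) ≫ omegaMat (𝟙 N) ≫ u = omegaMat (𝟙 N) ≫ u := fun u => by
      rw [← Category.assoc, ← omegaMat_comp, Category.comp_id]
    -- The transported idempotent; its idempotency, like the mutual inverses below, follows from
    -- cancelling `f ≫ omegaMat (𝟙 N) ≫ g`.
    let q : N ⟶ N := evenMat (g ≫ P.p ≫ f)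
    have hq : omegaMat q = omegaMat (𝟙 N) ≫ g ≫ P.p ≫ f ≫ omegaMat (𝟙 N) := by
      rw [omegaMat_evenMat]
      simp only [Category.assoc]
    have hqq : q ≫ q = q := omegaMat_injective (by
      rw [omegaMat_comp, hq]
      simp only [Category.assoc, hS, hfg, Karoubi.idem_assoc])
    have h1 : omegaMat q ≫ (omegaMat (𝟙 N) ≫ g ≫ P.p) ≫ P.p = omegaMat (𝟙 N) ≫ g ≫ P.p := by
      rw [hq]
      simp only [Category.assoc, hS, hfg, Karoubi.idem]
    have h2 : P.p ≫ (P.p ≫ f ≫ omegaMat (𝟙 N)) ≫ omegaMat q = P.p ≫ f ≫ omegaMat (𝟙 N) := by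
      rw [hq]
      simp only [Category.assoc, hS, hfg, Karoubi.idem_assoc]
    have h3 : (omegaMat (𝟙 N) ≫ g ≫ P.p) ≫ P.p ≫ f ≫ omegaMat (𝟙 N) = omegaMat q := by
      rw [hq]
      simp only [Category.assoc, Karoubi.idem_assoc]
    have h4 : (P.p ≫ f ≫ omegaMat (𝟙 N)) ≫ omegaMat (𝟙 N) ≫ g ≫ P.p = P.p := by
      simp only [Category.assoc, hS, hfg, Karoubi.idem]
    exact ⟨⟨N, q, hqq⟩, ⟨⟨⟨_, h1⟩, ⟨_, h2⟩, Karoubi.hom_ext _ _ h3, Karoubi.hom_ext _ _ h4⟩⟩⟩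

end StdOmega

/-! ### The symmetric monoidal structure -/

section Monoidal

open IdempotentCompletion

variable {t : ℂ}

/-- The matrix of the tensor product is indexed by pairs on both sides, so this is `omegaHom_tensor`
entry by entry. -/
theorem omegaMat_tensor {M N M' N' : Mat_ (RepZero t)} (f : M ⟶ N) (g : M' ⟶ N') :
    omegaMat (f ⊗ₘ g) = (omegaMat f ⊗ₘ omegaMat g :
      colourMat M ⊗ colourMat M' ⟶ colourMat N ⊗ colourMat N') := by
  ext i j
  exact omegaHom_tensor (f i.1 j.1) (g i.2 j.2)

theorem signIdem_permHom_of_equiv (T : ℂ) {k l : ℕ} (σ : Fin k ≃ Fin l) :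
    signIdem T k ≫ permHom T σ = permHom T σ ≫ signIdem T l := by
  obtain rfl : k = l := by simpa using Fintype.card_congr σ
  exact signIdem_permHom T σ

theorem omegaHom_perm_of_equiv {X Y : RepZero t} (σ : Fin X.n ≃ Fin Y.n) :
    omegaHom (DiagramCat.ofW (wperm σ) : X ⟶ Y) =
      (permHom (2 * t) σ ≫ signIdem (2 * t) Y.n : colourObj X ⟶ colourObj Y) := by
  obtain ⟨k⟩ := X
  obtain ⟨l⟩ := Y
  obtain rfl : k = l := by simpa using Fintype.card_congr σ
  exact omegaHom_perm σ

/-- A matrix of permutations goes to the same permutations up to a sign projector. Since the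
projectors commute with permutations, the projector may stand on either side, and both forms are
needed for compatibility with idempotents. -/
theorem omegaMat_diag_perm {M N : Mat_ (RepZero t)} (e : M.ι ≃ N.ι)
    (σ : ∀ i, Fin (M.X i).n ≃ Fin (N.X (e i)).n) :
    omegaMat (AdditiveEnvelope.diag e (fun i => DiagramCat.ofW (wperm (σ i)))) =
      AdditiveEnvelope.diag (M := colourMat M) (N := colourMat N) e
        (fun i => permHom (2 * t) (σ i)) ≫ omegaMat (𝟙 N) := by
  rw [omegaMat_diag, omegaMat_id]
  refine Eq.trans ?_ (AdditiveEnvelope.diag_comp_diag (M := colourMat M) (N := colourMat N)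
    (K := colourMat N) _ _ _ _).symm
  exact congrArg _ (funext fun i => omegaHom_perm_of_equiv (σ i))

theorem omegaMat_diag_perm_left {M N : Mat_ (RepZero t)} (e : M.ι ≃ N.ι)
    (σ : ∀ i, Fin (M.X i).n ≃ Fin (N.X (e i)).n) :
    omegaMat (AdditiveEnvelope.diag e (fun i => DiagramCat.ofW (wperm (σ i)))) =
      omegaMat (𝟙 M) ≫ AdditiveEnvelope.diag (M := colourMat M) (N := colourMat N) e
        (fun i => permHom (2 * t) (σ i)) := by
  rw [omegaMat_diag, omegaMat_id]
  refine Eq.trans ?_ (AdditiveEnvelope.diag_comp_diag (M := colourMat M) (N := colourMat M)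
    (K := colourMat N) _ _ _ _).symm
  exact congrArg _ (funext fun i => (omegaHom_perm_of_equiv (σ i)).trans
    (signIdem_permHom_of_equiv (2 * t) (σ i)).symm)

/-- A morphism given by permutations is mapped to the morphism given by the same permutations. -/
theorem isGivenBy_stdOmega_map {P Q : RepH t} {f : P ⟶ Q} (e : P.X.ι ≃ Q.X.ι)
    (σ : ∀ i, Fin (P.X.X i).n ≃ Fin (Q.X.X (e i)).n)
    (h : IsGivenBy f (AdditiveEnvelope.diag e (fun i => DiagramCat.ofW (wperm (σ i))))) :
    IsGivenBy ((stdOmega t).map f) (AdditiveEnvelope.diag (M := colourMat P.X) (N := colourMat Q.X)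
      e (fun i => permHom (2 * t) (σ i))) := by
  set φ := AdditiveEnvelope.diag (M := colourMat P.X) (N := colourMat Q.X)
      e (fun i => permHom (2 * t) (σ i)) with hφ
  have h1 : omegaMat (P.p ≫ AdditiveEnvelope.diag e (fun i => DiagramCat.ofW (wperm (σ i)))) =
      omegaMat P.p ≫ φ := by
    rw [omegaMat_comp, omegaMat_diag_perm_left, ← Category.assoc, ← omegaMat_comp, Category.comp_id]
  have h2 : omegaMat (AdditiveEnvelope.diag e (fun i => DiagramCat.ofW (wperm (σ i))) ≫ Q.p) =
      φ ≫ omegaMat Q.p := by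
    rw [omegaMat_comp, omegaMat_diag_perm, Category.assoc, ← omegaMat_comp, Category.id_comp]
  exact ⟨h1.symm.trans ((congrArg omegaMat h.1).trans h2), (congrArg omegaMat h.2).trans h1⟩

/-- Two equal idempotents of an object define isomorphic objects. -/
def isoOfEq {C : Type*} [Category C] {X : C} {p q : X ⟶ X} (hp : p ≫ p = p) (hq : q ≫ q = q)
    (h : p = q) : (⟨X, p, hp⟩ : Karoubi C) ≅ ⟨X, q, hq⟩ :=
  isoOfComm (Iso.refl X) ((Category.comp_id p).trans (h.trans (Category.id_comp q).symm))

theorem isGivenBy_isoOfEq {C : Type*} [Category C] {X : C} {p q : X ⟶ X} (hp : p ≫ p = p)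
    (hq : q ≫ q = q) (h : p = q) : IsGivenBy (isoOfEq hp hq h).hom (𝟙 X) :=
  isGivenBy_isoOfComm _ _

/-- The functor `stdOmega` preserves tensor products. -/
noncomputable def stdOmegaTensor (P Q : RepH t) :
    (stdOmega t).obj P ⊗ (stdOmega t).obj Q ≅ (stdOmega t).obj (P ⊗ Q) :=
  isoOfEq (((stdOmega t).obj P ⊗ (stdOmega t).obj Q).idem) ((stdOmega t).obj (P ⊗ Q)).idem
    (omegaMat_tensor P.p Q.p).symm

theorem isGivenBy_stdOmegaTensor (P Q : RepH t) :
    IsGivenBy (stdOmegaTensor P Q).hom (𝟙 (colourMat P.X ⊗ colourMat Q.X)) :=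
  isGivenBy_isoOfEq _ _ _

/-- The functor `stdOmega` preserves the unit object. -/
noncomputable def stdOmegaUnit : 𝟙_ (ParKar (2 * t)) ≅ (stdOmega t).obj (𝟙_ (RepH t)) :=
  isoOfEq (𝟙_ (ParKar (2 * t))).idem ((stdOmega t).obj (𝟙_ (RepH t))).idem (by
    change 𝟙 (𝟙_ (Mat_ (ParZTwo (2 * t)))) = omegaMat (𝟙 (𝟙_ (Mat_ (RepZero t))))
    rw [omegaMat_id, AdditiveEnvelope.id_eq_diag]
    exact congrArg _ (funext fun i => (signIdem_zero (2 * t)).symm))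

theorem isGivenBy_stdOmegaUnit :
    IsGivenBy (stdOmegaUnit (t := t)).hom (𝟙 (𝟙_ (Mat_ (ParZTwo (2 * t))))) :=
  isGivenBy_isoOfEq _ _ _

/-- Associators, unitors and symmetries of the envelope are all induced by diagonal matrices of
permutation diagrams, so the functor carries them to their counterparts on the coloured side. -/
theorem isGivenBy_map_associator (P Q R : RepH t) : IsGivenBy ((stdOmega t).map (α_ P Q R).hom)
    (α_ (colourMat P.X) (colourMat Q.X) (colourMat R.X)).hom :=
  isGivenBy_stdOmega_map _ _ (isGivenBy_associator P Q R)

theorem isGivenBy_map_leftUnitor (P : RepH t) : IsGivenBy ((stdOmega t).map (λ_ P).hom)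
    (λ_ (colourMat P.X)).hom :=
  isGivenBy_stdOmega_map _ _ (isGivenBy_leftUnitor P)

theorem isGivenBy_map_rightUnitor (P : RepH t) : IsGivenBy ((stdOmega t).map (ρ_ P).hom)
    (ρ_ (colourMat P.X)).hom :=
  isGivenBy_stdOmega_map _ _ (isGivenBy_rightUnitor P)

theorem isGivenBy_map_braiding (P Q : RepH t) : IsGivenBy ((stdOmega t).map (β_ P Q).hom)
    (β_ (colourMat P.X) (colourMat Q.X)).hom :=
  isGivenBy_stdOmega_map _ _ (isGivenBy_swap P Q)

theorem id_tensor_id_comp {C : Type*} [Category C] [MonoidalCategory C] {X Y Z : C}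
    (f : X ⊗ Y ⟶ Z) : (𝟙 X ⊗ₘ 𝟙 Y) ≫ 𝟙 (X ⊗ Y) ≫ f = f := by
  rw [id_tensorHom_id, Category.id_comp, Category.id_comp]

theorem comp_id_tensor_id {C : Type*} [Category C] [MonoidalCategory C] {X Y Z : C}
    (f : Z ⟶ X ⊗ Y) : f ≫ (𝟙 X ⊗ₘ 𝟙 Y) ≫ 𝟙 (X ⊗ Y) = f := by
  rw [id_tensorHom_id, Category.comp_id, Category.comp_id]

/-- The functor `stdOmega` is strong monoidal. -/
noncomputable def stdOmegaCore (t : ℂ) : (stdOmega t).CoreMonoidal where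
  εIso := stdOmegaUnit
  μIso := stdOmegaTensor
  μIso_hom_natural_left {P P'} f Q :=
    (isGivenBy_stdOmegaTensor P Q).natural (isGivenBy_stdOmegaTensor P' Q)
      ((Category.comp_id _).trans ((omegaMat_tensor f.f Q.p).symm.trans (Category.id_comp _).symm))
  μIso_hom_natural_right {P P'} Q f :=
    (isGivenBy_stdOmegaTensor Q P).natural (isGivenBy_stdOmegaTensor Q P')
      ((Category.comp_id _).trans ((omegaMat_tensor Q.p f.f).symm.trans (Category.id_comp _).symm))
  associativity P Q R :=
    -- The tensor constraints are given by identities, so both sides are given by the associator of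
    -- the underlying formal sums; the unit and symmetry conditions reduce in the same way.
    IsGivenBy.ext (((isGivenBy_stdOmegaTensor P Q).tensor (isGivenBy_id _)).comp
        ((isGivenBy_stdOmegaTensor (P ⊗ Q) R).comp (isGivenBy_map_associator P Q R)))
      ((isGivenBy_associator _ _ _).comp (((isGivenBy_id _).tensor
        (isGivenBy_stdOmegaTensor Q R)).comp (isGivenBy_stdOmegaTensor P (Q ⊗ R))))
      ((id_tensor_id_comp _).trans (comp_id_tensor_id _).symm)
  left_unitality P :=
    IsGivenBy.ext (isGivenBy_leftUnitor _)
      ((isGivenBy_stdOmegaUnit.tensor (isGivenBy_id _)).comp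
        ((isGivenBy_stdOmegaTensor (𝟙_ _) P).comp (isGivenBy_map_leftUnitor P)))
      (id_tensor_id_comp _).symm
  right_unitality P :=
    IsGivenBy.ext (isGivenBy_rightUnitor _)
      (((isGivenBy_id _).tensor isGivenBy_stdOmegaUnit).comp
        ((isGivenBy_stdOmegaTensor P (𝟙_ _)).comp (isGivenBy_map_rightUnitor P)))
      (id_tensor_id_comp _).symm

noncomputable instance : (stdOmega t).Braided where
  toMonoidal := (stdOmegaCore t).toMonoidal
  braided P Q :=
    IsGivenBy.ext ((isGivenBy_stdOmegaTensor P Q).comp (isGivenBy_map_braiding P Q))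
      ((isGivenBy_swap _ _).comp (isGivenBy_stdOmegaTensor Q P))
      ((Category.id_comp _).trans (Category.comp_id _).symm)

end Monoidal

/-! ### Additive functors on the Karoubian envelope -/

section Uniqueness

universe v u v' u'

variable {C : Type u} [Category.{v} C] [Preadditive C] {D : Type u'} [Category.{v'} D]
  [Preadditive D]

/-- The inclusion of a summand of a formal direct sum. -/
noncomputable def matι (M : Mat_ C) (i : M.ι) : (Mat_.embedding C).obj (M.X i) ⟶ M :=
  fun _ j => (𝟙 M : M ⟶ M) i j

/-- The projection to a summand of a formal direct sum. -/
noncomputable def matπ (M : Mat_ C) (i : M.ι) : M ⟶ (Mat_.embedding C).obj (M.X i) :=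
  fun j _ => (𝟙 M : M ⟶ M) j i

/-- The corners of a matrix are its entries. Hence naturality on the original category controls
every matrix. -/
theorem matι_comp_matπ {M N : Mat_ C} (f : M ⟶ N) (i : M.ι) (j : N.ι) :
    matι M i ≫ f ≫ matπ N j = (Mat_.embedding C).map (f i j) := by
  ext a b
  have : (matι M i ≫ f ≫ matπ N j) a b = (𝟙 M ≫ f ≫ 𝟙 N : M ⟶ N) i j := rfl
  rw [this, Category.id_comp, Category.comp_id]
  rfl

theorem sum_matπ_comp_matι (M : Mat_ C) : ∑ i, matπ M i ≫ matι M i = 𝟙 M := by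
  ext j k
  let ev : (M ⟶ M) →+ (M.X j ⟶ M.X k) := ⟨⟨fun f => f j k, rfl⟩, fun _ _ => rfl⟩
  refine (map_sum ev _ _).trans (Eq.trans ?_ (congrArg ev (Category.comp_id (𝟙 M))))
  refine Eq.trans (Finset.sum_congr rfl fun i _ => ?_) (Mat_.comp_apply _ _ _ _).symm
  exact Fintype.sum_unique (fun _ : PUnit => (𝟙 M : M ⟶ M) j i ≫ (𝟙 M : M ⟶ M) i k)

variable (F G H : Mat_ C ⥤ D)

/-- A natural transformation between additive functors on the additive envelope is determined by
its restriction to the original category. -/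
noncomputable def extendToMat [F.Additive] [G.Additive]
    (α : Mat_.embedding C ⋙ F ⟶ Mat_.embedding C ⋙ G) : F ⟶ G where
  app M := ∑ i, F.map (matπ M i) ≫ α.app (M.X i) ≫ G.map (matι M i)
  naturality M N f := by
    -- Naturality holds for every entry of `f`; both sides are then decomposed along the summands
    -- and compared term by term.
    have key : ∀ i j, F.map (matι M i ≫ f ≫ matπ N j) ≫ α.app (N.X j) =
        α.app (M.X i) ≫ G.map (matι M i ≫ f ≫ matπ N j) := fun i j => by
      rw [matι_comp_matπ]
      exact α.naturality (f i j)
    have h1 : F.map f = ∑ i, F.map (matπ M i) ≫ F.map (matι M i ≫ f) := by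
      simp only [← F.map_comp, ← F.map_sum, ← Category.assoc, ← Preadditive.sum_comp,
        sum_matπ_comp_matι, Category.id_comp]
    have h2 : G.map f = ∑ j, G.map (f ≫ matπ N j) ≫ G.map (matι N j) := by
      simp only [← G.map_comp, ← G.map_sum, Category.assoc, ← Preadditive.comp_sum,
        sum_matπ_comp_matι, Category.comp_id]
    rw [h1, h2]
    simp only [Preadditive.sum_comp, Preadditive.comp_sum]
    refine Finset.sum_congr rfl fun j _ => Finset.sum_congr rfl fun i _ => ?_
    have := key i j
    simp only [Functor.map_comp, Category.assoc] at this ⊢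
    rw [reassoc_of% this]

theorem extendToMat_app_embedding [F.Additive] [G.Additive]
    (α : Mat_.embedding C ⋙ F ⟶ Mat_.embedding C ⋙ G) (X : C) :
    (extendToMat F G α).app ((Mat_.embedding C).obj X) = α.app X := by
  have h1 : matπ ((Mat_.embedding C).obj X) PUnit.unit = 𝟙 _ := by ext ⟨⟩ ⟨⟩; rfl
  have h2 : matι ((Mat_.embedding C).obj X) PUnit.unit = 𝟙 _ := by ext ⟨⟩ ⟨⟩; rfl
  refine (Fintype.sum_unique (fun i : PUnit => F.map (matπ ((Mat_.embedding C).obj X) i) ≫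
    α.app X ≫ G.map (matι ((Mat_.embedding C).obj X) i))).trans ?_
  refine (congrArg₂ (fun f g => F.map f ≫ α.app X ≫ G.map g) h1 h2).trans ?_
  exact (congrArg₂ (fun f g => f ≫ α.app X ≫ g) (F.map_id _) (G.map_id _)).trans
    ((Category.id_comp _).trans (Category.comp_id _))

/-- Naturality of the second extension moves it to single summands, where it agrees with `β`. -/
theorem extendToMat_comp [F.Additive] [G.Additive] [H.Additive]
    (α : Mat_.embedding C ⋙ F ⟶ Mat_.embedding C ⋙ G)
    (β : Mat_.embedding C ⋙ G ⟶ Mat_.embedding C ⋙ H) :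
    extendToMat F G α ≫ extendToMat G H β = extendToMat F H (α ≫ β) := by
  ext M
  rw [NatTrans.comp_app]
  refine (Preadditive.sum_comp _ _ _).trans (Finset.sum_congr rfl fun i _ => ?_)
  rw [Category.assoc, Category.assoc, (extendToMat G H β).naturality, extendToMat_app_embedding,
    NatTrans.comp_app, Category.assoc]

theorem extendToMat_id [F.Additive] : extendToMat F F (𝟙 _) = 𝟙 F := by
  ext M
  refine Eq.trans (Finset.sum_congr rfl fun i _ => ?_) ((F.map_sum _ _).symm.trans
    ((congrArg F.map (sum_matπ_comp_matι M)).trans (F.map_id M)))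
  rw [F.map_comp]
  exact congrArg _ (Category.id_comp _)

/-- Additive functors on the additive envelope are isomorphic if their restrictions to the original
category are. -/
noncomputable def extendIsoToMat [F.Additive] [G.Additive]
    (α : Mat_.embedding C ⋙ F ≅ Mat_.embedding C ⋙ G) : F ≅ G where
  hom := extendToMat F G α.hom
  inv := extendToMat G F α.inv
  hom_inv_id := by rw [extendToMat_comp, α.hom_inv_id, extendToMat_id]
  inv_hom_id := by rw [extendToMat_comp, α.inv_hom_id, extendToMat_id]

/-- Additive functors on the Karoubian envelope are isomorphic if their restrictions to the original
category are. -/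
noncomputable def extendIsoToKaroubi (F G : Karoubi (Mat_ C) ⥤ D) [F.Additive] [G.Additive]
    (α : (Mat_.embedding C ⋙ toKaroubi (Mat_ C)) ⋙ F ≅
      (Mat_.embedding C ⋙ toKaroubi (Mat_ C)) ⋙ G) : F ≅ G :=
  -- Restriction along the embedding into the idempotent completion is fully faithful on functors,
  -- so only the additive envelope requires the sums over summands.
  whiskeringLeftObjToKaroubiFullyFaithful.preimageIso
    (extendIsoToMat (toKaroubi (Mat_ C) ⋙ F) (toKaroubi (Mat_ C) ⋙ G) α)

end Uniqueness

/-! ### The standard functor extends `Ω₀`, and so does any other only up to isomorphism -/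

section Extension

variable {t : ℂ}

/-- Identifies `Ω₀` as stated, with recursive tensor powers and values in the envelope, with
`omegaHom`. -/
theorem omegaMap_f {X Y : RepZero t} (f : X ⟶ Y) :
    (omegaMap (2 * t) (k := X.n) (l := Y.n) f).f =
      (Mat_.embedding (ParZTwo (2 * t))).map (omegaHom f) := by
  induction f using diagram_induction
  case zero =>
    rw [omegaMap, map_zero, map_zero]; exact ((Mat_.embedding (ParZTwo (2 * t))).map_zero _ _).symm
  case add f f' hf hf' =>
    rw [map_add, Functor.map_add, ← hf, ← hf']
    exact congrArg Karoubi.Hom.f (map_add (Finsupp.linearCombination ℂ (omegaDiagram (2 * t))) f f')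
  case smul c f hf =>
    rw [map_smul]
    refine (congrArg Karoubi.Hom.f (map_smul (Finsupp.linearCombination ℂ
      (omegaDiagram (2 * t))) c f)).trans ((congrArg (c • ·) hf).trans ?_)
    ext
    rfl
  rename_i p
  have h : omegaMap (2 * t) (k := X.n) (l := Y.n) (Finsupp.single p 1 : EvenPartition X.n Y.n →₀ ℂ)
      = omegaDiagram (2 * t) p :=
    (Finsupp.linearCombination_single ℂ 1 p).trans (one_smul ℂ _)
  refine (congrArg Karoubi.Hom.f h).trans ?_
  rw [omegaHom_single, one_smul]
  have e : (summandMap (ofDiagram (2 * t) (uncoloured p.1)) :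
      omegaObj (2 * t) X.n ⟶ omegaObj (2 * t) Y.n).f =
      (Mat_.embedding (ParZTwo (2 * t))).map (sandwich (2 * t) p.1) := by
    change (Mat_.embedding (ParZTwo (2 * t))).map (ePow (2 * t) X.n ≫ _ ≫ ePow (2 * t) Y.n) = _
    rw [ePow_eq, ePow_eq]
    rfl
  refine (congrArg (coef p.1 • ·) e).trans ?_
  ext
  rfl

theorem extendsOmegaZero_stdOmega : ExtendsOmegaZero (stdOmega t) := by
  have h0 : ∀ X : RepZero t, omegaMat (𝟙 ((Mat_.embedding (RepZero t)).obj X)) =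
      (Mat_.embedding (ParZTwo (2 * t))).map (ePow (2 * t) X.n) := fun X => by
    rw [← (Mat_.embedding (RepZero t)).map_id, ePow_eq, ← omegaHom_id]
    rfl
  have h : ∀ k : ℕ, (stdOmega t).obj ((toEnvelope (RepZero t)).obj ⟨k⟩) = omegaObj (2 * t) k :=
    -- Both objects have the same underlying formal sum, and the idempotents agree because the
    -- identity of `[k]` goes to the tensor power of `e'`.
    fun k => Karoubi.ext rfl ((Category.comp_id _).trans ((h0 ⟨k⟩).trans (Category.id_comp _).symm))
  refine ⟨h, fun k l f => ?_⟩
  -- Identities in an idempotent completion are the idempotents themselves. The transports along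
  -- object equalities thus become `omegaMat` of an identity and are absorbed by `omegaMat_comp`.
  have h1 : ∀ (k : ℕ) (e : (stdOmega t).obj ((toEnvelope (RepZero t)).obj ⟨k⟩) =
      omegaObj (2 * t) k), (eqToHom e).f = omegaMat (𝟙 ((Mat_.embedding (RepZero t)).obj ⟨k⟩)) :=
    fun k e => (Karoubi.eqToHom_f e).trans (Category.comp_id _)
  have h2 : ∀ (k : ℕ) (e : omegaObj (2 * t) k =
      (stdOmega t).obj ((toEnvelope (RepZero t)).obj ⟨k⟩)),
      (eqToHom e).f = omegaMat (𝟙 ((Mat_.embedding (RepZero t)).obj ⟨k⟩)) :=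
    fun k e => (Karoubi.eqToHom_f e).trans ((Category.comp_id _).trans (h0 ⟨k⟩).symm)
  have h3 : omegaMat ((Mat_.embedding (RepZero t)).map f) = (omegaMap (2 * t) f).f :=
    (omegaMap_f f).symm
  refine Karoubi.hom_ext _ _ ?_
  refine Eq.trans ?_ (congrArg₂ (fun a b => a ≫ (omegaMap (2 * t) f).f ≫ b) (h1 k (h k))
    (h2 l (h l).symm)).symm
  rw [← h3]
  refine Eq.trans ?_ (congrArg _ (omegaMat_comp ((Mat_.embedding (RepZero t)).map f) (𝟙 _)))
  refine Eq.trans ?_ (omegaMat_comp (𝟙 _) ((Mat_.embedding (RepZero t)).map f ≫ 𝟙 _))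
  rw [Category.comp_id, Category.id_comp]
  rfl

end Extension

/-- Two extensions take equal values on the objects `[k]`. The transports along these equalities are
natural, since both functors restrict to `Ω₀`, and the resulting isomorphism extends to the envelope
by additivity. -/
theorem nonempty_iso_of_extendsOmegaZero {t : ℂ} {Ω Ω' : RepH t ⥤ ParKar (2 * t)} [Ω.Additive]
    [Ω'.Additive] (h : ExtendsOmegaZero Ω) (h' : ExtendsOmegaZero Ω') : Nonempty (Ω ≅ Ω') := by
  obtain ⟨h, hm⟩ := h
  obtain ⟨h', hm'⟩ := h'
  refine ⟨extendIsoToKaroubi Ω Ω' (NatIso.ofComponents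
    (fun X => eqToIso ((h X.n).trans (h' X.n).symm)) fun {X Y} f => ?_)⟩
  refine (congrArg (· ≫ eqToHom ((h Y.n).trans (h' Y.n).symm)) (hm X.n Y.n f)).trans (Eq.trans ?_
    (congrArg (eqToHom ((h X.n).trans (h' X.n).symm) ≫ ·) (hm' X.n Y.n f)).symm)
  simp

/-- The structure of a braided functor can be transported along an isomorphism of functors. -/
theorem nonempty_braided_of_iso {C D : Type*} [Category C] [Category D] [MonoidalCategory C]
    [MonoidalCategory D] [BraidedCategory C] [BraidedCategory D] {F G : C ⥤ D} [F.Braided]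
    (i : F ≅ G) : Nonempty G.Braided := by
  let hG : G.Monoidal := Functor.Monoidal.transport i
  exact ⟨{ toMonoidal := hG
           braided := fun X Y => by
            -- The transported constraint is that of `F` conjugated by `i`. Naturality of the
            -- braiding and of `i` moves the components of `i` aside, leaving the condition for `F`.
            rw [Functor.Monoidal.transport_μ, Functor.Monoidal.transport_μ, Category.assoc,
              Category.assoc, ← i.hom.naturality, ← BraidedCategory.braiding_naturality_assoc,
              Functor.LaxBraided.braided_assoc] }⟩

end PartitionDiagram

theorem mainTheorem1 (t : ℂ) :
    -- the functor on the generators `[k]` extends to an additive functor on the Karoubian envelopes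
    (∃ Ω : RepH t ⥤ ParKar (2 * t), Ω.Additive ∧ ExtendsOmegaZero Ω) ∧
    -- and every such extension is an equivalence of linear symmetric monoidal categories
    ∀ Ω : RepH t ⥤ ParKar (2 * t), Ω.Additive → ExtendsOmegaZero Ω →
      Ω.obj ((toEnvelope (RepZero t)).obj ⟨1⟩) =
          summand ⟨1⟩ (ePrime (2 * t)) (ePrime_comp (2 * t)) ∧
        Ω.Full ∧ Ω.Faithful ∧ Ω.EssSurj ∧ Ω.IsEquivalence ∧
        Ω.Linear ℂ ∧ Nonempty Ω.Braided := by
  refine ⟨⟨stdOmega t, inferInstance, extendsOmegaZero_stdOmega⟩, fun Ω _ hΩ => ?_⟩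
  -- Everything except the value on `[1]` is transported from `stdOmega`; that value is an equality
  -- of objects and is read off from the extension hypothesis.
  obtain ⟨i⟩ := nonempty_iso_of_extendsOmegaZero extendsOmegaZero_stdOmega hΩ
  have hfull : Ω.Full := Functor.Full.of_iso i
  have hfaithful : Ω.Faithful := Functor.Faithful.of_iso i
  have hess : Ω.EssSurj := Functor.essSurj_of_iso i
  refine ⟨?_, hfull, hfaithful, hess, {}, Functor.linear_of_iso ℂ i, nonempty_braided_of_iso i⟩
  refine (hΩ.1 1).trans ?_
  have h : ePow (2 * t) 1 = ePrime (2 * t) := (ePow_eq (2 * t) 1).trans (signIdem_one (2 * t))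
  simp only [omegaObj, h]
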